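/- **Setting.** Let $n\ge 2$, $A_n=\mathbb C[t_1,\dots,t_n]$, $d_i=\partial/\partial t_i$, and let $\mathfrak g$ be a finite-dimensional simple Lie algebra over $\mathbb C$ with a Cartan subalgebra $\mathfrak h$ and a base of its root system. Let $W_n=\mathrm{Der}_{\mathbb C}(A_n)$, let $S_n\subset W_n$ be the subalgebra of vector fields $\sum_i g_id_i$ with $\sum_i d_i(g_i)=0$, and, when $n=2m$, let $H_n\subset W_n$ be the subalgebra of vector fields that annihilate the 2-form $\sum_{i=1}^m dt_i\wedge dt_{m+i}$. Let $X_n$ be one of $W_n,S_n,H_n$ ($n=2m$ in the last case), and let $(X_n)_0$ be the subalgebra of vector fields in $X_n$ with homogeneous linear coefficients, so that $(X_n)_0\cong\mathfrak{gl}_n,\mathfrak{sl}_n,\mathfrak{sp}_n$ respectively. Let $\mathcal Z=\bigoplus_{i=1}^n A_nK_i$ and $\mathfrak L(\mathfrak g,X_n)=(\mathfrak g\otimes A_n\oplus\mathcal Z)\rtimes X_n$, with brackets $[x\otimes f,y\otimes g]=[x,y]\otimes fg$, $[\mathcal Z,\mathfrak g\otimes A_n\oplus\mathcal Z]=0$,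 $[D,x\otimes f]=x\otimes D(f)$, $[D,fK_i]=D(f)K_i$ for $x,y\in\mathfrak g$, $f,g\in A_n$, $D\in X_n$, and the commutator on $X_n$. Its degree-zero subalgebra is $\mathfrak L(\mathfrak g,X_n)_0=\mathfrak g\oplus\mathrm{span}\{K_1,\dots,K_n\}\oplus (X_n)_0$. For an $\mathfrak L(\mathfrak g,X_n)_0$-module $V$, the *Shen–Larsson module* is $A_n\otimes V$ with $$(x\otimes f)(g\otimes v)=fg\otimes xv,\qquad (fK_i)(g\otimes v)=fg\otimes K_iv,$$ $$D(g\otimes v)=D(g)\otimes v+\sum_{i,j}d_i(D(t_j))\,g\otimes(t_id_j)v\qquad(D\in X_n),$$ where for $X_n=S_n,H_n$ the last sum is understood through the fact that $\sum_{i,j}d_i(D(t_j))\otimes t_id_j$ lies in $A_n\otimes (X_n)_0$. Let $\mathfrak h_X$ be the space of diagonal elements $\sum_i a_it_id_i$ of $(X_n)_0$, let $\epsilon_i\in\mathfrak h_X^*$ be the coefficient of $t_id_i$, and let $\mathfrak n_X^+\subset(X_n)_0$ be spanned by the $t_id_j$ $(1\le i<j\le n)$ if $X=W,S$, and by the $t_id_j-t_{j+m}d_{i+m}$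 $(1\le i<j\le m)$ and $t_id_{j+m}+t_jd_{i+m}$ $(1\le i\le j\le m)$ if $X=H$. For $\lambda\in\mathfrak h^*$, $\mu\in\mathfrak h_X^*$ and $\mathbf c\in\mathbb C^n$ write $V\cong L^0_X(\lambda,\mu,\mathbf c)$ if $V$ is a finite-dimensional irreducible $\mathfrak L(\mathfrak g,X_n)_0$-module with a highest weight vector of weight $(\lambda,\mu)$ (nonzero, killed by the positive root spaces of $\mathfrak g$ and by $\mathfrak n_X^+$) on which each $K_i$ acts by the scalar $c_i$; then put $\mathcal V_X(\lambda,\mu,\mathbf c)=A_n\otimes L^0_X(\lambda,\mu,\mathbf c)$. Let $n_X=n,\,n-1,\,m$ for $X=W,S,H$, and $\mu_k=\epsilon_1+\dots+\epsilon_k$, $\mu_0=0$. **Theorem.** Let $V$ be an irreducible $\mathfrak L(\mathfrak g,X_n)_0$-module. 1. If $V\not\cong L^0_X(0,\mu_k,\mathbf 0)$ for every $0\le k\le n_X$, then the $\mathfrak L(\mathfrak g,X_n)$-module $A_n\otimes V$ is irreducible. 2. If $X=W$ and $V\cong L^0_W(0,\mu_n,\mathbf 0)$, then $A_n\otimes V$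 is irreducible. 3. If $V\cong L^0_X(0,\mu_k,\mathbf 0)$ for some $0\le k\le n_X$ with $k\ne n$, then $A_n\otimes V$ is reducible. In particular, if $\dim V$ is infinite, then $A_n\otimes V$ is irreducible. Further, if $V\cong L^0_X(\lambda,\mu,\mathbf c)$, then $\mathcal V_X(\lambda,\mu,\mathbf c)=A_n\otimes V$ is reducible if and only if $(\lambda,\mu,\mathbf c)=(0,\mu_k,\mathbf 0)$ for some $0\le k\le n_X$ and, in the case $X=W$, $\mu\ne\mu_n$. -/

import Mathlib

open scoped TensorProduct

namespace PolyToroidal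

noncomputable section

/-- `A_n = ℂ[t_1, …, t_n]`. It is a type synonym of `MvPolynomial (Fin n) ℂ`, so that it carries
exactly one ring and one algebra structure. -/
def Poly (n : ℕ) : Type := MvPolynomial (Fin n) ℂ

instance (n : ℕ) : CommRing (Poly n) := inferInstanceAs (CommRing (MvPolynomial (Fin n) ℂ))
instance (n : ℕ) : Algebra ℂ (Poly n) := inferInstanceAs (Algebra ℂ (MvPolynomial (Fin n) ℂ))

/-- The identification of `A_n` with Mathlib's polynomial ring. -/
def Poly.equiv (n : ℕ) : Poly n ≃ₐ[ℂ] MvPolynomial (Fin n) ℂ := AlgEquiv.refl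

/-- The variable `t_i`. -/
def t {n : ℕ} (i : Fin n) : Poly n := (MvPolynomial.X i : MvPolynomial (Fin n) ℂ)

/-- The monomials `t^r`, as a basis of `A_n`. -/
def monomials (n : ℕ) : Module.Basis (Fin n →₀ ℕ) ℂ (Poly n) :=
  MvPolynomial.basisMonomials (Fin n) ℂ

/-- The homogeneous polynomials of degree `k`. -/
def homogeneous (n k : ℕ) : Submodule ℂ (Poly n) := MvPolynomial.homogeneousSubmodule (Fin n) ℂ k

/-- `W_n`, the Lie algebra of all `ℂ`-linear derivations of `A_n` (polynomial vector fields). -/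
abbrev Witt (n : ℕ) : Type := Derivation ℂ (Poly n) (Poly n)

/-- The vector field `d_i = ∂/∂t_i`. -/
def dd {n : ℕ} (i : Fin n) : Witt n :=
  (MvPolynomial.pderiv i : Derivation ℂ (MvPolynomial (Fin n) ℂ) (MvPolynomial (Fin n) ℂ))

/-- The vector field `t_i d_j`. -/
def td {n : ℕ} (i j : Fin n) : Witt n := t i • dd j

/-! ### Calculus of vector fields -/

lemma witt_ext {n : ℕ} {D E : Witt n} (h : ∀ i, D (t i) = E (t i)) : D = E :=
  MvPolynomial.derivation_ext (σ := Fin n) (R := ℂ) (A := MvPolynomial (Fin n) ℂ) h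

lemma dd_t {n : ℕ} (i j : Fin n) : dd i (t j) = if i = j then 1 else 0 := by
  have h := MvPolynomial.pderiv_X (R := ℂ) i j
  rw [Pi.single_apply] at h
  simp only [eq_comm (a := i)]
  exact h

lemma sum_witt_apply {n : ℕ} {ι : Type*} (s : Finset ι) (D : ι → Witt n) (f : Poly n) :
    (∑ k ∈ s, D k) f = ∑ k ∈ s, D k f := by
  classical
  induction s using Finset.induction_on with
  | empty => simp
  | insert a s ha ih => rw [Finset.sum_insert ha, Finset.sum_insert ha, Derivation.add_apply, ih]

lemma apply_eq_sum {n : ℕ} (D : Witt n) (f : Poly n) :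
    D f = ∑ k, D (t k) * dd k f := by
  have : D = ∑ k, D (t k) • dd k := by
    apply witt_ext
    intro i
    simp [sum_witt_apply, dd_t]
  conv_lhs => rw [this]
  simp [sum_witt_apply]

lemma dd_comm {n : ℕ} (i j : Fin n) (f : Poly n) : dd i (dd j f) = dd j (dd i f) := by
  have : (⁅dd i, dd j⁆ : Witt n) = 0 := by
    apply witt_ext
    intro k
    rw [Derivation.commutator_apply, dd_t, dd_t]
    split_ifs <;> simp
  have h := congrArg (fun D : Witt n => D f) this
  simpa [Derivation.commutator_apply, sub_eq_zero] using h

lemma dd_apply_apply {n : ℕ} (D : Witt n) (i : Fin n) (f : Poly n) :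
    dd i (D f) = D (dd i f) + ∑ k, dd i (D (t k)) * dd k f := by
  rw [apply_eq_sum D f, apply_eq_sum D (dd i f), map_sum, ← Finset.sum_add_distrib]
  refine Finset.sum_congr rfl fun k _ => ?_
  rw [Derivation.leibniz, dd_comm i k f]
  simp only [smul_eq_mul]
  ring

lemma dd_lie {n : ℕ} (u v : Witt n) (i j : Fin n) :
    dd i (⁅u, v⁆ (t j)) =
      u (dd i (v (t j))) - v (dd i (u (t j))) +
        ∑ k, (dd i (u (t k)) * dd k (v (t j)) -
          dd i (v (t k)) * dd k (u (t j))) := by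
  rw [Derivation.commutator_apply, map_sub, dd_apply_apply u i (v (t j)),
    dd_apply_apply v i (u (t j)),
    Finset.sum_sub_distrib]
  ring

/-! ### The Lie algebras `W_n`, `S_n`, `H_n` -/

/-- The divergence `∑ d_i(g_i)` of `∑ g_i d_i`. -/
def divergence {n : ℕ} (D : Witt n) : Poly n := ∑ i, dd i (D (t i))

/-- The index `i` of the first half `1, …, m` of `1, …, 2m`. -/
def lo {m : ℕ} (i : Fin m) : Fin (2 * m) := ⟨i, by omega⟩

/-- The index `m + i` of the second half of `1, …, 2m`. -/
def hi {m : ℕ} (i : Fin m) : Fin (2 * m) := ⟨m + i, by omega⟩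

/-- The value on two vector fields of the 2-form `ω = ∑_{i ≤ m} dt_i ∧ dt_{m+i}`. -/
def omega {m : ℕ} (E F : Witt (2 * m)) : Poly (2 * m) :=
  ∑ k : Fin m, (E (t (lo k)) * F (t (hi k)) -
    E (t (hi k)) * F (t (lo k)))

/-- The value on two vector fields of the Lie derivative of `ω` along `D`. -/
def lieOmega {m : ℕ} (D E F : Witt (2 * m)) : Poly (2 * m) :=
  D (omega E F) - omega ⁅D, E⁆ F - omega E ⁅D, F⁆

/-- `S_n`: the divergence-free vector fields. -/
def special (n : ℕ) : LieSubalgebra ℂ (Witt n) where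
  carrier := {D | divergence D = 0}
  zero_mem' := by simp [divergence]
  add_mem' {D E} hD hE := by
    have hD : ∑ i, dd i (D (t i)) = 0 := hD
    have hE : ∑ i, dd i (E (t i)) = 0 := hE
    change ∑ i, dd i ((D + E) (t i)) = 0
    simp only [Derivation.add_apply, map_add, Finset.sum_add_distrib]
    rw [hD, hE, add_zero]
  smul_mem' c D hD := by
    have hD : ∑ i, dd i (D (t i)) = 0 := hD
    change ∑ i, dd i ((c • D) (t i)) = 0
    simp only [Derivation.smul_apply, Derivation.map_smul, ← Finset.smul_sum]
    rw [hD, smul_zero]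
  lie_mem' {u v} hu hv := by
    have hu : ∑ i, dd i (u (t i)) = 0 := hu
    have hv : ∑ i, dd i (v (t i)) = 0 := hv
    change ∑ i, dd i (⁅u, v⁆ (t i)) = 0
    simp only [dd_lie, Finset.sum_add_distrib, Finset.sum_sub_distrib, ← map_sum, hu, hv,
      map_zero, sub_zero, zero_add]
    rw [Finset.sum_comm, sub_eq_zero]
    refine Finset.sum_congr rfl fun i _ => Finset.sum_congr rfl fun k _ => mul_comm _ _

lemma omega_add_left {m : ℕ} (E E' F : Witt (2 * m)) :
    omega (E + E') F = omega E F + omega E' F := by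
  simp only [omega, Derivation.add_apply, ← Finset.sum_add_distrib]
  exact Finset.sum_congr rfl fun _ _ => by ring

lemma omega_sub_left {m : ℕ} (E E' F : Witt (2 * m)) :
    omega (E - E') F = omega E F - omega E' F := by
  simp only [omega, Derivation.sub_apply, ← Finset.sum_sub_distrib]
  exact Finset.sum_congr rfl fun _ _ => by ring

lemma omega_smul_left {m : ℕ} (c : ℂ) (E F : Witt (2 * m)) :
    omega (c • E) F = c • omega E F := by
  simp only [omega, Derivation.smul_apply, Finset.smul_sum, smul_sub, smul_mul_assoc]

lemma omega_add_right {m : ℕ} (E F F' : Witt (2 * m)) :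
    omega E (F + F') = omega E F + omega E F' := by
  simp only [omega, Derivation.add_apply, ← Finset.sum_add_distrib]
  exact Finset.sum_congr rfl fun _ _ => by ring

lemma omega_sub_right {m : ℕ} (E F F' : Witt (2 * m)) :
    omega E (F - F') = omega E F - omega E F' := by
  simp only [omega, Derivation.sub_apply, ← Finset.sum_sub_distrib]
  exact Finset.sum_congr rfl fun _ _ => by ring

lemma omega_smul_right {m : ℕ} (c : ℂ) (E F : Witt (2 * m)) :
    omega E (c • F) = c • omega E F := by
  simp only [omega, Derivation.smul_apply, Finset.smul_sum, smul_sub, mul_smul_comm]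

/-- `H_{2m}`: the vector fields that annihilate the 2-form `ω`. -/
def hamiltonian (m : ℕ) : LieSubalgebra ℂ (Witt (2 * m)) where
  carrier := {D | ∀ E F, lieOmega D E F = 0}
  zero_mem' := by intro E F; simp [lieOmega, omega]
  add_mem' {D D'} hD hD' := by
    intro E F
    have h1 := hD E F
    have h2 := hD' E F
    simp only [lieOmega, add_lie, omega_add_left, omega_add_right, Derivation.add_apply] at *
    linear_combination h1 + h2
  smul_mem' c D hD := by
    intro E F
    have h1 := hD E F
    simp only [lieOmega, smul_lie, omega_smul_left, omega_smul_right,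
      Derivation.smul_apply, ← smul_sub] at *
    rw [h1, smul_zero]
  lie_mem' {u v} hu hv := by
    intro E F
    have hu : ∀ E F, u (omega E F) = omega ⁅u, E⁆ F + omega E ⁅u, F⁆ := fun E F => by
      have h := hu E F
      simp only [lieOmega] at h
      linear_combination h
    have hv : ∀ E F, v (omega E F) = omega ⁅v, E⁆ F + omega E ⁅v, F⁆ := fun E F => by
      have h := hv E F
      simp only [lieOmega] at h
      linear_combination h
    simp only [lieOmega, lie_lie, omega_sub_left, omega_sub_right, Derivation.commutator_apply,
      hu, hv, map_add]
    ring

/-- The three series of Lie algebras of vector fields; `H` is only defined for `n = 2m`. -/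
inductive Series : ℕ → Type
  | W (n : ℕ) : Series n
  | S (n : ℕ) : Series n
  | H (m : ℕ) : Series (2 * m)

/-- The Lie algebra `X_n ∈ {W_n, S_n, H_n}`. -/
def vf : {n : ℕ} → Series n → LieSubalgebra ℂ (Witt n)
  | _, .W _ => ⊤
  | _, .S n => special n
  | _, .H m => hamiltonian m

/-- `n_X = n, n - 1, m` for `X_n = W_n, S_n, H_n`. -/
def nX : {n : ℕ} → Series n → ℕ
  | _, .W n => n
  | _, .S n => n - 1
  | _, .H m => m

/-- `(W_n)_0`: the vector fields with homogeneous linear coefficients. -/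
def witt0 (n : ℕ) : LieSubalgebra ℂ (Witt n) where
  carrier := {D | ∀ j, D (t j) ∈ homogeneous n 1}
  zero_mem' := fun _ => (homogeneous n 1).zero_mem
  add_mem' hD hE := fun j => (homogeneous n 1).add_mem (hD j) (hE j)
  smul_mem' c _ hD := fun j => (homogeneous n 1).smul_mem c (hD j)
  lie_mem' {u v} hu hv := by
    have key : ∀ D E : Witt n, (∀ j, D (t j) ∈ homogeneous n 1) →
        (∀ j, E (t j) ∈ homogeneous n 1) → ∀ j, D (E (t j)) ∈ homogeneous n 1 := by
      intro D E hD hE j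
      rw [apply_eq_sum]
      refine Submodule.sum_mem _ fun k _ => ?_
      exact MvPolynomial.IsHomogeneous.mul (m := 1) (n := 0) (hD k)
        (MvPolynomial.IsHomogeneous.pderiv (hE j))
    intro j
    rw [Derivation.commutator_apply]
    exact (homogeneous n 1).sub_mem (key u v hu hv j) (key v u hv hu j)

/-- `(X_n)_0 = X_n ∩ (W_n)_0`, as a Lie algebra of vector fields. -/
abbrev vf0 {n : ℕ} (X : Series n) : LieSubalgebra ℂ (Witt n) := vf X ⊓ witt0 n

/-- The entry `M i j` of the matrix `M` with `D = ∑ M i j • t_i d_j`, for `D ∈ (W_n)_0`: the constant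
term of `∂_i (D t_j)`. -/
def entry {n : ℕ} (i j : Fin n) : Witt n →ₗ[ℂ] ℂ where
  toFun D := (monomials n).repr (dd i (D (t j))) 0
  map_add' D E := by simp
  map_smul' c D := by simp

/-! ### The Lie algebra `𝔏(𝔤, X_n)` -/

/-- The space `𝒵 = ⨁ A_n K_i` (`z` stands for `∑ z_i K_i`), as an abelian Lie algebra. -/
def Center (n : ℕ) : Type := Fin n → Poly n

instance (n : ℕ) : AddCommGroup (Center n) := inferInstanceAs (AddCommGroup (Fin n → Poly n))
instance (n : ℕ) : Module ℂ (Center n) := inferInstanceAs (Module ℂ (Fin n → Poly n))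

instance (n : ℕ) : LieRing (Center n) where
  bracket _ _ := 0
  add_lie _ _ _ := (add_zero 0).symm
  lie_add _ _ _ := (add_zero 0).symm
  lie_self _ := rfl
  leibniz_lie _ _ _ := (add_zero 0).symm

instance (n : ℕ) : LieAlgebra ℂ (Center n) where
  lie_smul _ _ _ := (smul_zero _).symm

lemma Center.lie_eq_zero {n : ℕ} (z w : Center n) : ⁅z, w⁆ = 0 := rfl

/-- A vector field acts on `∑ z_i K_i` through the coefficients. -/
def Center.act {n : ℕ} (D : Witt n) : Center n →ₗ[ℂ] Center n where
  toFun z := fun i => D (z i)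
  map_add' z w := funext fun i => map_add D (z i) (w i)
  map_smul' c z := funext fun i => D.map_smul c (z i)

lemma Center.act_apply {n : ℕ} (D : Witt n) (z : Center n) (i : Fin n) :
    Center.act D z i = D (z i) := rfl

variable (𝔤 : Type*) [LieRing 𝔤] [LieAlgebra ℂ 𝔤]

/-- The ideal `𝔤 ⊗ A_n ⊕ 𝒵`, with `𝒵` central. -/
abbrev Current (n : ℕ) : Type _ := (Poly n ⊗[ℂ] 𝔤) × Center n

/-- The action of a vector field on `𝔤 ⊗ A_n ⊕ 𝒵`, through the polynomial coefficients. -/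
def Current.act {n : ℕ} (D : Witt n) : LieDerivation ℂ (Current 𝔤 n) (Current 𝔤 n) where
  toLinearMap := (Lie.Derivation.ofDerivation 𝔤 D).toLinearMap.prodMap (Center.act D)
  leibniz' a b := by
    refine Prod.ext ?_ ?_
    · exact (Lie.Derivation.ofDerivation 𝔤 D).apply_lie_eq_sub a.1 b.1
    · change Center.act D ⁅a.2, b.2⁆ = ⁅a.2, Center.act D b.2⁆ - ⁅b.2, Center.act D a.2⁆
      simp [Center.lie_eq_zero]

lemma Current.act_fst {n : ℕ} (D : Witt n) (a : Current 𝔤 n) :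
    (Current.act 𝔤 D a).1 = Lie.Derivation.ofDerivation 𝔤 D a.1 := rfl

lemma Current.act_snd {n : ℕ} (D : Witt n) (a : Current 𝔤 n) :
    (Current.act 𝔤 D a).2 = Center.act D a.2 := rfl

/-- The action of `X_n` on `𝔤 ⊗ A_n ⊕ 𝒵`, as a homomorphism into the derivations. -/
def Current.actHom {n : ℕ} (X : Series n) :
    vf X →ₗ⁅ℂ⁆ LieDerivation ℂ (Current 𝔤 n) (Current 𝔤 n) where
  toFun D := Current.act 𝔤 D
  map_add' D E := by
    refine LieDerivation.ext fun a => Prod.ext ?_ ?_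
    · simp [Current.act_fst]
    · funext i
      rfl
  map_smul' c D := by
    refine LieDerivation.ext fun a => Prod.ext ?_ ?_
    · simp [Current.act_fst]
    · funext i
      rfl
  map_lie' {D E} := by
    refine LieDerivation.ext fun a => Prod.ext ?_ ?_
    · simp only [LieSubalgebra.coe_bracket, Current.act_fst, LieHom.map_lie,
        LieDerivation.commutator_apply, Prod.fst_sub]
    · funext i
      simp only [LieDerivation.commutator_apply, Prod.snd_sub, Current.act_snd]
      change ⁅(D : Witt n), (E : Witt n)⁆ (a.2 i) = D.1 (E.1 (a.2 i)) - E.1 (D.1 (a.2 i))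
      rw [Derivation.commutator_apply]

/-- The Lie algebra `𝔏(𝔤, X_n) = (𝔤 ⊗ A_n ⊕ 𝒵) ⋊ X_n`. -/
abbrev Toroidal {n : ℕ} (X : Series n) : Type _ :=
  LieAlgebra.SemiDirectSum (Current 𝔤 n) (vf X) (Current.actHom 𝔤 X)

variable {𝔤} in
lemma ofDerivation_one_tmul {n : ℕ} (D : Witt n) (x : 𝔤) :
    Lie.Derivation.ofDerivation 𝔤 D ((1 : Poly n) ⊗ₜ[ℂ] x) = 0 := by
  simp

/-- The degree zero component `𝔏(𝔤, X_n)_0 = 𝔤 ⊗ 1 ⊕ span{K_1, …, K_n} ⊕ (X_n)_0`. -/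
def toroidal0 {n : ℕ} (X : Series n) : LieSubalgebra ℂ (Toroidal 𝔤 X) where
  carrier := {Y | (∃ x : 𝔤, Y.left.1 = (1 : Poly n) ⊗ₜ[ℂ] x) ∧
    (∃ c : Fin n → ℂ, Y.left.2 = fun i => algebraMap ℂ (Poly n) (c i)) ∧ (Y.right : Witt n) ∈ witt0 n}
  zero_mem' := ⟨⟨0, (TensorProduct.tmul_zero _ _).symm⟩,
    ⟨0, funext fun _ => (map_zero (algebraMap ℂ (Poly n))).symm⟩, (witt0 n).zero_mem⟩
  add_mem' := by
    rintro Y Z ⟨⟨x, hx⟩, ⟨c, hc⟩, hY⟩ ⟨⟨y, hy⟩, ⟨d, hd⟩, hZ⟩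
    refine ⟨⟨x + y, ?_⟩, ⟨c + d, ?_⟩, (witt0 n).add_mem hY hZ⟩
    · simp [hx, hy, TensorProduct.tmul_add]
    · simp only [LieAlgebra.SemiDirectSum.add_eq_mk, Prod.snd_add, hc, hd]
      funext i
      exact (map_add (algebraMap ℂ (Poly n)) (c i) (d i)).symm
  smul_mem' := by
    rintro r Y ⟨⟨x, hx⟩, ⟨c, hc⟩, hY⟩
    refine ⟨⟨r • x, ?_⟩, ⟨r • c, ?_⟩, (witt0 n).smul_mem r hY⟩
    · simp [hx]
    · simp only [LieAlgebra.SemiDirectSum.smul_eq_mk, Prod.smul_snd, hc]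
      funext i
      change r • algebraMap ℂ (Poly n) (c i) = algebraMap ℂ (Poly n) (r * c i)
      rw [Algebra.smul_def, ← map_mul]
  lie_mem' := by
    rintro Y Z ⟨⟨x, hx⟩, ⟨c, hc⟩, hY⟩ ⟨⟨y, hy⟩, ⟨d, hd⟩, hZ⟩
    refine ⟨⟨⁅x, y⁆, ?_⟩, ⟨0, ?_⟩, (witt0 n).lie_mem hY hZ⟩
    · change ⁅Y.left.1, Z.left.1⁆ + Lie.Derivation.ofDerivation 𝔤 (Y.right : Witt n) Z.left.1 -
        Lie.Derivation.ofDerivation 𝔤 (Z.right : Witt n) Y.left.1 = _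
      rw [hx, hy, ofDerivation_one_tmul, ofDerivation_one_tmul]
      simp
    · change ⁅Y.left.2, Z.left.2⁆ + Center.act (Y.right : Witt n) Z.left.2 -
        Center.act (Z.right : Witt n) Y.left.2 = _
      rw [Center.lie_eq_zero, hc, hd]
      funext i
      change 0 + Y.right.1 (algebraMap ℂ (Poly n) (d i)) - Z.right.1 (algebraMap ℂ (Poly n) (c i)) =
        algebraMap ℂ (Poly n) 0
      simp

/-- The inclusion of `𝔤 = 𝔤 ⊗ 1` into `𝔏(𝔤, X_n)_0`. -/
def ofG {n : ℕ} (X : Series n) : 𝔤 →ₗ⁅ℂ⁆ toroidal0 𝔤 X where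
  toFun x := ⟨⟨((1 : Poly n) ⊗ₜ[ℂ] x, 0), 0⟩, ⟨x, rfl⟩,
    ⟨0, funext fun _ => (map_zero (algebraMap ℂ (Poly n))).symm⟩, (witt0 n).zero_mem⟩
  map_add' x y := by
    apply Subtype.ext
    simp [TensorProduct.tmul_add]
  map_smul' c x := by
    apply Subtype.ext
    simp
  map_lie' {x y} := by
    apply Subtype.ext
    simp

/-- The inclusion of `(X_n)_0` into `𝔏(𝔤, X_n)_0`. -/
def ofVf0 {n : ℕ} (X : Series n) : vf0 X →ₗ⁅ℂ⁆ toroidal0 𝔤 X where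
  toFun D := ⟨⟨0, ⟨D.1, D.2.1⟩⟩, ⟨0, (TensorProduct.tmul_zero _ _).symm⟩,
    ⟨0, funext fun _ => (map_zero (algebraMap ℂ (Poly n))).symm⟩, D.2.2⟩
  map_add' D E := by
    apply Subtype.ext
    simp
  map_smul' c D := by
    apply Subtype.ext
    simp
  map_lie' {D E} := by
    apply Subtype.ext
    simp
    rfl

/-- The central element `K_i` of `𝔏(𝔤, X_n)_0`. -/
def K {n : ℕ} (X : Series n) (i : Fin n) : toroidal0 𝔤 X :=
  ⟨⟨(0, (Pi.single i 1 : Fin n → Poly n)), 0⟩, ⟨0, (TensorProduct.tmul_zero _ _).symm⟩,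
    ⟨Pi.single i 1, by
      funext j
      by_cases h : j = i
      · subst h
        simp
      · simp [h]⟩, (witt0 n).zero_mem⟩

lemma K_lie {n : ℕ} (X : Series n) (i : Fin n) (Y : toroidal0 𝔤 X) : ⁅K 𝔤 X i, Y⁆ = 0 := by
  obtain ⟨Y, ⟨x, hx⟩, ⟨c, hc⟩, hY⟩ := Y
  apply Subtype.ext
  refine LieAlgebra.SemiDirectSum.ext (Prod.ext ?_ ?_) ?_
  · change ⁅(0 : Poly n ⊗[ℂ] 𝔤), Y.left.1⁆ + Lie.Derivation.ofDerivation 𝔤 (0 : Witt n) Y.left.1 -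
      Lie.Derivation.ofDerivation 𝔤 (Y.right : Witt n) 0 = 0
    simp
  · change ⁅(K 𝔤 X i).1.left.2, Y.left.2⁆ + Center.act (0 : Witt n) Y.left.2 -
      Center.act (Y.right : Witt n) (Pi.single i 1 : Fin n → Poly n) = 0
    rw [Center.lie_eq_zero]
    funext j
    change 0 + (0 : Witt n) (Y.left.2 j) - Y.right.1 ((Pi.single i 1 : Fin n → Poly n) j) = 0
    by_cases h : j = i
    · subst h
      simp
    · simp [h]
  · change ⁅(0 : vf X), Y.right⁆ = 0
    simp

lemma ofVf0_lie_ofG {n : ℕ} (X : Series n) (D : vf0 X) (x : 𝔤) :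
    ⁅ofVf0 𝔤 X D, ofG 𝔤 X x⁆ = 0 := by
  apply Subtype.ext
  refine LieAlgebra.SemiDirectSum.ext (Prod.ext ?_ ?_) ?_
  · change ⁅(0 : Poly n ⊗[ℂ] 𝔤), (1 : Poly n) ⊗ₜ[ℂ] x⁆ +
      Lie.Derivation.ofDerivation 𝔤 (D : Witt n) ((1 : Poly n) ⊗ₜ[ℂ] x) -
      Lie.Derivation.ofDerivation 𝔤 (0 : Witt n) 0 = 0
    rw [ofDerivation_one_tmul]
    simp
  · change ⁅(0 : Center n), (0 : Center n)⁆ + Center.act (D : Witt n) 0 -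
      Center.act (0 : Witt n) 0 = 0
    simp
  · change ⁅(⟨D.1, D.2.1⟩ : vf X), (0 : vf X)⁆ = 0
    simp

/-! ### Extension of scalars of a Lie module -/

section

variable {L V : Type*} [LieRing L] [LieAlgebra ℂ L] [AddCommGroup V] [Module ℂ V]
  [LieRingModule L V] [LieModule ℂ L V] {n : ℕ}

/-- The action `(f ⊗ Y) • (g ⊗ v) = f g ⊗ Y v` of `A_n ⊗ L` on `A_n ⊗ V`. -/
def tact : Poly n ⊗[ℂ] L →ₗ[ℂ] Poly n ⊗[ℂ] V →ₗ[ℂ] Poly n ⊗[ℂ] V :=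
  TensorProduct.map₂ (LinearMap.mul ℂ (Poly n)) (LieModule.toEnd ℂ L V : L →ₗ[ℂ] Module.End ℂ V)

lemma tact_tmul (f g : Poly n) (Y : L) (v : V) :
    tact (f ⊗ₜ[ℂ] Y) (g ⊗ₜ[ℂ] v) = (f * g) ⊗ₜ[ℂ] ⁅Y, v⁆ := rfl

lemma tact_tact (x y : Poly n ⊗[ℂ] L) (w : Poly n ⊗[ℂ] V) :
    tact x (tact y w) = tact (tact x y) w + tact y (tact x w) := by
  induction x using TensorProduct.induction_on with
  | zero => simp
  | add x x' hx hx' =>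
    simp only [map_add, LinearMap.add_apply, hx, hx']
    abel
  | tmul f Y =>
    induction y using TensorProduct.induction_on with
    | zero => simp
    | add y y' hy hy' =>
      simp only [map_add, LinearMap.add_apply, hy, hy']
      abel
    | tmul g Z =>
      induction w using TensorProduct.induction_on with
      | zero => simp
      | add w w' hw hw' =>
        simp only [map_add, hw, hw']
        abel
      | tmul h v =>
        simp only [tact_tmul]
        rw [leibniz_lie, TensorProduct.tmul_add, mul_assoc, mul_left_comm g f h]

lemma tact_skew (x y : Poly n ⊗[ℂ] L) : tact x y = -tact y x := by
  induction x using TensorProduct.induction_on with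
  | zero => simp
  | add x x' hx hx' =>
    simp only [map_add, LinearMap.add_apply, hx, hx', neg_add]
  | tmul f Y =>
    induction y using TensorProduct.induction_on with
    | zero => simp
    | add y y' hy hy' =>
      simp only [map_add, LinearMap.add_apply, hy, hy', neg_add]
    | tmul g Z => rw [tact_tmul, tact_tmul, ← TensorProduct.tmul_neg, lie_skew, mul_comm]

lemma rTensor_tact (D : Witt n) (x : Poly n ⊗[ℂ] L) (w : Poly n ⊗[ℂ] V) :
    D.toLinearMap.rTensor V (tact x w) =
      tact (D.toLinearMap.rTensor L x) w + tact x (D.toLinearMap.rTensor V w) := by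
  induction x using TensorProduct.induction_on with
  | zero => simp
  | add x x' hx hx' =>
    simp only [map_add, LinearMap.add_apply, hx, hx']
    abel
  | tmul f Y =>
    induction w using TensorProduct.induction_on with
    | zero => simp
    | add w w' hw hw' =>
      simp only [map_add, hw, hw']
      abel
    | tmul g v =>
      simp only [LinearMap.rTensor_tmul, tact_tmul]
      rw [← TensorProduct.add_tmul]
      congr 1
      change D (f * g) = D f * g + f * D g
      rw [Derivation.leibniz, smul_eq_mul, smul_eq_mul]
      ring

lemma rTensor_commutator (D E : Witt n) (w : Poly n ⊗[ℂ] V) :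
    (⁅D, E⁆ : Witt n).toLinearMap.rTensor V w =
      D.toLinearMap.rTensor V (E.toLinearMap.rTensor V w) -
        E.toLinearMap.rTensor V (D.toLinearMap.rTensor V w) := by
  induction w using TensorProduct.induction_on with
  | zero => simp
  | add x y hx hy =>
    simp only [map_add, hx, hy]
    abel
  | tmul g v =>
    simp only [LinearMap.rTensor_tmul]
    rw [← TensorProduct.sub_tmul]
    rfl

end

/-! ### The Jacobian of a vector field, with values in `A_n ⊗ (X_n)_0` -/

/-- The coefficient of `t^r` in `∑ ∂_i (D t_j) ⊗ t_i d_j ∈ A_n ⊗ (W_n)_0`. -/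
def jetW {n : ℕ} (r : Fin n →₀ ℕ) (D : Witt n) : Witt n :=
  ∑ i, ∑ j, (monomials n).repr (dd i (D (t j))) r • td i j

lemma jetW_t {n : ℕ} (r : Fin n →₀ ℕ) (D : Witt n) (j : Fin n) :
    jetW r D (t j) = ∑ i, (monomials n).repr (dd i (D (t j))) r • t i := by
  simp [jetW, sum_witt_apply, td, dd_t]

lemma dd_jetW_t {n : ℕ} (r : Fin n →₀ ℕ) (D : Witt n) (i j : Fin n) :
    dd i (jetW r D (t j)) = algebraMap ℂ (Poly n) ((monomials n).repr (dd i (D (t j))) r) := by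
  simp [jetW_t, dd_t, Algebra.smul_def]

lemma lieOmega_eq {m : ℕ} (D E F : Witt (2 * m)) : lieOmega D E F =
    ∑ k : Fin m, (E (D (t (lo k))) * F (t (hi k)) + E (t (lo k)) * F (D (t (hi k))) -
      E (D (t (hi k))) * F (t (lo k)) - E (t (hi k)) * F (D (t (lo k)))) := by
  simp only [lieOmega, omega, map_sum, ← Finset.sum_sub_distrib]
  refine Finset.sum_congr rfl fun k _ => ?_
  simp only [map_sub, Derivation.leibniz, Derivation.commutator_apply, smul_eq_mul]
  ring

lemma mul_eq_sum {n : ℕ} (E F : Witt n) (f g : Poly n) :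
    E f * F g = ∑ a, ∑ b, (E (t a) * F (t b)) * (dd a f * dd b g) := by
  rw [apply_eq_sum E f, apply_eq_sum F g, Finset.sum_mul_sum]
  exact Finset.sum_congr rfl fun a _ => Finset.sum_congr rfl fun b _ => by ring

lemma lieOmega_eq_sum {m : ℕ} (D E F : Witt (2 * m)) : lieOmega D E F =
    ∑ a, ∑ b, (E (t a) * F (t b)) * lieOmega D (dd a) (dd b) := by
  simp only [lieOmega_eq, Finset.mul_sum]
  have h : ∀ (f : Fin (2 * m) → Fin (2 * m) → Fin m → Poly (2 * m)),
      ∑ a, ∑ b, ∑ k, f a b k = ∑ k, ∑ a, ∑ b, f a b k := by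
    intro f
    simp only [Finset.sum_comm (s := (Finset.univ : Finset (Fin (2 * m))))
      (t := (Finset.univ : Finset (Fin m)))]
  rw [h]
  refine Finset.sum_congr rfl fun k _ => ?_
  rw [mul_eq_sum E F, mul_eq_sum E F, mul_eq_sum E F, mul_eq_sum E F]
  simp only [← Finset.sum_add_distrib, ← Finset.sum_sub_distrib]
  refine Finset.sum_congr rfl fun a _ => Finset.sum_congr rfl fun b _ => ?_
  ring

lemma lieOmega_jetW {m : ℕ} (r : Fin (2 * m) →₀ ℕ) (D : Witt (2 * m)) (a b : Fin (2 * m)) :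
    lieOmega (jetW r D) (dd a) (dd b) = algebraMap ℂ (Poly (2 * m))
      ((monomials (2 * m)).repr (lieOmega D (dd a) (dd b)) r) := by
  simp only [lieOmega_eq, map_sum, Finsupp.coe_finsetSum, Finset.sum_apply]
  refine Finset.sum_congr rfl fun k _ => ?_
  simp only [dd_jetW_t, dd_t, map_add, map_sub, Finsupp.add_apply, Finsupp.sub_apply]
  split_ifs <;> simp

lemma jetW_mem {n : ℕ} (X : Series n) (r : Fin n →₀ ℕ) (D : Witt n) (hD : D ∈ vf X) :
    jetW r D ∈ vf0 X := by
  refine ⟨?_, fun j => ?_⟩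
  · cases X with
    | W n => trivial
    | S n =>
      have hD : ∑ i, dd i (D (t i)) = 0 := hD
      change ∑ i, dd i (jetW r D (t i)) = 0
      simp only [dd_jetW_t]
      rw [← map_sum, ← Finsupp.finsetSum_apply, ← map_sum, hD]
      simp
    | H m =>
      intro E F
      rw [lieOmega_eq_sum]
      refine Finset.sum_eq_zero fun a _ => Finset.sum_eq_zero fun b _ => ?_
      rw [lieOmega_jetW, hD (dd a) (dd b)]
      simp
  · rw [jetW_t]
    exact Submodule.sum_mem _ fun i _ => Submodule.smul_mem _ _
      (MvPolynomial.isHomogeneous_X ℂ i)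

/-- The coefficient of `t^r` in the Jacobian `∑ ∂_i (D t_j) ⊗ t_i d_j` of `D ∈ X_n`; it lies in
`(X_n)_0`. -/
def jet {n : ℕ} (X : Series n) (r : Fin n →₀ ℕ) (D : vf X) : vf0 X :=
  ⟨jetW r D, jetW_mem X r D D.2⟩

/-- A finite set of exponents that contains all those occurring in the Jacobian of `D`. -/
def jetSupport {n : ℕ} (D : Witt n) : Finset (Fin n →₀ ℕ) :=
  Finset.univ.biUnion fun p : Fin n × Fin n => ((monomials n).repr (dd p.1 (D (t p.2)))).support

/-- The map `A_n ⊗ (X_n)_0 → A_n` induced by the matrix entry `(i, j)`. -/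
def entryA {n : ℕ} (X : Series n) (i j : Fin n) : Poly n ⊗[ℂ] vf0 X →ₗ[ℂ] Poly n :=
  (TensorProduct.rid ℂ (Poly n)).toLinearMap ∘ₗ
    ((entry i j) ∘ₗ (vf0 X).toSubmodule.subtype).lTensor (Poly n)

lemma entryA_tmul {n : ℕ} (X : Series n) (i j : Fin n) (f : Poly n) (D : vf0 X) :
    entryA X i j (f ⊗ₜ D) = entry i j (D : Witt n) • f := by
  simp [entryA]

lemma dd_eq_entry {n : ℕ} {D : Witt n} (hD : D ∈ witt0 n) (i j : Fin n) :
    dd i (D (t j)) = algebraMap ℂ (Poly n) (entry i j D) := by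
  have h : MvPolynomial.IsHomogeneous (dd i (D (t j)) : MvPolynomial (Fin n) ℂ) 0 :=
    MvPolynomial.IsHomogeneous.pderiv (n := 1) (hD j)
  exact MvPolynomial.totalDegree_eq_zero_iff_eq_C.mp
    ((MvPolynomial.totalDegree_zero_iff_isHomogeneous (σ := Fin n) (R := ℂ)).mpr h)

lemma eq_zero_of_entry {n : ℕ} {D : Witt n} (hD : D ∈ witt0 n) (h : ∀ i j, entry i j D = 0) :
    D = 0 := by
  apply witt_ext
  intro j
  have h1 : ∑ i : Fin n, (MvPolynomial.X i : MvPolynomial (Fin n) ℂ) *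
      MvPolynomial.pderiv i (D (t j) : MvPolynomial (Fin n) ℂ) =
      1 • (D (t j) : MvPolynomial (Fin n) ℂ) :=
    MvPolynomial.IsHomogeneous.sum_X_mul_pderiv (hD j)
  have h2 : ∀ i, MvPolynomial.pderiv i (D (t j) : MvPolynomial (Fin n) ℂ) = 0 := fun i => by
    have := dd_eq_entry hD i j
    rw [h i j, map_zero] at this
    exact this
  simp only [h2, mul_zero, Finset.sum_const_zero] at h1
  exact (h1.trans (one_smul ℕ (D (t j)))).symm

lemma algebraMap_injective (n : ℕ) : Function.Injective (algebraMap ℂ (Poly n)) :=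
  MvPolynomial.C_injective (Fin n) ℂ

lemma entry_lie {n : ℕ} {D E : Witt n} (hD : D ∈ witt0 n) (hE : E ∈ witt0 n) (i j : Fin n) :
    entry i j ⁅D, E⁆ = ∑ k, (entry i k D * entry k j E - entry i k E * entry k j D) := by
  apply algebraMap_injective n
  rw [← dd_eq_entry ((witt0 n).lie_mem hD hE), dd_lie, dd_eq_entry hD i j, dd_eq_entry hE i j,
    Derivation.map_algebraMap, Derivation.map_algebraMap, sub_zero, zero_add, map_sum]
  refine Finset.sum_congr rfl fun k _ => ?_
  rw [dd_eq_entry hD, dd_eq_entry hE, dd_eq_entry hD, dd_eq_entry hE, map_sub, map_mul, map_mul]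

lemma eq_zero_of_entryA {n : ℕ} {X : Series n} {x : Poly n ⊗[ℂ] vf0 X}
    (h : ∀ i j, entryA X i j x = 0) : x = 0 := by
  let e := TensorProduct.equivFinsuppOfBasisLeft (N := vf0 X) (monomials n)
  have key : ∀ (i j : Fin n) (r : Fin n →₀ ℕ) (y : Poly n ⊗[ℂ] vf0 X),
      entry i j (e y r : Witt n) = (monomials n).repr (entryA X i j y) r := by
    intro i j r y
    induction y using TensorProduct.induction_on with
    | zero => simp
    | tmul f D =>
      rw [entryA_tmul, TensorProduct.equivFinsuppOfBasisLeft_apply_tmul_apply]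
      simp [mul_comm]
    | add y z hy hz =>
      simp only [map_add, Finsupp.add_apply, ← hy, ← hz]
      exact map_add (entry i j) (e y r : Witt n) (e z r : Witt n)
  apply e.injective
  rw [map_zero]
  ext1 r
  apply Subtype.ext
  apply eq_zero_of_entry (e x r).2.2
  intro i j
  rw [key, h]
  simp

lemma eq_sum_monomials {n : ℕ} (f : Poly n) {s : Finset (Fin n →₀ ℕ)}
    (hs : ((monomials n).repr f).support ⊆ s) :
    f = ∑ r ∈ s, (monomials n).repr f r • monomials n r := by
  have h : ∑ r ∈ ((monomials n).repr f).support, (monomials n).repr f r • monomials n r = f := by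
    have h1 := (monomials n).linearCombination_repr f
    rwa [Finsupp.linearCombination_apply] at h1
  refine h.symm.trans (Finset.sum_subset hs fun r _ hr => ?_)
  rw [Finsupp.notMem_support_iff.mp hr, zero_smul]

lemma entryA_sum_jet {n : ℕ} (X : Series n) (D : vf X) (i j : Fin n) :
    entryA X i j (∑ r ∈ jetSupport (D : Witt n), monomials n r ⊗ₜ jet X r D) =
      dd i ((D : Witt n) (t j)) := by
  have hs : ((monomials n).repr (dd i ((D : Witt n) (t j)))).support ⊆ jetSupport (D : Witt n) := by
    intro r hr
    rw [jetSupport, Finset.mem_biUnion]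
    exact ⟨(i, j), Finset.mem_univ _, hr⟩
  rw [map_sum]
  rw [eq_sum_monomials (dd i ((D : Witt n) (t j))) hs]
  refine Finset.sum_congr rfl fun r _ => ?_
  rw [entryA_tmul]
  congr 1
  apply algebraMap_injective n
  rw [← dd_eq_entry (jet X r D).2.2]
  exact dd_jetW_t r D i j

/-- The Jacobian `∑ ∂_i (D t_j) ⊗ t_i d_j ∈ A_n ⊗ (X_n)_0` of a vector field `D ∈ X_n`, written as
`∑_r t^r ⊗ (coefficient of t^r)`. -/
def jacobian {n : ℕ} (X : Series n) : vf X →ₗ[ℂ] Poly n ⊗[ℂ] vf0 X where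
  toFun D := ∑ r ∈ jetSupport (D : Witt n), monomials n r ⊗ₜ jet X r D
  map_add' D E := by
    rw [← sub_eq_zero]
    apply eq_zero_of_entryA
    intro i j
    rw [map_sub, map_add, entryA_sum_jet, entryA_sum_jet, entryA_sum_jet]
    simp
  map_smul' c D := by
    rw [← sub_eq_zero]
    apply eq_zero_of_entryA
    intro i j
    rw [map_sub, RingHom.id_apply, map_smul, entryA_sum_jet, entryA_sum_jet]
    simp

lemma entryA_jacobian {n : ℕ} (X : Series n) (D : vf X) (i j : Fin n) :
    entryA X i j (jacobian X D) = dd i ((D : Witt n) (t j)) :=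
  entryA_sum_jet X D i j

lemma entryA_act {n : ℕ} (X : Series n) (D : Witt n) (x : Poly n ⊗[ℂ] vf0 X) (i j : Fin n) :
    entryA X i j (D.toLinearMap.rTensor (vf0 X) x) = D (entryA X i j x) := by
  induction x using TensorProduct.induction_on with
  | zero => simp
  | tmul f E =>
    rw [LinearMap.rTensor_tmul, entryA_tmul, entryA_tmul]
    exact (D.map_smul _ _).symm
  | add x y hx hy => simp only [map_add, hx, hy]

lemma entryA_tact {n : ℕ} (X : Series n) (x y : Poly n ⊗[ℂ] vf0 X) (i j : Fin n) :
    entryA X i j (tact x y) = ∑ k, (entryA X i k x * entryA X k j y -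
      entryA X i k y * entryA X k j x) := by
  induction x using TensorProduct.induction_on with
  | zero => simp
  | add x x' hx hx' =>
    rw [map_add, LinearMap.add_apply, map_add, hx, hx', ← Finset.sum_add_distrib]
    exact Finset.sum_congr rfl fun k _ => by simp only [map_add]; ring
  | tmul f D =>
    induction y using TensorProduct.induction_on with
    | zero => simp
    | add y y' hy hy' =>
      rw [map_add, map_add, hy, hy', ← Finset.sum_add_distrib]
      exact Finset.sum_congr rfl fun k _ => by simp only [map_add]; ring
    | tmul g E =>
      rw [tact_tmul, entryA_tmul, LieSubalgebra.coe_bracket,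
        entry_lie D.2.2 E.2.2, Finset.sum_smul]
      refine Finset.sum_congr rfl fun k _ => ?_
      simp only [entryA_tmul, Algebra.smul_def, map_sub, map_mul]
      ring

lemma jacobian_lie {n : ℕ} (X : Series n) (D E : vf X) :
    jacobian X ⁅D, E⁆ = tact (jacobian X D) (jacobian X E) +
      (D : Witt n).toLinearMap.rTensor (vf0 X) (jacobian X E) -
      (E : Witt n).toLinearMap.rTensor (vf0 X) (jacobian X D) := by
  rw [← sub_eq_zero]
  apply eq_zero_of_entryA
  intro i j
  simp only [map_sub, map_add, entryA_act, entryA_tact, entryA_jacobian]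
  rw [LieSubalgebra.coe_bracket, dd_lie]
  ring

/-! ### The Shen–Larsson modules -/

/-- The map `∑ z_i K_i ↦ ∑ z_i ⊗ K_i`. -/
def centerSymbol {n : ℕ} (X : Series n) : Center n →ₗ[ℂ] Poly n ⊗[ℂ] toroidal0 𝔤 X where
  toFun z := ∑ i, z i ⊗ₜ K 𝔤 X i
  map_add' z w := by
    rw [← Finset.sum_add_distrib]
    exact Finset.sum_congr rfl fun i _ => TensorProduct.add_tmul (z i) (w i) _
  map_smul' c z := by
    rw [Finset.smul_sum]
    exact Finset.sum_congr rfl fun i _ => (TensorProduct.smul_tmul' c (z i) _).symm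

lemma centerSymbol_apply {n : ℕ} (X : Series n) (z : Center n) :
    centerSymbol 𝔤 X z = ∑ i, z i ⊗ₜ K 𝔤 X i := rfl

lemma centerSymbol_tact {n : ℕ} (X : Series n) (z : Center n) (x : Poly n ⊗[ℂ] toroidal0 𝔤 X) :
    tact (centerSymbol 𝔤 X z) x = 0 := by
  rw [centerSymbol_apply, map_sum, LinearMap.sum_apply]
  refine Finset.sum_eq_zero fun i _ => ?_
  induction x using TensorProduct.induction_on with
  | zero => simp
  | tmul f Y => rw [tact_tmul, K_lie, TensorProduct.tmul_zero]
  | add x y hx hy => rw [map_add, hx, hy, add_zero]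

lemma tact_centerSymbol {n : ℕ} (X : Series n) (z : Center n) (x : Poly n ⊗[ℂ] toroidal0 𝔤 X) :
    tact x (centerSymbol 𝔤 X z) = 0 := by
  rw [tact_skew, centerSymbol_tact, neg_zero]

lemma centerSymbol_act {n : ℕ} (X : Series n) (D : Witt n) (z : Center n) :
    D.toLinearMap.rTensor (toroidal0 𝔤 X) (centerSymbol 𝔤 X z) =
      centerSymbol 𝔤 X (Center.act D z) := by
  rw [centerSymbol_apply, centerSymbol_apply, map_sum]
  rfl

/-- The map `f ⊗ x ↦ f ⊗ x` from `A_n ⊗ 𝔤` to `A_n ⊗ 𝔏(𝔤, X_n)_0`. -/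
def gSymbol {n : ℕ} (X : Series n) : Poly n ⊗[ℂ] 𝔤 →ₗ[ℂ] Poly n ⊗[ℂ] toroidal0 𝔤 X :=
  (ofG 𝔤 X : 𝔤 →ₗ[ℂ] toroidal0 𝔤 X).lTensor (Poly n)

lemma gSymbol_tmul {n : ℕ} (X : Series n) (f : Poly n) (x : 𝔤) :
    gSymbol 𝔤 X (f ⊗ₜ x) = f ⊗ₜ ofG 𝔤 X x := rfl

/-- The map `f ⊗ D ↦ f ⊗ D` from `A_n ⊗ (X_n)_0` to `A_n ⊗ 𝔏(𝔤, X_n)_0`. -/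
def vfSymbol {n : ℕ} (X : Series n) : Poly n ⊗[ℂ] vf0 X →ₗ[ℂ] Poly n ⊗[ℂ] toroidal0 𝔤 X :=
  (ofVf0 𝔤 X : vf0 X →ₗ[ℂ] toroidal0 𝔤 X).lTensor (Poly n)

lemma vfSymbol_tmul {n : ℕ} (X : Series n) (f : Poly n) (D : vf0 X) :
    vfSymbol 𝔤 X (f ⊗ₜ D) = f ⊗ₜ ofVf0 𝔤 X D := rfl

lemma gSymbol_act {n : ℕ} (X : Series n) (D : Witt n) (x : Poly n ⊗[ℂ] 𝔤) :
    D.toLinearMap.rTensor (toroidal0 𝔤 X) (gSymbol 𝔤 X x) =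
      gSymbol 𝔤 X (D.toLinearMap.rTensor 𝔤 x) := by
  induction x using TensorProduct.induction_on with
  | zero => simp
  | tmul f x => rfl
  | add x y hx hy => simp only [map_add, hx, hy]

lemma vfSymbol_act {n : ℕ} (X : Series n) (D : Witt n) (x : Poly n ⊗[ℂ] vf0 X) :
    D.toLinearMap.rTensor (toroidal0 𝔤 X) (vfSymbol 𝔤 X x) =
      vfSymbol 𝔤 X (D.toLinearMap.rTensor (vf0 X) x) := by
  induction x using TensorProduct.induction_on with
  | zero => simp
  | tmul f x => rfl
  | add x y hx hy => simp only [map_add, hx, hy]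

lemma gSymbol_lie {n : ℕ} (X : Series n) (x y : Poly n ⊗[ℂ] 𝔤) :
    gSymbol 𝔤 X ⁅x, y⁆ = tact (gSymbol 𝔤 X x) (gSymbol 𝔤 X y) := by
  induction x using TensorProduct.induction_on with
  | zero => simp
  | add x x' hx hx' => rw [add_lie, map_add, hx, hx', map_add, map_add, LinearMap.add_apply]
  | tmul f x =>
    induction y using TensorProduct.induction_on with
    | zero => simp
    | add y y' hy hy' => rw [lie_add, map_add, hy, hy', map_add, map_add]
    | tmul g y =>
      rw [LieAlgebra.ExtendScalars.bracket_tmul, gSymbol_tmul, gSymbol_tmul, gSymbol_tmul,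
        tact_tmul, LieHom.map_lie]

lemma vfSymbol_tact {n : ℕ} (X : Series n) (x y : Poly n ⊗[ℂ] vf0 X) :
    vfSymbol 𝔤 X (tact x y) = tact (vfSymbol 𝔤 X x) (vfSymbol 𝔤 X y) := by
  induction x using TensorProduct.induction_on with
  | zero => simp
  | add x x' hx hx' => simp only [map_add, LinearMap.add_apply, hx, hx']
  | tmul f x =>
    induction y using TensorProduct.induction_on with
    | zero => simp
    | add y y' hy hy' => simp only [map_add, hy, hy']
    | tmul g y =>
      rw [tact_tmul, vfSymbol_tmul, vfSymbol_tmul, vfSymbol_tmul, tact_tmul, LieHom.map_lie]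

lemma vfSymbol_tact_gSymbol {n : ℕ} (X : Series n) (x : Poly n ⊗[ℂ] vf0 X)
    (a : Poly n ⊗[ℂ] 𝔤) : tact (vfSymbol 𝔤 X x) (gSymbol 𝔤 X a) = 0 := by
  induction x using TensorProduct.induction_on with
  | zero => simp
  | add x y hx hy => rw [map_add, map_add, LinearMap.add_apply, hx, hy, add_zero]
  | tmul f D =>
    induction a using TensorProduct.induction_on with
    | zero => simp
    | add x y hx hy => rw [map_add, map_add, hx, hy, add_zero]
    | tmul g y =>
      rw [vfSymbol_tmul, gSymbol_tmul, tact_tmul, ofVf0_lie_ofG, TensorProduct.tmul_zero]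

/-- The `A_n ⊗ 𝔏(𝔤, X_n)_0`-part of the Shen–Larsson action:
`f ⊗ x ↦ f ⊗ x`, `f K_i ↦ f ⊗ K_i`, and `D ↦ ∑ ∂_i (D t_j) ⊗ t_i d_j`. -/
def symbol {n : ℕ} (X : Series n) : Toroidal 𝔤 X →ₗ[ℂ] Poly n ⊗[ℂ] toroidal0 𝔤 X where
  toFun Y := gSymbol 𝔤 X Y.left.1 + centerSymbol 𝔤 X Y.left.2 +
    vfSymbol 𝔤 X (jacobian X Y.right)
  map_add' Y Z := by
    simp only [LieAlgebra.SemiDirectSum.add_eq_mk, Prod.fst_add, Prod.snd_add, map_add]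
    abel
  map_smul' c Y := by
    simp only [LieAlgebra.SemiDirectSum.smul_eq_mk, Prod.smul_fst, Prod.smul_snd, map_smul,
      smul_add, RingHom.id_apply]

lemma symbol_lie {n : ℕ} (X : Series n) (Y Z : Toroidal 𝔤 X) :
    symbol 𝔤 X ⁅Y, Z⁆ = tact (symbol 𝔤 X Y) (symbol 𝔤 X Z) +
      (Y.right : Witt n).toLinearMap.rTensor (toroidal0 𝔤 X) (symbol 𝔤 X Z) -
      (Z.right : Witt n).toLinearMap.rTensor (toroidal0 𝔤 X) (symbol 𝔤 X Y) := by
  have h1 : (⁅Y, Z⁆ : Toroidal 𝔤 X).left.1 = ⁅Y.left.1, Z.left.1⁆ +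
      (Y.right : Witt n).toLinearMap.rTensor 𝔤 Z.left.1 -
      (Z.right : Witt n).toLinearMap.rTensor 𝔤 Y.left.1 := rfl
  have h2 : (⁅Y, Z⁆ : Toroidal 𝔤 X).left.2 = 0 + Center.act (Y.right : Witt n) Z.left.2 -
      Center.act (Z.right : Witt n) Y.left.2 := rfl
  have h3 : (⁅Y, Z⁆ : Toroidal 𝔤 X).right = ⁅Y.right, Z.right⁆ := rfl
  have h4 : tact (gSymbol 𝔤 X Y.left.1) (vfSymbol 𝔤 X (jacobian X Z.right)) = 0 := by
    rw [tact_skew, vfSymbol_tact_gSymbol, neg_zero]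
  simp only [symbol, LinearMap.coe_mk, AddHom.coe_mk, h1, h2, h3, map_add, map_sub, map_zero,
    gSymbol_act, vfSymbol_act, centerSymbol_act, jacobian_lie, gSymbol_lie, vfSymbol_tact,
    LinearMap.add_apply, centerSymbol_tact, tact_centerSymbol, vfSymbol_tact_gSymbol, h4]
  abel

/-- The underlying space `A_n ⊗ V` of the Shen–Larsson module. -/
def ShenLarsson {n : ℕ} (_ : Series n) (V : Type*) [AddCommGroup V] [Module ℂ V] : Type _ :=
  Poly n ⊗[ℂ] V

instance {n : ℕ} (X : Series n) (V : Type*) [AddCommGroup V] [Module ℂ V] :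
    AddCommGroup (ShenLarsson X V) := inferInstanceAs (AddCommGroup (Poly n ⊗[ℂ] V))
instance {n : ℕ} (X : Series n) (V : Type*) [AddCommGroup V] [Module ℂ V] :
    Module ℂ (ShenLarsson X V) := inferInstanceAs (Module ℂ (Poly n ⊗[ℂ] V))

section

variable {n : ℕ} (X : Series n) (V : Type*) [AddCommGroup V] [Module ℂ V]
  [LieRingModule (toroidal0 𝔤 X) V] [LieModule ℂ (toroidal0 𝔤 X) V]

/-- The Shen–Larsson action of `Y = a + z + D ∈ 𝔏(𝔤, X_n)` on `A_n ⊗ V`: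
`f ⊗ x` acts by `g ⊗ v ↦ f g ⊗ x v`, `f K_i` by `g ⊗ v ↦ f g ⊗ K_i v`, and the vector field `D` by
`g ⊗ v ↦ D(g) ⊗ v + ∑ ∂_i (D t_j) g ⊗ (t_i d_j) v`, the sum being regrouped over monomials so that
only elements of `(X_n)_0` act on `V`. -/
def ShenLarsson.act (Y : Toroidal 𝔤 X) (w : Poly n ⊗[ℂ] V) : Poly n ⊗[ℂ] V :=
  (Y.right : Witt n).toLinearMap.rTensor V w + tact (symbol 𝔤 X Y) w

lemma ShenLarsson.act_add_left (Y Z : Toroidal 𝔤 X) (w : Poly n ⊗[ℂ] V) :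
    act 𝔤 X V (Y + Z) w = act 𝔤 X V Y w + act 𝔤 X V Z w := by
  have h : ((Y + Z).right : Witt n).toLinearMap.rTensor V =
      (Y.right : Witt n).toLinearMap.rTensor V + (Z.right : Witt n).toLinearMap.rTensor V :=
    LinearMap.rTensor_add V _ _
  simp only [act, map_add, LinearMap.add_apply, h]
  abel

lemma ShenLarsson.act_add_right (Y : Toroidal 𝔤 X) (w w' : Poly n ⊗[ℂ] V) :
    act 𝔤 X V Y (w + w') = act 𝔤 X V Y w + act 𝔤 X V Y w' := by
  simp only [act, map_add]
  abel

lemma ShenLarsson.act_smul_left (c : ℂ) (Y : Toroidal 𝔤 X) (w : Poly n ⊗[ℂ] V) :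
    act 𝔤 X V (c • Y) w = c • act 𝔤 X V Y w := by
  have h : ((c • Y).right : Witt n).toLinearMap.rTensor V =
      c • (Y.right : Witt n).toLinearMap.rTensor V := LinearMap.rTensor_smul V _ _
  simp only [act, map_smul, LinearMap.smul_apply, h, smul_add]

lemma ShenLarsson.act_smul_right (c : ℂ) (Y : Toroidal 𝔤 X) (w : Poly n ⊗[ℂ] V) :
    act 𝔤 X V Y (c • w) = c • act 𝔤 X V Y w := by
  simp only [act, map_smul, smul_add]

lemma ShenLarsson.act_act (Y Z : Toroidal 𝔤 X) (w : Poly n ⊗[ℂ] V) :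
    act 𝔤 X V Y (act 𝔤 X V Z w) = act 𝔤 X V ⁅Y, Z⁆ w + act 𝔤 X V Z (act 𝔤 X V Y w) := by
  have h : ((⁅Y, Z⁆ : Toroidal 𝔤 X).right : Witt n) = ⁅(Y.right : Witt n), (Z.right : Witt n)⁆ :=
    rfl
  simp only [act, h, rTensor_commutator, symbol_lie, map_add, map_sub,
    LinearMap.add_apply, LinearMap.sub_apply, rTensor_tact]
  rw [tact_tact (symbol 𝔤 X Y)]
  abel

instance : LieRingModule (Toroidal 𝔤 X) (ShenLarsson X V) where
  bracket Y w := ShenLarsson.act 𝔤 X V Y w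
  add_lie := ShenLarsson.act_add_left 𝔤 X V
  lie_add := ShenLarsson.act_add_right 𝔤 X V
  leibniz_lie := ShenLarsson.act_act 𝔤 X V

instance : LieModule ℂ (Toroidal 𝔤 X) (ShenLarsson X V) where
  smul_lie := ShenLarsson.act_smul_left 𝔤 X V
  lie_smul := ShenLarsson.act_smul_right 𝔤 X V

end

/-! ### Highest weights -/

/-- `𝔥_X`: the diagonal elements of `(X_n)_0`. -/
def cartan {n : ℕ} (X : Series n) : Submodule ℂ (vf0 X) :=
  (Submodule.span ℂ (Set.range fun i : Fin n => td i i)).comap (vf0 X).toSubmodule.subtype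

/-- The root vectors spanning `𝔫⁺_X`. -/
def posRootVectors : {n : ℕ} → Series n → Set (Witt n)
  | _, .W n => {D | ∃ i j : Fin n, i < j ∧ D = td i j}
  | _, .S n => {D | ∃ i j : Fin n, i < j ∧ D = td i j}
  | _, .H m => {D | ∃ i j : Fin m, i < j ∧ D = td (lo i) (lo j) - td (hi j) (hi i)} ∪
      {D | ∃ i j : Fin m, D = td (lo i) (hi j) + td (lo j) (hi i)}

/-- `𝔫⁺_X`. -/
def nPos {n : ℕ} (X : Series n) : Submodule ℂ (vf0 X) :=
  (Submodule.span ℂ (posRootVectors X)).comap (vf0 X).toSubmodule.subtype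

/-- The weight `ε_i` of `𝔥_X`: the coefficient of `t_i d_i`. -/
def eps {n : ℕ} (X : Series n) (i : Fin n) : Module.Dual ℂ (cartan X) :=
  entry i i ∘ₗ (vf0 X).toSubmodule.subtype ∘ₗ (cartan X).subtype

/-- The weight `μ_k = ε_1 + ⋯ + ε_k` of `𝔥_X`. -/
def mu {n : ℕ} (X : Series n) (k : ℕ) : Module.Dual ℂ (cartan X) :=
  ∑ i : Fin n with i.val < k, eps X i

variable {𝔤} in
/-- `V ≅ L⁰_X(λ, μ, c)`: `V` is the finite-dimensional irreducible `𝔏(𝔤, X_n)_0`-module of highest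
weight `(λ, μ)` on which each `K_i` acts by the scalar `c_i`. Positive roots of `𝔤` are taken with
respect to the Cartan subalgebra `𝔥` and the base `b` of the root system. -/
structure IsL0 [FiniteDimensional ℂ 𝔤] [LieAlgebra.IsSimple ℂ 𝔤] {𝔥 : LieSubalgebra ℂ 𝔤}
    [𝔥.IsCartanSubalgebra] (b : (LieAlgebra.IsKilling.rootSystem 𝔥).Base) {n : ℕ} (X : Series n)
    (l : Module.Dual ℂ 𝔥) (μ : Module.Dual ℂ (cartan X)) (c : Fin n → ℂ) (V : Type*)
    [AddCommGroup V] [Module ℂ V] [LieRingModule (toroidal0 𝔤 X) V]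
    [LieModule ℂ (toroidal0 𝔤 X) V] : Prop where
  irreducible : LieModule.IsIrreducible ℂ (toroidal0 𝔤 X) V
  finiteDimensional : FiniteDimensional ℂ V
  highestWeight : ∃ v : V, v ≠ 0 ∧
    (∀ α, b.IsPos α → ∀ x ∈ LieAlgebra.rootSpace 𝔥 α.1, ⁅ofG 𝔤 X x, v⁆ = 0) ∧
    (∀ h : 𝔥, ⁅ofG 𝔤 X h, v⁆ = l h • v) ∧
    (∀ D ∈ nPos X, ⁅ofVf0 𝔤 X D, v⁆ = 0) ∧
    (∀ D : cartan X, ⁅ofVf0 𝔤 X D, v⁆ = μ D • v)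
  central : ∀ (i : Fin n) (v : V), ⁅K 𝔤 X i, v⁆ = c i • v

end

end PolyToroidal

open PolyToroidal

/-!
The two halves of the theorem rest on the interpretation of the exceptional modules
`A_n ⊗ L⁰(0, μ_k, 0)` as differential `k`-forms.

*Irreducibility.* Let `p` be a proper nonzero submodule of `A_n ⊗ V`. The derivations `d_i` lower the
degree, so `p` contains a nonzero constant, hence all constants `1 ⊗ v` since `V` is irreducible
(`IsStable.one_tmul_mem`). On the other hand the vectors `v` with `A_n ⊗ v ⊆ p` form a proper
submodule of `V`, so there are none but zero (`IsStable.eq_zero_of_forall_tmul_mem`). Applying `x ⊗ f`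
and `f K_i` to `1 ⊗ v` shows that `𝔤` and the `K_i` act on `V` by zero. Alternating sums of products of
two vector fields, applied to `1 ⊗ v`, isolate the quadratic term: they give `g ⊗ E_ij² v ∈ p` for all
`g` (`IsStable.tmul_sq_mem`) with `i ≠ j` for `S` and with a long root vector `E_ij` for `H`, and
`g ⊗ (E_ij² - δ_ij E_ij) v ∈ p` for `W` (`IsStable.tmul_sq_sub_mem`). Hence `(X_n)_0` satisfies on `V`
the quadratic relations `QuadRel`.

These relations determine `V`, without any finiteness assumption. They make `𝔥_X` act by commuting
operators with `h³ = h`, which have a joint eigenvector of extremal weight; the submodule it generates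
is finite-dimensional (`QuadRel.exists_isHighestWeight`). They also leave only the values `0` and `1`
for the coefficients of the highest weight, and these decrease, so the weight is some `μ_k`
(`QuadRel.weight`). The case `μ_n` for `W` is that of the `n`-forms, where `𝔤𝔩_n` acts through the trace
and `g d_i` sends `1 ⊗ v` to `∂_i g ⊗ v`; as `∂_i` is surjective, the module is irreducible
(`isIrreducible_of_weight_top`).

*Reducibility.* If `V = L⁰(0, μ_k, 0)`, then `𝔤` acts by zero because highest weight vectors of weight
zero in a finite-dimensional module are invariant (`IsL0.ofG_eq_zero`). For `k ≠ n` the closed forms,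
the common kernel of the components `∑_a θ_ab ∂_a` of the exterior derivative (`extDeriv`), are a
submodule. It contains the constants, and it is proper since `θ ≠ 0` (`not_isIrreducible_of_theta`).
Stability under vector fields needs one relation between the operators `θ_ab`, a form of the symmetry
of second derivatives (`sum_theta_rep`). It is checked in the exterior algebra of `ℂⁿ` with creation
and annihilation operators (`sum_theta_fockRep`), and carries over to `V` because an irreducible module
satisfies the relations of every module with a highest weight vector of the same weight
(`exists_correspondence`).
-/

namespace PolyToroidal

noncomputable section

attribute [local instance] LieRing.ofAssociativeRing

/-! ### Linear vector fields as matrices -/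

/-- The linear vector field `∑ M i j • t_i d_j`. -/
def ofMatrix {n : ℕ} (M : Fin n → Fin n → ℂ) : Witt n := ∑ i, ∑ j, M i j • td i j

lemma ofMatrix_t {n : ℕ} (M : Fin n → Fin n → ℂ) (j : Fin n) :
    ofMatrix M (t j) = ∑ i, M i j • t i := by
  simp [ofMatrix, sum_witt_apply, td, dd_t]

lemma dd_ofMatrix_t {n : ℕ} (M : Fin n → Fin n → ℂ) (i j : Fin n) :
    dd i (ofMatrix M (t j)) = algebraMap ℂ (Poly n) (M i j) := by
  simp [ofMatrix_t, dd_t, Algebra.smul_def]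

lemma ofMatrix_mem_witt0 {n : ℕ} (M : Fin n → Fin n → ℂ) : ofMatrix M ∈ witt0 n := by
  intro j
  rw [ofMatrix_t]
  exact Submodule.sum_mem _ fun i _ => Submodule.smul_mem _ _ (MvPolynomial.isHomogeneous_X ℂ i)

@[simp]
lemma entry_ofMatrix {n : ℕ} (M : Fin n → Fin n → ℂ) (i j : Fin n) :
    entry i j (ofMatrix M) = M i j := by
  apply algebraMap_injective n
  rw [← dd_eq_entry (ofMatrix_mem_witt0 M), dd_ofMatrix_t]

lemma witt0_ext {n : ℕ} {D E : Witt n} (hD : D ∈ witt0 n) (hE : E ∈ witt0 n)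
    (h : ∀ i j, entry i j D = entry i j E) : D = E := by
  rw [← sub_eq_zero]
  exact eq_zero_of_entry ((witt0 n).sub_mem hD hE) fun i j => by rw [map_sub, h, sub_self]

lemma eq_ofMatrix {n : ℕ} {D : Witt n} (hD : D ∈ witt0 n) :
    D = ofMatrix (fun i j => entry i j D) :=
  witt0_ext hD (ofMatrix_mem_witt0 _) fun i j => by simp

lemma td_mem_witt0 {n : ℕ} (i j : Fin n) : td i j ∈ witt0 n := by
  intro k
  simp only [td, Derivation.smul_apply, dd_t, smul_eq_mul]
  split_ifs
  · rw [mul_one]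
    exact MvPolynomial.isHomogeneous_X ℂ i
  · rw [mul_zero]
    exact (homogeneous n 1).zero_mem

lemma entry_td {n : ℕ} (i j k l : Fin n) :
    entry i j (td k l) = if i = k ∧ j = l then 1 else 0 := by
  apply algebraMap_injective n
  rw [← dd_eq_entry (td_mem_witt0 k l)]
  simp only [td, Derivation.smul_apply, dd_t, smul_eq_mul]
  by_cases h1 : i = k <;> by_cases h2 : j = l <;> simp [h1, h2, Ne.symm, dd_t]

/-! ### The symplectic index involution -/

/-- The involution `i ↔ m + i` of the indices `1, …, 2m`. -/
def partner {m : ℕ} (a : Fin (2 * m)) : Fin (2 * m) :=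
  if h : a.val < m then ⟨a.val + m, by omega⟩ else ⟨a.val - m, by omega⟩

/-- The sign `1` on the first half of the indices `1, …, 2m` and `-1` on the second half. -/
def sgn {m : ℕ} (a : Fin (2 * m)) : ℂ := if a.val < m then 1 else -1

@[simp] lemma partner_lo {m : ℕ} (i : Fin m) : partner (lo i) = hi i := by
  ext; simp [partner, lo, hi, add_comm]

@[simp] lemma partner_hi {m : ℕ} (i : Fin m) : partner (hi i) = lo i := by
  ext; simp [partner, lo, hi]

@[simp] lemma sgn_lo {m : ℕ} (i : Fin m) : sgn (lo i) = 1 := by simp [sgn, lo]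

@[simp] lemma sgn_hi {m : ℕ} (i : Fin m) : sgn (hi i) = -1 := by simp [sgn, hi]

lemma eq_lo_or_eq_hi {m : ℕ} (a : Fin (2 * m)) : (∃ i, a = lo i) ∨ ∃ i, a = hi i := by
  by_cases h : a.val < m
  · exact Or.inl ⟨⟨a, h⟩, rfl⟩
  · exact Or.inr ⟨⟨a - m, by omega⟩, by ext; simp [hi]; omega⟩

@[simp] lemma lo_inj {m : ℕ} {i j : Fin m} : lo i = lo j ↔ i = j := by
  simp [lo, Fin.ext_iff]

@[simp] lemma hi_inj {m : ℕ} {i j : Fin m} : hi i = hi j ↔ i = j := by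
  simp [hi, Fin.ext_iff]

@[simp] lemma lo_ne_hi {m : ℕ} (i j : Fin m) : lo i ≠ hi j := by
  simp [lo, hi, Fin.ext_iff]; omega

@[simp] lemma hi_ne_lo {m : ℕ} (i j : Fin m) : hi i ≠ lo j := (lo_ne_hi j i).symm

@[simp] lemma partner_partner {m : ℕ} (a : Fin (2 * m)) : partner (partner a) = a := by
  obtain ⟨i, rfl⟩ | ⟨i, rfl⟩ := eq_lo_or_eq_hi a <;> simp

@[simp] lemma sgn_partner {m : ℕ} (a : Fin (2 * m)) : sgn (partner a) = -sgn a := by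
  obtain ⟨i, rfl⟩ | ⟨i, rfl⟩ := eq_lo_or_eq_hi a <;> simp

@[simp] lemma sgn_mul_sgn {m : ℕ} (a : Fin (2 * m)) : sgn a * sgn a = 1 := by
  obtain ⟨i, rfl⟩ | ⟨i, rfl⟩ := eq_lo_or_eq_hi a <;> simp

lemma partner_ne {m : ℕ} (a : Fin (2 * m)) : partner a ≠ a := by
  obtain ⟨i, rfl⟩ | ⟨i, rfl⟩ := eq_lo_or_eq_hi a <;> simp

lemma partner_eq_iff {m : ℕ} {a b : Fin (2 * m)} : partner a = b ↔ a = partner b := by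
  constructor
  · rintro rfl; simp
  · rintro rfl; simp

lemma sum_lo_add_sum_hi {m : ℕ} {M : Type*} [AddCommMonoid M] (f : Fin (2 * m) → M) :
    ∑ a, f a = ∑ i : Fin m, f (lo i) + ∑ i : Fin m, f (hi i) := by
  refine Eq.trans ?_ (Fintype.sum_sum_type (fun x : Fin m ⊕ Fin m => f (Sum.elim lo hi x)))
  refine (Function.Bijective.sum_comp (e := fun x : Fin m ⊕ Fin m => Sum.elim lo hi x)
    ⟨?_, ?_⟩ f).symm
  · rintro (i | i) (j | j) h <;> simp_all
  · intro a
    obtain ⟨i, rfl⟩ | ⟨i, rfl⟩ := eq_lo_or_eq_hi a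
    · exact ⟨Sum.inl i, rfl⟩
    · exact ⟨Sum.inr i, rfl⟩

lemma lieOmega_dd_dd {m : ℕ} (D : Witt (2 * m)) (a b : Fin (2 * m)) :
    lieOmega D (dd a) (dd b) =
      sgn a • dd b (D (t (partner a))) - sgn b • dd a (D (t (partner b))) := by
  rw [lieOmega_eq]
  obtain ⟨i, rfl⟩ | ⟨i, rfl⟩ := eq_lo_or_eq_hi a <;>
  obtain ⟨j, rfl⟩ | ⟨j, rfl⟩ := eq_lo_or_eq_hi b <;>
  simp [dd_t, Finset.sum_add_distrib, Finset.sum_sub_distrib] <;> ring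

/-- A vector field is Hamiltonian iff contracting it with the symplectic form gives a closed
1-form. -/
lemma mem_hamiltonian_iff {m : ℕ} {D : Witt (2 * m)} : D ∈ hamiltonian m ↔
    ∀ a b, sgn a • dd b (D (t (partner a))) = sgn b • dd a (D (t (partner b))) := by
  constructor
  · intro h a b
    rw [← sub_eq_zero, ← lieOmega_dd_dd]
    exact h _ _
  · intro h E F
    rw [lieOmega_eq_sum]
    refine Finset.sum_eq_zero fun a _ => Finset.sum_eq_zero fun b _ => ?_
    rw [lieOmega_dd_dd, h a b, sub_self, mul_zero]

lemma mem_special_iff {n : ℕ} {D : Witt n} : D ∈ special n ↔ ∑ i, dd i (D (t i)) = 0 := Iff.rfl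

/-! ### The matrices of the elements of `(X_n)_0` -/

/-- The condition on `M` for `∑ M i j • t_i d_j` to lie in `X_n`: none, trace zero, or
symplectic. -/
def MatCond : {n : ℕ} → Series n → (Fin n → Fin n → ℂ) → Prop
  | _, .W _, _ => True
  | _, .S _, M => ∑ i, M i i = 0
  | _, .H _, M => ∀ a b, sgn a * M b (partner a) = sgn b * M a (partner b)

lemma ofMatrix_mem_vf {n : ℕ} (X : Series n) {M : Fin n → Fin n → ℂ} :
    ofMatrix M ∈ vf X ↔ MatCond X M := by
  cases X with
  | W n => exact ⟨fun _ => trivial, fun _ => trivial⟩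
  | S n =>
    change ofMatrix M ∈ special n ↔ ∑ i, M i i = 0
    rw [mem_special_iff]
    simp only [dd_ofMatrix_t]
    rw [← map_sum, map_eq_zero_iff _ (algebraMap_injective n)]
  | H m =>
    change ofMatrix M ∈ hamiltonian m ↔ ∀ a b, sgn a * M b (partner a) = sgn b * M a (partner b)
    rw [mem_hamiltonian_iff]
    simp only [dd_ofMatrix_t, Algebra.smul_def, ← map_mul, (algebraMap_injective _).eq_iff]

/-- The element of `(X_n)_0` with matrix `M`. -/
def mk0 {n : ℕ} (X : Series n) (M : Fin n → Fin n → ℂ) (h : MatCond X M) : vf0 X :=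
  ⟨ofMatrix M, (ofMatrix_mem_vf X).2 h, ofMatrix_mem_witt0 M⟩

@[simp]
lemma entry_mk0 {n : ℕ} (X : Series n) (M : Fin n → Fin n → ℂ) (h : MatCond X M)
    (i j : Fin n) : entry i j (mk0 X M h : Witt n) = M i j := entry_ofMatrix M i j

lemma vf0_ext {n : ℕ} {X : Series n} {D E : vf0 X}
    (h : ∀ i j, entry i j (D : Witt n) = entry i j (E : Witt n)) : D = E :=
  Subtype.ext (witt0_ext D.2.2 E.2.2 h)

lemma matCond_entry {n : ℕ} {X : Series n} (D : vf0 X) :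
    MatCond X (fun i j => entry i j (D : Witt n)) := by
  rw [← ofMatrix_mem_vf, ← eq_ofMatrix D.2.2]
  exact D.2.1

instance {n : ℕ} (X : Series n) : FiniteDimensional ℂ (vf0 X) :=
  FiniteDimensional.of_injective
    (V₂ := Fin n → Fin n → ℂ)
    { toFun := fun D i j => entry i j (D : Witt n)
      map_add' := fun D E => by ext i j; exact map_add (entry i j) (D : Witt n) E
      map_smul' := fun c D => by ext i j; exact map_smul (entry i j) c (D : Witt n) }
    fun D E h => vf0_ext fun i j => congrFun (congrFun h i) j

/-! ### The principal grading of `(X_n)_0` -/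

/-- The order of the indices for which `𝔫⁺_X` consists of the strictly upper triangular elements:
the usual one for `W` and `S`, and `1, …, m, 2m, …, m + 1` for `H`. -/
def rk : {n : ℕ} → Series n → Fin n → ℤ
  | _, .W _, i => i.val
  | _, .S _, i => i.val
  | _, .H m, i => if i.val < m then i.val else 3 * m - 1 - i.val

lemma rk_injective {n : ℕ} (X : Series n) : Function.Injective (rk X) := by
  intro i j h
  ext
  cases X with
  | W n => simpa [rk] using h
  | S n => simpa [rk] using h
  | H m =>
    simp only [rk] at h
    split_ifs at h <;> omega

lemma rk_partner {m : ℕ} (a : Fin (2 * m)) :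
    rk (.H m) (partner a) = 2 * m - 1 - rk (.H m) a := by
  obtain ⟨i, rfl⟩ | ⟨i, rfl⟩ := eq_lo_or_eq_hi a
  · rw [partner_lo]
    simp [rk, lo, hi]
    omega
  · rw [partner_hi]
    simp [rk, lo, hi]
    omega

/-- The homogeneous component of degree `q` of `D ∈ (X_n)_0`, where `t_i d_j` has degree
`rk j - rk i`. -/
def comp {n : ℕ} (X : Series n) (q : ℤ) (D : vf0 X) : vf0 X :=
  mk0 X (fun i j => if rk X j - rk X i = q then entry i j (D : Witt n) else 0) <| by
    have hD := matCond_entry D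
    cases X with
    | W n => trivial
    | S n =>
      have hD : ∑ i, entry i i (D : Witt n) = 0 := hD
      change ∑ i, (if rk (.S n) i - rk (.S n) i = q then entry i i (D : Witt n) else 0) = 0
      simp only [sub_self]
      split_ifs
      · exact hD
      · simp
    | H m =>
      intro a b
      have h := hD a b
      have e : rk (.H m) (partner a) - rk (.H m) b = rk (.H m) (partner b) - rk (.H m) a := by
        rw [rk_partner, rk_partner]; ring
      simp only [e, mul_ite, mul_zero]
      rw [h]

lemma entry_comp {n : ℕ} (X : Series n) (q : ℤ) (D : vf0 X) (i j : Fin n) :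
    entry i j (comp X q D : Witt n) =
      if rk X j - rk X i = q then entry i j (D : Witt n) else 0 := entry_mk0 _ _ _ _ _

/-- The component of degree `q` of `(X_n)_0` for the principal grading. -/
def gr {n : ℕ} (X : Series n) (q : ℤ) : Submodule ℂ (vf0 X) where
  carrier := {D | ∀ i j, rk X j - rk X i ≠ q → entry i j (D : Witt n) = 0}
  zero_mem' := fun i j _ => map_zero (entry i j)
  add_mem' {D E} hD hE i j h := by
    change entry i j ((D : Witt n) + E) = 0
    rw [map_add, hD i j h, hE i j h, add_zero]
  smul_mem' c D hD i j h := by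
    change entry i j (c • (D : Witt n)) = 0
    rw [map_smul, hD i j h, smul_zero]

lemma comp_mem_gr {n : ℕ} (X : Series n) (q : ℤ) (D : vf0 X) : comp X q D ∈ gr X q := by
  intro i j h
  rw [entry_comp, if_neg h]

lemma entry_coe_sum {n : ℕ} {X : Series n} {ι : Type*} (s : Finset ι) (f : ι → vf0 X)
    (i j : Fin n) :
    entry i j ((∑ k ∈ s, f k : vf0 X) : Witt n) = ∑ k ∈ s, entry i j (f k : Witt n) :=
  map_sum (entry i j ∘ₗ (vf0 X).toSubmodule.subtype) f s

lemma exists_eq_sum_comp {n : ℕ} (X : Series n) :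
    ∃ s : Finset ℤ, ∀ D : vf0 X, D = ∑ q ∈ s, comp X q D := by
  refine ⟨Finset.univ.image fun p : Fin n × Fin n => rk X p.2 - rk X p.1, fun D => ?_⟩
  apply vf0_ext
  intro i j
  rw [entry_coe_sum]
  simp only [entry_comp]
  rw [Finset.sum_ite_eq, if_pos]
  exact Finset.mem_image.2 ⟨(i, j), Finset.mem_univ _, rfl⟩

lemma iSup_gr {n : ℕ} (X : Series n) : ⨆ q, gr X q = ⊤ := by
  rw [eq_top_iff]
  intro D _
  obtain ⟨s, hs⟩ := exists_eq_sum_comp X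
  rw [hs D]
  exact Submodule.sum_mem _ fun q _ => Submodule.mem_iSup_of_mem q (comp_mem_gr X q D)

/-- The element of `𝔥_X` that defines the principal grading. -/
def gradElt {n : ℕ} (X : Series n) : vf0 X :=
  mk0 X (fun i j => if i = j then ((n : ℂ) - 1) / 2 - rk X i else 0) <| by
    cases X with
    | W n => trivial
    | S n =>
      change ∑ i : Fin n, (if i = i then ((n : ℂ) - 1) / 2 - rk (.S n) i else 0) = 0
      simp only [if_true, rk]
      rw [Finset.sum_sub_distrib]
      have h : ∑ i : Fin n, (((i.val : ℤ) : ℂ)) = n * (n - 1) / 2 := by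
        rw [Fin.sum_univ_eq_sum_range (fun i : ℕ => ((i : ℤ) : ℂ)) n]
        induction n with
        | zero => simp
        | succ k ih => rw [Finset.sum_range_succ, ih]; push_cast; ring
      rw [h]
      simp
      ring
    | H m =>
      intro a b
      simp only []
      by_cases h : b = partner a
      · subst h
        simp only [partner_partner, if_true, sgn_partner, rk_partner]
        push_cast
        ring
      · rw [if_neg h, if_neg (fun h' => h (by rw [h', partner_partner]))]
        simp

lemma lie_gradElt {n : ℕ} (X : Series n) {q : ℤ} {D : vf0 X} (hD : D ∈ gr X q) :
    ⁅gradElt X, D⁆ = (q : ℂ) • D := by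
  apply vf0_ext
  intro i j
  rw [LieSubalgebra.coe_bracket, entry_lie (gradElt X).2.2 D.2.2]
  have e : entry i j ((((q : ℂ) • D : vf0 X)) : Witt n) = q * entry i j (D : Witt n) :=
    map_smul (entry i j) (q : ℂ) (D : Witt n)
  rw [e]
  simp only [gradElt, entry_mk0, Finset.sum_sub_distrib, ite_mul, zero_mul,
    mul_ite, mul_zero, Finset.sum_ite_eq, Finset.sum_ite_eq', Finset.mem_univ, if_true]
  by_cases h : rk X j - rk X i = q
  · rw [← h]; push_cast; ring
  · rw [hD i j h]; ring

lemma mem_cartan_iff {n : ℕ} {X : Series n} {D : vf0 X} :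
    D ∈ cartan X ↔ ∀ i j, i ≠ j → entry i j (D : Witt n) = 0 := by
  change (D : Witt n) ∈ Submodule.span ℂ (Set.range fun i : Fin n => td i i) ↔ _
  constructor
  · intro h i j hij
    have : Submodule.span ℂ (Set.range fun i : Fin n => (td i i : Witt n)) ≤
        LinearMap.ker (entry i j) := by
      rw [Submodule.span_le]
      rintro _ ⟨k, rfl⟩
      change entry i j (td k k) = 0
      rw [entry_td, if_neg]
      rintro ⟨rfl, h⟩
      exact hij h.symm
    exact this h
  · intro h
    rw [eq_ofMatrix D.2.2, ofMatrix]
    refine Submodule.sum_mem _ fun i _ => Submodule.sum_mem _ fun j _ => ?_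
    by_cases hij : i = j
    · subst hij
      exact Submodule.smul_mem _ _ (Submodule.subset_span ⟨i, rfl⟩)
    · rw [h i j hij, zero_smul]
      exact Submodule.zero_mem _

lemma gr_zero {n : ℕ} (X : Series n) : gr X 0 = cartan X := by
  ext D
  rw [mem_cartan_iff]
  refine forall_congr' fun i => forall_congr' fun j => ?_
  rw [sub_ne_zero, (rk_injective X).ne_iff, ne_comm]

lemma gradElt_mem_cartan {n : ℕ} (X : Series n) : gradElt X ∈ cartan X := by
  rw [mem_cartan_iff]
  intro i j h
  rw [gradElt, entry_mk0, if_neg h]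

lemma entry_posRootVectors {n : ℕ} {X : Series n} {D : Witt n} (hD : D ∈ posRootVectors X)
    (i j : Fin n) (h : ¬ rk X i < rk X j) : entry i j D = 0 := by
  cases X with
  | W n =>
    obtain ⟨k, l, hkl, rfl⟩ := hD
    rw [entry_td, if_neg]
    rintro ⟨rfl, rfl⟩
    exact h (by simpa [rk] using hkl)
  | S n =>
    obtain ⟨k, l, hkl, rfl⟩ := hD
    rw [entry_td, if_neg]
    rintro ⟨rfl, rfl⟩
    exact h (by simpa [rk] using hkl)
  | H m =>
    obtain ⟨k, l, hkl, rfl⟩ | ⟨k, l, rfl⟩ := hD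
    · rw [map_sub, entry_td, entry_td, if_neg, if_neg, sub_zero]
      · rintro ⟨rfl, rfl⟩
        refine h ?_
        simp [rk, hi]
        omega
      · rintro ⟨rfl, rfl⟩
        refine h ?_
        simp [rk, lo]
        omega
    · rw [map_add, entry_td, entry_td, if_neg, if_neg, add_zero]
      all_goals
        rintro ⟨rfl, rfl⟩
        refine h ?_
        simp [rk, lo, hi]
        omega

lemma mem_nPos_iff {n : ℕ} {X : Series n} {D : vf0 X} :
    D ∈ nPos X ↔ ∀ i j, ¬ rk X i < rk X j → entry i j (D : Witt n) = 0 := by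
  change (D : Witt n) ∈ Submodule.span ℂ (posRootVectors X) ↔ _
  constructor
  · intro h i j hij
    have : Submodule.span ℂ (posRootVectors X) ≤ LinearMap.ker (entry i j) := by
      rw [Submodule.span_le]
      intro E hE
      exact entry_posRootVectors hE i j hij
    exact this h
  · intro h
    have hD := matCond_entry D
    rw [eq_ofMatrix D.2.2]
    generalize hM : (fun i j => entry i j (D : Witt n)) = M at hD
    replace h : ∀ i j, ¬ rk X i < rk X j → M i j = 0 := by
      subst hM
      exact h
    cases X with
    | W n =>
      rw [ofMatrix]
      refine Submodule.sum_mem _ fun i _ => Submodule.sum_mem _ fun j _ => ?_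
      by_cases hij : i < j
      · exact Submodule.smul_mem _ _ (Submodule.subset_span ⟨i, j, hij, rfl⟩)
      · rw [h i j (by simpa [rk] using hij), zero_smul]
        exact Submodule.zero_mem _
    | S n =>
      rw [ofMatrix]
      refine Submodule.sum_mem _ fun i _ => Submodule.sum_mem _ fun j _ => ?_
      by_cases hij : i < j
      · exact Submodule.smul_mem _ _ (Submodule.subset_span ⟨i, j, hij, rfl⟩)
      · rw [h i j (by simpa [rk] using hij), zero_smul]
        exact Submodule.zero_mem _
    | H m =>
      have e : ofMatrix M =
          ∑ i, ∑ j, M (lo i) (lo j) • (td (lo i) (lo j) - td (hi j) (hi i)) +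
          ∑ i, ∑ j, (M (lo i) (hi j) / 2) • (td (lo i) (hi j) + td (lo j) (hi i)) := by
        have h1 : ∀ i j, M (hi j) (hi i) = -M (lo i) (lo j) := fun i j => by
          have := hD (lo i) (hi j)
          simpa using this
        have h2 : ∀ i j, M (lo j) (hi i) = M (lo i) (hi j) := fun i j => by
          have := hD (lo i) (lo j)
          simpa using this
        have h3 : ∀ i j, M (hi i) (lo j) = 0 := fun i j => by
          apply h
          simp [rk, lo, hi]
          omega
        have h4 : ∑ i, ∑ j, (M (lo i) (hi j) / 2) • td (lo j) (hi i) =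
            ∑ i, ∑ j, (M (lo i) (hi j) / 2) • td (lo i) (hi j) := by
          rw [Finset.sum_comm]
          refine Finset.sum_congr rfl fun i _ => Finset.sum_congr rfl fun j _ => ?_
          rw [h2]
        have h5 : ∑ i, ∑ j, M (hi i) (hi j) • td (hi i) (hi j) =
            -∑ i, ∑ j, M (lo i) (lo j) • td (hi j) (hi i) := by
          rw [Finset.sum_comm, ← Finset.sum_neg_distrib]
          refine Finset.sum_congr rfl fun i _ => ?_
          rw [← Finset.sum_neg_distrib]
          refine Finset.sum_congr rfl fun j _ => ?_
          rw [h1, neg_smul]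
        have h6 : ∑ i, ∑ j, M (lo i) (hi j) • td (lo i) (hi j) =
            ∑ i, ∑ j, (M (lo i) (hi j) / 2) • td (lo i) (hi j) +
            ∑ i, ∑ j, (M (lo i) (hi j) / 2) • td (lo i) (hi j) := by
          simp only [← Finset.sum_add_distrib, ← add_smul, add_halves]
        rw [ofMatrix, sum_lo_add_sum_hi]
        simp only [sum_lo_add_sum_hi (m := m), h3, zero_smul, Finset.sum_const_zero, zero_add,
          smul_add, smul_sub, Finset.sum_add_distrib, Finset.sum_sub_distrib, h4, h5, h6]
        abel
      rw [e]
      refine Submodule.add_mem _ ?_ ?_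
      · refine Submodule.sum_mem _ fun i _ => Submodule.sum_mem _ fun j _ => ?_
        by_cases hij : i < j
        · exact Submodule.smul_mem _ _ (Submodule.subset_span (Or.inl ⟨i, j, hij, rfl⟩))
        · rw [h (lo i) (lo j) (by simpa [rk, lo] using hij), zero_smul]
          exact Submodule.zero_mem _
      · exact Submodule.sum_mem _ fun i _ => Submodule.sum_mem _ fun j _ =>
          Submodule.smul_mem _ _ (Submodule.subset_span (Or.inr ⟨i, j, rfl⟩))

lemma gr_le_nPos {n : ℕ} (X : Series n) {q : ℤ} (hq : 0 < q) : gr X q ≤ nPos X := by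
  intro D hD
  rw [mem_nPos_iff]
  intro i j hij
  exact hD i j (by omega)

lemma nPos_le_iSup_gr {n : ℕ} (X : Series n) : nPos X ≤ ⨆ q : ℤ, ⨆ _ : 0 < q, gr X q := by
  intro D hD
  rw [mem_nPos_iff] at hD
  obtain ⟨s, hs⟩ := exists_eq_sum_comp X
  rw [hs D]
  refine Submodule.sum_mem _ fun q _ => ?_
  by_cases hq : 0 < q
  · exact Submodule.mem_iSup_of_mem q (Submodule.mem_iSup_of_mem hq (comp_mem_gr X q D))
  · have : comp X q D = 0 := by
      apply vf0_ext
      intro i j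
      rw [entry_comp]
      split_ifs with h
      · rw [hD i j (by omega)]
        exact (map_zero (entry i j)).symm
      · exact (map_zero (entry i j)).symm
    rw [this]
    exact Submodule.zero_mem _

/-! ### Commuting tripotents -/

section Tripotent

variable {M : Type*} [AddCommGroup M] [Module ℂ M] {ι : Type*} [Fintype ι]

/-- Commuting operators `h k` with `(h k)³ = h k` have a joint eigenvector in every nonzero subspace
that they preserve, with eigenvalues in `{-1, 0, 1}`. -/
lemma exists_joint_eigenvector (h : ι → Module.End ℂ M) (hc : ∀ k l, Commute (h k) (h l))
    (h3 : ∀ k, h k * h k * h k = h k) {p : Submodule ℂ M} (hp : p ≠ ⊥)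
    (hs : ∀ k, ∀ x ∈ p, h k x ∈ p) :
    ∃ v ∈ p, v ≠ 0 ∧ ∃ a : ι → ℂ, ∀ k, h k v = a k • v ∧ (a k = -1 ∨ a k = 0 ∨ a k = 1) := by
  classical
  suffices H : ∀ s : Finset ι, ∃ v ∈ p, v ≠ 0 ∧ ∃ a : ι → ℂ, ∀ k ∈ s,
      h k v = a k • v ∧ (a k = -1 ∨ a k = 0 ∨ a k = 1) by
    obtain ⟨v, hv, hv0, a, ha⟩ := H Finset.univ
    exact ⟨v, hv, hv0, a, fun k => ha k (Finset.mem_univ k)⟩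
  intro s
  induction s using Finset.induction_on with
  | empty =>
    obtain ⟨v, hv, hv0⟩ := Submodule.exists_mem_ne_zero_of_ne_bot hp
    exact ⟨v, hv, hv0, 0, by simp⟩
  | insert k s hk ih =>
    obtain ⟨v, hv, hv0, a, ha⟩ := ih
    have e3 : h k (h k (h k v)) = h k v := by
      have := congrArg (fun f : Module.End ℂ M => f v) (h3 k)
      simpa using this
    have hcl : ∀ l x, h l (h k x) = h k (h l x) := fun l x => by
      have := congrArg (fun f : Module.End ℂ M => f x) (hc l k).eq
      simpa using this
    -- a nonzero component of `v` for the eigenvalues `0, 1, -1` of `h k` replaces `v`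
    have key : ∀ (x : M) (c : ℂ), x ∈ p → x ≠ 0 → h k x = c • x → (c = -1 ∨ c = 0 ∨ c = 1) →
        (∀ l ∈ s, h l x = a l • x) → ∃ v ∈ p, v ≠ 0 ∧ ∃ a : ι → ℂ, ∀ l ∈ insert k s,
          h l v = a l • v ∧ (a l = -1 ∨ a l = 0 ∨ a l = 1) := by
      intro x c hx hx0 hxc hc' hxs
      refine ⟨x, hx, hx0, Function.update a k c, fun l hl => ?_⟩
      by_cases hlk : l = k
      · subst hlk
        simpa using ⟨hxc, hc'⟩
      · have hl' : l ∈ s := by simpa [hlk] using hl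
        simpa [hlk] using ⟨hxs l hl', (ha l hl').2⟩
    have p1 : h k v ∈ p := hs k v hv
    have p2 : h k (h k v) ∈ p := hs k _ p1
    by_cases h0 : v - h k (h k v) = 0
    · by_cases h1 : h k v + v = 0
      · refine key v (-1) hv hv0 ?_ (Or.inl rfl) fun l hl => (ha l hl).1
        rw [neg_one_smul]
        exact eq_neg_of_add_eq_zero_left h1
      · refine key (h k v + v) 1 (p.add_mem p1 hv) h1 ?_ (Or.inr (Or.inr rfl)) fun l hl => ?_
        · rw [map_add, ← sub_eq_zero.1 h0, one_smul, add_comm]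
        · rw [map_add, hcl, (ha l hl).1, map_smul, smul_add]
    · refine key _ 0 (p.sub_mem hv p2) h0 ?_ (Or.inr (Or.inl rfl)) fun l hl => ?_
      · rw [map_sub, e3, sub_self, zero_smul]
      · rw [map_sub, hcl, hcl, (ha l hl).1, map_smul, map_smul, smul_sub]

/-- A linear combination `T` of commuting tripotents has finitely many eigenvalues, and there is a
joint eigenvector whose `T`-eigenvalue is maximal. -/
lemma exists_extremal_eigenvector [Nontrivial M] (h : ι → Module.End ℂ M)
    (hc : ∀ k l, Commute (h k) (h l)) (h3 : ∀ k, h k * h k * h k = h k)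
    {T : Module.End ℂ M} (hT : T ∈ Submodule.span ℂ (Set.range h)) :
    ∃ v : M, v ≠ 0 ∧ (∀ k, ∃ a : ℂ, h k v = a • v) ∧ ∃ z : ℂ, T v = z • v ∧
      (∀ q : ℤ, 0 < q → ∀ x, T x = (z + q) • x → x = 0) ∧
      ∃ B : ℕ, ∀ j : ℕ, B ≤ j → ∀ x, T x = (z - j) • x → x = 0 := by
  classical
  obtain ⟨c, rfl⟩ := (Submodule.mem_span_range_iff_exists_fun ℂ).1 hT
  set T := ∑ k, c k • h k with hTdef
  have hcT : ∀ k, Commute (h k) T := fun k =>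
    Commute.sum_right _ _ _ fun l _ => (hc k l).smul_right _
  -- every eigenspace of `T` contains a joint eigenvector
  have hjoint : ∀ z : ℂ, ∀ x ≠ 0, T x = z • x → ∃ v, T v = z • v ∧ v ≠ 0 ∧
      ∃ a : ι → ℂ, ∀ k, h k v = a k • v ∧ (a k = -1 ∨ a k = 0 ∨ a k = 1) := by
    intro z x hx hxz
    obtain ⟨v, hv, hv0, ha⟩ := exists_joint_eigenvector h hc h3 (p := T.eigenspace z)
      (fun hb => hx (by
        have : x ∈ T.eigenspace z := Module.End.mem_eigenspace_iff.2 hxz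
        rwa [hb, Submodule.mem_bot] at this))
      (fun k y hy => by
        rw [Module.End.mem_eigenspace_iff] at hy ⊢
        have := congrArg (fun f : Module.End ℂ M => f y) (hcT k).eq
        simp only [Module.End.mul_apply] at this
        rw [← this, hy, map_smul])
    exact ⟨v, Module.End.mem_eigenspace_iff.1 hv, hv0, ha⟩
  let E : Set ℂ := {z | ∃ x, x ≠ 0 ∧ T x = z • x}
  have hfin : E.Finite := by
    refine (Set.Finite.image (fun a : ι → ℂ => ∑ k, c k * a k)
      (Set.Finite.pi (t := fun _ : ι => ({-1, 0, 1} : Set ℂ)) fun _ => Set.toFinite _)).subset ?_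
    rintro z ⟨x, hx, hxz⟩
    obtain ⟨v, hv, hv0, a, ha⟩ := hjoint z x hx hxz
    refine ⟨a, fun k _ => by simpa using (ha k).2, ?_⟩
    have : T v = (∑ k, c k * a k) • v := by
      rw [hTdef, LinearMap.sum_apply, Finset.sum_smul]
      exact Finset.sum_congr rfl fun k _ => by
        rw [LinearMap.smul_apply, (ha k).1, smul_smul]
    rw [this] at hv
    exact smul_left_injective ℂ hv0 hv
  have hne : E.Nonempty := by
    obtain ⟨v, -, hv0, a, ha⟩ := exists_joint_eigenvector h hc h3 (p := ⊤) top_ne_bot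
      fun _ _ _ => Submodule.mem_top
    refine ⟨∑ k, c k * a k, v, hv0, ?_⟩
    rw [hTdef, LinearMap.sum_apply, Finset.sum_smul]
    exact Finset.sum_congr rfl fun k _ => by
      rw [LinearMap.smul_apply, (ha k).1, smul_smul]
  obtain ⟨z, hz, hmax⟩ := hfin.toFinset.exists_max_image Complex.re (by simpa using hne)
  obtain ⟨x, hx0, hx⟩ := hfin.mem_toFinset.1 hz
  obtain ⟨v, hv, hv0, a, ha⟩ := hjoint z x hx0 hx
  refine ⟨v, hv0, fun k => ⟨a k, (ha k).1⟩, z, hv, fun q hq y hy => ?_, ?_⟩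
  · by_contra hy0
    have h1 := hmax _ (hfin.mem_toFinset.2 ⟨y, hy0, hy⟩)
    simp only [Complex.add_re, Complex.intCast_re] at h1
    have : (0 : ℝ) < q := by exact_mod_cast hq
    linarith
  · have hJ : {j : ℕ | z - j ∈ E}.Finite :=
      Set.Finite.preimage (fun j _ k _ hjk => by simpa using hjk) hfin
    obtain ⟨B, hB⟩ := hJ.bddAbove
    refine ⟨B + 1, fun j hj y hy => ?_⟩
    by_contra hy0
    have := hB (show j ∈ {j : ℕ | z - j ∈ E} from ⟨y, hy0, hy⟩)
    omega

end Tripotent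

/-! ### Highest weight vectors for `(X_n)_0` -/

section HighestWeight

variable {n : ℕ} {X : Series n} {M : Type*} [AddCommGroup M] [Module ℂ M]
  (ρ : vf0 X →ₗ⁅ℂ⁆ Module.End ℂ M)

/-- `v` is killed by `𝔫⁺_X`, and `𝔥_X` acts on it by `μ` (the value `v = 0` is allowed). -/
structure IsHighestWeight (μ : Module.Dual ℂ (cartan X)) (v : M) : Prop where
  killed : ∀ D ∈ nPos X, ρ D v = 0
  weight : ∀ D : cartan X, ρ D v = μ D • v

/-- The only subspaces preserved by `(X_n)_0` are zero and the whole space. -/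
def StableTrivial : Prop :=
  ∀ p : Submodule ℂ M, (∀ D, ∀ u ∈ p, ρ D u ∈ p) → p = ⊥ ∨ p = ⊤

lemma rep_lie (D E : vf0 X) (u : M) : ρ ⁅D, E⁆ u = ρ D (ρ E u) - ρ E (ρ D u) := by
  rw [LieHom.map_lie]
  rfl

lemma rep_gradElt_of_mem_gr {q : ℤ} {D : vf0 X} (hD : D ∈ gr X q) {z : ℂ} {u : M}
    (hu : ρ (gradElt X) u = z • u) : ρ (gradElt X) (ρ D u) = (z + q) • ρ D u := by
  have h := rep_lie ρ (gradElt X) D u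
  rw [lie_gradElt X hD, map_smul, LinearMap.smul_apply, hu, map_smul] at h
  rw [add_smul, h]
  abel

/-- The span `𝔫⁻_X` of the components of negative degree. -/
def nNeg {n : ℕ} (X : Series n) : Submodule ℂ (vf0 X) := ⨆ q : ℤ, ⨆ _ : q < 0, gr X q

lemma exists_triangular (D : vf0 X) :
    ∃ a ∈ nNeg X, ∃ b ∈ cartan X, ∃ c ∈ nPos X, D = a + b + c := by
  have hD : D ∈ ⨆ q, gr X q := by rw [iSup_gr]; trivial
  have hle : (⨆ q, gr X q) ≤ nNeg X ⊔ cartan X ⊔ nPos X := by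
    refine iSup_le fun q => ?_
    rcases lt_trichotomy q 0 with h | h | h
    · exact (le_iSup₂ (f := fun (q : ℤ) (_ : q < 0) => gr X q) q h).trans
        (le_sup_left.trans le_sup_left)
    · rw [h, gr_zero]
      exact le_sup_right.trans le_sup_left
    · exact (gr_le_nPos X h).trans le_sup_right
  obtain ⟨x, hx, c, hc, rfl⟩ := Submodule.mem_sup.1 (hle hD)
  obtain ⟨a, ha, b, hb, rfl⟩ := Submodule.mem_sup.1 hx
  exact ⟨a, ha, b, hb, c, hc, rfl⟩

/-- The span of the products of `l` elements of `𝔫⁻_X` applied to `v`. -/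
def lowering (v : M) : ℕ → Submodule ℂ M
  | 0 => Submodule.span ℂ {v}
  | l + 1 => Submodule.map₂ (ρ : vf0 X →ₗ[ℂ] Module.End ℂ M) (nNeg X) (lowering v l)

/-- The space `U(𝔫⁻_X) v`. -/
def cyclic (v : M) : Submodule ℂ M := ⨆ l, lowering ρ v l

lemma self_mem_cyclic (v : M) : v ∈ cyclic ρ v :=
  Submodule.mem_iSup_of_mem 0 (Submodule.mem_span_singleton_self v)

lemma cyclic_nNeg {v u : M} (hu : u ∈ cyclic ρ v) {D : vf0 X} (hD : D ∈ nNeg X) :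
    ρ D u ∈ cyclic ρ v := by
  have : cyclic ρ v ≤ (cyclic ρ v).comap (ρ D) := by
    refine iSup_le fun l x hx => ?_
    exact Submodule.mem_iSup_of_mem (l + 1)
      (Submodule.apply_mem_map₂ (ρ : vf0 X →ₗ[ℂ] Module.End ℂ M) hD hx)
  exact this hu

variable {ρ} {μ : Module.Dual ℂ (cartan X)} {v : M}

/-- `U(𝔫⁻_X) v` is preserved by `(X_n)_0` if `v` is a highest weight vector, by induction on the
number of factors: `x y w = y x w + [x, y] w`. -/
lemma IsHighestWeight.cyclic_stable (h : IsHighestWeight ρ μ v) (D : vf0 X) {u : M}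
    (hu : u ∈ cyclic ρ v) : ρ D u ∈ cyclic ρ v := by
  have H : ∀ l, ∀ w ∈ lowering ρ v l, ∀ D : vf0 X, ρ D w ∈ cyclic ρ v := by
    intro l
    induction l with
    | zero =>
      intro w hw D
      obtain ⟨z, rfl⟩ := Submodule.mem_span_singleton.1 hw
      obtain ⟨a, ha, b, hb, c, hc, rfl⟩ := exists_triangular D
      rw [map_smul]
      refine Submodule.smul_mem _ _ ?_
      rw [map_add, map_add, LinearMap.add_apply, LinearMap.add_apply, h.killed c hc, add_zero]
      have := h.weight ⟨b, hb⟩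
      change ρ b v = _ at this
      rw [this]
      exact Submodule.add_mem _ (cyclic_nNeg ρ (self_mem_cyclic ρ v) ha)
        (Submodule.smul_mem _ _ (self_mem_cyclic ρ v))
    | succ l ih =>
      intro w hw D
      have hle : lowering ρ v (l + 1) ≤ (cyclic ρ v).comap (ρ D) := by
        refine Submodule.map₂_le.2 fun y hy w hw => ?_
        change ρ D (ρ y w) ∈ cyclic ρ v
        have e : ρ D (ρ y w) = ρ ⁅D, y⁆ w + ρ y (ρ D w) := by
          rw [rep_lie]
          abel
        rw [e]
        exact Submodule.add_mem _ (ih w hw _) (cyclic_nNeg ρ (ih w hw D) hy)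
      exact hle hw
  have hle : cyclic ρ v ≤ (cyclic ρ v).comap (ρ D) := iSup_le fun l x hx => H l x hx D
  exact hle hu

lemma cyclic_le {p : Submodule ℂ M} (hp : ∀ D, ∀ u ∈ p, ρ D u ∈ p) (hv : v ∈ p) :
    cyclic ρ v ≤ p := by
  refine iSup_le fun l => ?_
  induction l with
  | zero => exact (Submodule.span_singleton_le_iff_mem v p).2 hv
  | succ l ih => exact Submodule.map₂_le.2 fun y _ w hw => hp y w (ih hw)

lemma IsHighestWeight.lowering_le (h : IsHighestWeight ρ μ v) (l : ℕ) :
    lowering ρ v l ≤ ⨆ j : ℕ, ⨆ _ : l ≤ j, (ρ (gradElt X)).eigenspace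
      (μ ⟨gradElt X, gradElt_mem_cartan X⟩ - j) := by
  induction l with
  | zero =>
    rw [lowering, Submodule.span_singleton_le_iff_mem]
    refine Submodule.mem_iSup_of_mem 0 (Submodule.mem_iSup_of_mem le_rfl ?_)
    rw [Module.End.mem_eigenspace_iff, Nat.cast_zero, sub_zero]
    exact h.weight ⟨gradElt X, gradElt_mem_cartan X⟩
  | succ l ih =>
    set z := μ ⟨gradElt X, gradElt_mem_cartan X⟩
    set S := ⨆ j : ℕ, ⨆ _ : l + 1 ≤ j, (ρ (gradElt X)).eigenspace (z - j)
    refine Submodule.map₂_le.2 fun y hy w hw => ?_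
    have h1 : ∀ q : ℤ, q < 0 → ∀ y ∈ gr X q, ∀ w ∈ lowering ρ v l, ρ y w ∈ S := by
      intro q hq y hy w hw
      have hle : (⨆ j : ℕ, ⨆ _ : l ≤ j, (ρ (gradElt X)).eigenspace (z - j)) ≤
          S.comap (ρ y) := by
        refine iSup₂_le fun j hj x hx => ?_
        rw [Module.End.mem_eigenspace_iff] at hx
        have hx' := rep_gradElt_of_mem_gr ρ hy hx
        obtain ⟨k, hk⟩ := Int.eq_ofNat_of_zero_le (show 0 ≤ -q by omega)
        refine Submodule.mem_iSup_of_mem (j + k) (Submodule.mem_iSup_of_mem (by omega) ?_)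
        rw [Module.End.mem_eigenspace_iff, hx']
        congr 1
        have : (q : ℂ) = -(k : ℂ) := by
          have : q = -(k : ℤ) := by omega
          rw [this]
          push_cast
          rfl
        rw [this]
        push_cast
        ring
      exact hle (ih hw)
    have h2 : nNeg X ≤ S.comap ((ρ : vf0 X →ₗ[ℂ] Module.End ℂ M).flip w) :=
      iSup₂_le fun q hq y hy => h1 q hq y hy w hw
    exact h2 hy

/-- In `U(𝔫⁻_X) v` the vectors of the same degree as `v` are the multiples of `v`. -/
lemma IsHighestWeight.eq_smul_of_mem_cyclic (h : IsHighestWeight ρ μ v) {u : M}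
    (hu : u ∈ cyclic ρ v)
    (hu' : ρ (gradElt X) u = μ ⟨gradElt X, gradElt_mem_cartan X⟩ • u) : ∃ a : ℂ, u = a • v := by
  set z := μ ⟨gradElt X, gradElt_mem_cartan X⟩
  set f := ρ (gradElt X)
  set S := ⨆ j : ℂ, ⨆ _ : j ≠ z, f.eigenspace j
  have hle : cyclic ρ v ≤ Submodule.span ℂ {v} ⊔ S := by
    refine iSup_le fun l => ?_
    cases l with
    | zero => exact le_sup_left
    | succ l =>
      refine (h.lowering_le (l + 1)).trans (le_trans ?_ le_sup_right)
      refine iSup₂_le fun j hj => le_iSup₂_of_le (z - j) ?_ le_rfl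
      rw [Ne, sub_eq_self, Nat.cast_eq_zero]
      omega
  obtain ⟨x, hx, y, hy, rfl⟩ := Submodule.mem_sup.1 (hle hu)
  obtain ⟨a, rfl⟩ := Submodule.mem_span_singleton.1 hx
  have hv : f v = z • v := h.weight ⟨gradElt X, gradElt_mem_cartan X⟩
  have hy' : y ∈ f.eigenspace z := by
    rw [Module.End.mem_eigenspace_iff]
    rw [map_add, map_smul, hv, smul_add, smul_comm] at hu'
    exact add_left_cancel hu'
  have := (f.eigenspaces_iSupIndep z).le_bot ⟨hy', hy⟩
  rw [Submodule.mem_bot] at this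
  exact ⟨a, by rw [this, add_zero]⟩

lemma IsHighestWeight.finiteDimensional (h : IsHighestWeight ρ μ v) (hv : v ≠ 0)
    (hs : StableTrivial ρ) {B : ℕ} (hB : ∀ j : ℕ, B ≤ j → ∀ x,
      ρ (gradElt X) x = (μ ⟨gradElt X, gradElt_mem_cartan X⟩ - j) • x → x = 0) :
    FiniteDimensional ℂ M := by
  have hfg : ∀ l, (lowering ρ v l).FG := by
    intro l
    induction l with
    | zero => exact Submodule.fg_span_singleton v
    | succ l ih => exact Submodule.FG.map₂ _ (IsNoetherian.noetherian _) ih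
  have hbot : ∀ l, B ≤ l → lowering ρ v l = ⊥ := by
    intro l hl
    rw [eq_bot_iff]
    refine (h.lowering_le l).trans (iSup₂_le fun j hj x hx => ?_)
    exact (Submodule.mem_bot ℂ).2 (hB j (hl.trans hj) x (Module.End.mem_eigenspace_iff.1 hx))
  have htop : cyclic ρ v = ⊤ := by
    refine (hs (cyclic ρ v) fun D u hu => h.cyclic_stable D hu).resolve_left fun hb => hv ?_
    have := self_mem_cyclic ρ v
    rwa [hb, Submodule.mem_bot] at this
  have hfin : cyclic ρ v = ⨆ l ∈ Finset.range B, lowering ρ v l := by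
    apply le_antisymm
    · refine iSup_le fun l => ?_
      by_cases hl : B ≤ l
      · rw [hbot l hl]; exact bot_le
      · exact le_iSup₂_of_le l (Finset.mem_range.2 (by omega)) le_rfl
    · exact iSup₂_le fun l _ => le_iSup (lowering ρ v) l
  refine Module.finite_def.2 ?_
  rw [← htop, hfin]
  exact Submodule.fg_biSup _ _ fun l _ => hfg l

end HighestWeight

section Transfer

variable {n : ℕ} {X : Series n} {M N : Type*} [AddCommGroup M] [Module ℂ M]
  [AddCommGroup N] [Module ℂ N]

/-- The direct sum of two representations of `(X_n)_0`. -/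
def prodRep (ρ : vf0 X →ₗ⁅ℂ⁆ Module.End ℂ M) (τ : vf0 X →ₗ⁅ℂ⁆ Module.End ℂ N) :
    vf0 X →ₗ⁅ℂ⁆ Module.End ℂ (M × N) where
  toFun D := (ρ D).prodMap (τ D)
  map_add' D E := by ext <;> simp
  map_smul' c D := by ext <;> simp
  map_lie' {D E} := by
    refine LinearMap.ext fun x => ?_
    rw [LieRing.of_associative_ring_bracket]
    refine Prod.ext ?_ ?_
    · exact rep_lie ρ D E x.1
    · exact rep_lie τ D E x.2

/-- An irreducible representation `M` of `(X_n)_0` with a highest weight vector `v` satisfies the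
relations of any representation `N` with a highest weight vector `e` of the same weight: in the
subrepresentation of `M ⊕ N` generated by `(v, e)`, which projects onto `M`, no nonzero vector has
second component zero. -/
lemma exists_correspondence {ρ : vf0 X →ₗ⁅ℂ⁆ Module.End ℂ M} {τ : vf0 X →ₗ⁅ℂ⁆ Module.End ℂ N}
    (hs : StableTrivial ρ) {μ : Module.Dual ℂ (cartan X)} {v : M} {e : N}
    (hv : IsHighestWeight ρ μ v) (he : IsHighestWeight τ μ e) (hv0 : v ≠ 0) (he0 : e ≠ 0) :
    ∃ U : Submodule ℂ (M × N), (∀ D, ∀ u ∈ U, (ρ D u.1, τ D u.2) ∈ U) ∧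
      (∀ w, ∃ f ∈ cyclic τ e, (w, f) ∈ U) ∧ ∀ w, (w, (0 : N)) ∈ U → w = 0 := by
  have hve : IsHighestWeight (prodRep ρ τ) μ (v, e) :=
    ⟨fun D hD => Prod.ext (hv.killed D hD) (he.killed D hD),
      fun D => Prod.ext (hv.weight D) (he.weight D)⟩
  let U := cyclic (prodRep ρ τ) (v, e)
  have hU : ∀ D, ∀ u ∈ U, (ρ D u.1, τ D u.2) ∈ U := fun D u hu => hve.cyclic_stable D hu
  have hmem : (v, e) ∈ U := self_mem_cyclic _ _
  refine ⟨U, hU, fun w => ?_, fun w hw => ?_⟩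
  · have h1 : U.map (LinearMap.fst ℂ M N) = ⊤ := by
      refine (hs _ ?_).resolve_left fun hb => hv0 ?_
      · rintro D _ ⟨u, hu, rfl⟩
        exact ⟨_, hU D u hu, rfl⟩
      · have : v ∈ U.map (LinearMap.fst ℂ M N) := ⟨_, hmem, rfl⟩
        rwa [hb, Submodule.mem_bot] at this
    have hw : w ∈ U.map (LinearMap.fst ℂ M N) := by rw [h1]; trivial
    obtain ⟨⟨w', f⟩, hu, rfl⟩ := hw
    refine ⟨f, ?_, hu⟩
    have : U ≤ (cyclic τ e).comap (LinearMap.snd ℂ M N) :=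
      cyclic_le (fun D u hu => he.cyclic_stable D hu) (self_mem_cyclic τ e)
    exact this hu
  · let p : Submodule ℂ M := U.comap (LinearMap.inl ℂ M N)
    have hp : p = ⊥ := by
      refine (hs p fun D u hu => ?_).resolve_right fun ht => ?_
      · have := hU D _ hu
        simpa [p] using this
      · have hvp : (v, (0 : N)) ∈ U := by
          have : v ∈ p := by rw [ht]; trivial
          exact this
        obtain ⟨a, ha⟩ := hve.eq_smul_of_mem_cyclic hvp
          (Prod.ext (hv.weight ⟨gradElt X, gradElt_mem_cartan X⟩) (by
            change τ _ 0 = _ • (0 : N)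
            rw [map_zero, smul_zero]))
        have ha1 : v = a • v := congrArg Prod.fst ha
        have ha2 : 0 = a • e := congrArg Prod.snd ha
        have ha0 : a = 0 := (smul_eq_zero.1 ha2.symm).resolve_right he0
        rw [ha0, zero_smul] at ha1
        exact hv0 ha1
    have : w ∈ p := hw
    rwa [hp, Submodule.mem_bot] at this

end Transfer

/-! ### The action on `A_n ⊗ V` in coordinates -/

lemma dd_mem_vf {n : ℕ} (X : Series n) (i : Fin n) : dd i ∈ vf X := by
  have h : ∀ j k : Fin n, dd j (dd i (t k)) = 0 := fun j k => by
    rw [dd_t]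
    split_ifs <;> simp
  cases X with
  | W n => trivial
  | S n =>
    change dd i ∈ special n
    simp [mem_special_iff, h]
  | H m =>
    change dd i ∈ hamiltonian m
    simp [mem_hamiltonian_iff, h]

/-- The vector field `d_i` as an element of `X_n`. -/
def ddX {n : ℕ} (X : Series n) (i : Fin n) : vf X := ⟨dd i, dd_mem_vf X i⟩

section Coeff

variable {n : ℕ} {V : Type*} [AddCommGroup V] [Module ℂ V]

/-- The coefficient in `V` of `t^r` in an element of `A_n ⊗ V`. -/
def coef (r : Fin n →₀ ℕ) : Poly n ⊗[ℂ] V →ₗ[ℂ] V :=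
  Finsupp.lapply r ∘ₗ (TensorProduct.equivFinsuppOfBasisLeft (N := V) (monomials n)).toLinearMap

lemma coef_tmul (r : Fin n →₀ ℕ) (f : Poly n) (v : V) :
    coef r (f ⊗ₜ[ℂ] v) = (monomials n).repr f r • v := by
  simp [coef]

lemma eq_zero_of_coef {w : Poly n ⊗[ℂ] V} (h : ∀ r, coef r w = 0) : w = 0 := by
  apply (TensorProduct.equivFinsuppOfBasisLeft (N := V) (monomials n)).injective
  rw [map_zero]
  ext r
  exact h r

lemma exists_coef_degree_bound (w : Poly n ⊗[ℂ] V) :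
    ∃ d : ℕ, ∀ r : Fin n →₀ ℕ, d ≤ r.degree → coef r w = 0 := by
  classical
  let e := TensorProduct.equivFinsuppOfBasisLeft (N := V) (monomials n)
  refine ⟨(e w).support.sup Finsupp.degree + 1, fun r hr => ?_⟩
  by_contra h
  have : r ∈ (e w).support := Finsupp.mem_support_iff.2 h
  have := Finset.le_sup (f := Finsupp.degree) this
  omega

lemma repr_dd (i : Fin n) (f : Poly n) (r : Fin n →₀ ℕ) :
    (monomials n).repr (dd i f) r =
      (monomials n).repr f (r + Finsupp.single i 1) * ((r i : ℂ) + 1) :=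
  MvPolynomial.coeff_pderiv (R := ℂ) f r

lemma repr_one (r : Fin n →₀ ℕ) :
    (monomials n).repr (1 : Poly n) r = if r = 0 then 1 else 0 := by
  have h := MvPolynomial.coeff_one (R := ℂ) r
  simp only [eq_comm (a := r)]
  exact h

lemma coef_dd (i : Fin n) (r : Fin n →₀ ℕ) (w : Poly n ⊗[ℂ] V) :
    coef r ((dd i).toLinearMap.rTensor V w) =
      ((r i : ℂ) + 1) • coef (r + Finsupp.single i 1) w := by
  induction w using TensorProduct.induction_on with
  | zero => simp
  | tmul f v =>
    rw [LinearMap.rTensor_tmul, coef_tmul, coef_tmul, smul_smul, mul_comm]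
    exact congrArg (· • v) (repr_dd i f r)
  | add x y hx hy => simp only [map_add, hx, hy, smul_add]

lemma eq_one_tmul_of_coef {w : Poly n ⊗[ℂ] V}
    (h : ∀ r : Fin n →₀ ℕ, r ≠ 0 → coef r w = 0) : w = 1 ⊗ₜ[ℂ] coef 0 w := by
  rw [← sub_eq_zero]
  refine eq_zero_of_coef fun r => ?_
  rw [map_sub, coef_tmul, repr_one]
  split_ifs with hr
  · rw [hr, one_smul, sub_self]
  · rw [h r hr, zero_smul, sub_self]

/-- A nonzero subspace of `A_n ⊗ V` that is preserved by the `d_i` contains a nonzero constant. -/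
lemma exists_one_tmul_mem {p : Submodule ℂ (Poly n ⊗[ℂ] V)}
    (hp : ∀ i, ∀ w ∈ p, (dd i).toLinearMap.rTensor V w ∈ p) (hne : p ≠ ⊥) :
    ∃ v : V, v ≠ 0 ∧ (1 : Poly n) ⊗ₜ[ℂ] v ∈ p := by
  obtain ⟨w, hw, hw0⟩ := Submodule.exists_mem_ne_zero_of_ne_bot hne
  obtain ⟨d, hd⟩ := exists_coef_degree_bound w
  induction d generalizing w with
  | zero => exact absurd (eq_zero_of_coef fun r => hd r (Nat.zero_le _)) hw0
  | succ d ih =>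
    by_cases h : ∀ i, (dd i).toLinearMap.rTensor V w = 0
    · have hr : ∀ r : Fin n →₀ ℕ, r ≠ 0 → coef r w = 0 := by
        intro r hr
        obtain ⟨i, hi⟩ := Finsupp.ne_iff.1 hr
        have hle : Finsupp.single i 1 ≤ r := by
          rw [Finsupp.single_le_iff]
          exact Nat.one_le_iff_ne_zero.2 hi
        have e := coef_dd i (r - Finsupp.single i 1) w
        rw [h i, map_zero, tsub_add_cancel_of_le hle] at e
        exact (smul_eq_zero.1 e.symm).resolve_left (Nat.cast_add_one_ne_zero _)
      refine ⟨coef 0 w, fun h0 => hw0 ?_, ?_⟩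
      · rw [eq_one_tmul_of_coef hr, h0, TensorProduct.tmul_zero]
      · rwa [← eq_one_tmul_of_coef hr]
    · push Not at h
      obtain ⟨i, hi⟩ := h
      refine ih _ (hp i w hw) hi fun r hr => ?_
      rw [coef_dd, hd, smul_zero]
      rw [map_add, Finsupp.degree_single]
      omega

end Coeff

lemma tmul_entry_eq_jacobian {n : ℕ} {X : Series n} (D : vf X) {ι : Type*} (s : Finset ι)
    (f : ι → Poly n) (E : ι → vf0 X)
    (h : ∀ i j, dd i ((D : Witt n) (t j)) = ∑ k ∈ s, entry i j (E k : Witt n) • f k) :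
    jacobian X D = ∑ k ∈ s, f k ⊗ₜ[ℂ] E k := by
  rw [← sub_eq_zero]
  apply eq_zero_of_entryA
  intro i j
  rw [map_sub, entryA_jacobian, h, map_sum]
  simp only [entryA_tmul]
  rw [sub_self]

section Action

variable {𝔤 : Type*} [LieRing 𝔤] [LieAlgebra ℂ 𝔤] {n : ℕ} {X : Series n} {V : Type*}
  [AddCommGroup V] [Module ℂ V] [LieRingModule (toroidal0 𝔤 X) V]
  [LieModule ℂ (toroidal0 𝔤 X) V]

variable (𝔤 X V) in
/-- The representation of `(X_n)_0` on an `𝔏(𝔤, X_n)_0`-module. -/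
def vfRep : vf0 X →ₗ⁅ℂ⁆ Module.End ℂ V :=
  (LieModule.toEnd ℂ (toroidal0 𝔤 X) V).comp (ofVf0 𝔤 X)

variable (𝔤 V) in
/-- The action of a vector field `D ∈ X_n` on the Shen–Larsson module. -/
def vfAct (D : vf X) : Poly n ⊗[ℂ] V →ₗ[ℂ] Poly n ⊗[ℂ] V :=
  (D : Witt n).toLinearMap.rTensor V + tact (vfSymbol 𝔤 X (jacobian X D))

lemma vfAct_tmul (D : vf X) {ι : Type*} (s : Finset ι) (f : ι → Poly n) (E : ι → vf0 X)
    (h : ∀ i j, dd i ((D : Witt n) (t j)) = ∑ k ∈ s, entry i j (E k : Witt n) • f k)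
    (g : Poly n) (v : V) :
    vfAct 𝔤 V D (g ⊗ₜ[ℂ] v) =
      (D : Witt n) g ⊗ₜ[ℂ] v + ∑ k ∈ s, (f k * g) ⊗ₜ[ℂ] vfRep 𝔤 X V (E k) v := by
  rw [vfAct, LinearMap.add_apply, tmul_entry_eq_jacobian D s f E h, map_sum, map_sum,
    LinearMap.sum_apply]
  rfl

lemma act_eq (Y : Toroidal 𝔤 X) (w : Poly n ⊗[ℂ] V) :
    ShenLarsson.act 𝔤 X V Y w = tact (gSymbol 𝔤 X Y.left.1) w +
      tact (centerSymbol 𝔤 X Y.left.2) w + vfAct 𝔤 V Y.right w := by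
  rw [ShenLarsson.act, symbol]
  simp only [LinearMap.coe_mk, AddHom.coe_mk, map_add, LinearMap.add_apply, vfAct]
  abel

lemma vfAct_ddX (i : Fin n) (w : Poly n ⊗[ℂ] V) :
    vfAct 𝔤 V (ddX X i) w = (dd i).toLinearMap.rTensor V w := by
  have : jacobian X (ddX X i) = 0 := by
    rw [tmul_entry_eq_jacobian (ddX X i) (∅ : Finset ℕ) 0 0, Finset.sum_empty]
    intro j k
    change dd j (dd i (t k)) = _
    rw [dd_t]
    split_ifs <;> simp
  rw [vfAct, this, map_zero, map_zero, add_zero]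
  rfl

/-- The element of `X_n` underlying an element of `(X_n)_0`. -/
def vf0Incl (D : vf0 X) : vf X := ⟨D, D.2.1⟩

lemma vfAct_vf0Incl (D : vf0 X) (g : Poly n) (v : V) :
    vfAct 𝔤 V (vf0Incl D) (g ⊗ₜ[ℂ] v) =
      (D : Witt n) g ⊗ₜ[ℂ] v + g ⊗ₜ[ℂ] vfRep 𝔤 X V D v := by
  rw [vfAct_tmul (vf0Incl D) ({()} : Finset Unit) (fun _ => 1) (fun _ => D), Finset.sum_singleton,
    one_mul]
  · rfl
  · intro i j
    rw [Finset.sum_singleton, ← Algebra.algebraMap_eq_smul_one]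
    exact dd_eq_entry D.2.2 i j

variable (𝔤 X) in
/-- `p` is preserved by the action of `𝔏(𝔤, X_n)`. -/
def IsStable (p : Submodule ℂ (Poly n ⊗[ℂ] V)) : Prop :=
  ∀ (Y : Toroidal 𝔤 X), ∀ w ∈ p, ShenLarsson.act 𝔤 X V Y w ∈ p

lemma isIrreducible_shenLarsson_iff [Nontrivial V] :
    LieModule.IsIrreducible ℂ (Toroidal 𝔤 X) (ShenLarsson X V) ↔
      ∀ p : Submodule ℂ (Poly n ⊗[ℂ] V), IsStable 𝔤 X p → p = ⊥ ∨ p = ⊤ := by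
  constructor
  · intro h p hp
    let N : LieSubmodule ℂ (Toroidal 𝔤 X) (ShenLarsson X V) :=
      { (p : Submodule ℂ (ShenLarsson X V)) with lie_mem := fun {Y w} hw => hp Y w hw }
    have hN : (N : Submodule ℂ (ShenLarsson X V)) = p := rfl
    rcases h.eq_bot_or_eq_top N with h0 | h0
    · left
      rw [← hN, h0]
      rfl
    · right
      rw [← hN, h0]
      rfl
  · intro h
    have : Nontrivial (ShenLarsson X V) := by
      obtain ⟨v, hv⟩ := exists_ne (0 : V)
      refine ⟨(1 : Poly n) ⊗ₜ[ℂ] v, (0 : Poly n ⊗[ℂ] V), fun h1 => hv ?_⟩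
      have := congrArg (coef (V := V) 0) h1
      rwa [coef_tmul, repr_one, if_pos rfl, one_smul, map_zero] at this
    refine LieModule.IsIrreducible.mk fun N hN => ?_
    have hst : IsStable 𝔤 X (N : Submodule ℂ (ShenLarsson X V)) := fun Y w hw => N.lie_mem hw
    rcases h _ hst with h0 | h0
    · exact absurd ((LieSubmodule.toSubmodule_eq_bot N).1 h0) hN
    · exact (LieSubmodule.toSubmodule_eq_top N).1 h0

section Stable

variable {p : Submodule ℂ (Poly n ⊗[ℂ] V)} (hp : IsStable 𝔤 X p)

include hp

lemma IsStable.vfAct_mem (D : vf X) {w : Poly n ⊗[ℂ] V} (hw : w ∈ p) : vfAct 𝔤 V D w ∈ p := by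
  have := hp ⟨0, D⟩ w hw
  rw [act_eq] at this
  simpa using this

lemma IsStable.tmul_ofG_mem (f g : Poly n) (x : 𝔤) {v : V} (hw : g ⊗ₜ[ℂ] v ∈ p) :
    (f * g) ⊗ₜ[ℂ] ⁅ofG 𝔤 X x, v⁆ ∈ p := by
  have := hp ⟨(f ⊗ₜ x, 0), 0⟩ _ hw
  rw [act_eq] at this
  simpa [gSymbol_tmul, tact_tmul, vfAct] using this

lemma IsStable.tmul_K_mem (f g : Poly n) (i : Fin n) {v : V} (hw : g ⊗ₜ[ℂ] v ∈ p) :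
    (f * g) ⊗ₜ[ℂ] ⁅K 𝔤 X i, v⁆ ∈ p := by
  let z : Center n := fun j => if j = i then f else 0
  have e : centerSymbol 𝔤 X z = f ⊗ₜ[ℂ] K 𝔤 X i := by
    rw [centerSymbol_apply, Finset.sum_eq_single i]
    · simp [z]
    · intro j _ hj
      simp [z, hj]
    · simp
  have := hp ⟨(0, z), 0⟩ _ hw
  rw [act_eq] at this
  simpa [e, tact_tmul, vfAct] using this

end Stable

lemma exists_eq_ofG_add_K_add_ofVf0 (Y : toroidal0 𝔤 X) :
    ∃ (x : 𝔤) (c : Fin n → ℂ) (D : vf0 X),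
      Y = ofG 𝔤 X x + ∑ i, c i • K 𝔤 X i + ofVf0 𝔤 X D := by
  obtain ⟨Y, ⟨x, hx⟩, ⟨c, hc⟩, hY⟩ := Y
  refine ⟨x, c, ⟨Y.right, Y.right.2, hY⟩, ?_⟩
  apply Subtype.ext
  have hK : ∀ i, ((c i • K 𝔤 X i : toroidal0 𝔤 X) : Toroidal 𝔤 X) =
      ⟨(0, (Pi.single i (algebraMap ℂ (Poly n) (c i)) : Fin n → Poly n)), 0⟩ := by
    intro i
    refine LieAlgebra.SemiDirectSum.ext (Prod.ext ?_ ?_) ?_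
    · change c i • (0 : Poly n ⊗[ℂ] 𝔤) = 0
      exact smul_zero _
    · change c i • (Pi.single i 1 : Fin n → Poly n) = Pi.single i _
      rw [← Pi.single_smul, Algebra.algebraMap_eq_smul_one]
    · change c i • (0 : vf X) = 0
      exact smul_zero _
  have hsum : ∀ s : Finset (Fin n), ((∑ i ∈ s, c i • K 𝔤 X i : toroidal0 𝔤 X) : Toroidal 𝔤 X) =
      ⟨(0, (∑ i ∈ s, Pi.single i (algebraMap ℂ (Poly n) (c i)) : Fin n → Poly n)), 0⟩ := by
    classical
    intro s
    induction s using Finset.induction_on with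
    | empty => rfl
    | insert a s ha ih =>
      rw [Finset.sum_insert ha, Finset.sum_insert ha]
      change ((c a • K 𝔤 X a : toroidal0 𝔤 X) : Toroidal 𝔤 X) +
        ((∑ i ∈ s, c i • K 𝔤 X i : toroidal0 𝔤 X) : Toroidal 𝔤 X) = _
      rw [ih, hK]
      refine LieAlgebra.SemiDirectSum.ext (Prod.ext ?_ ?_) ?_
      · exact add_zero (0 : Poly n ⊗[ℂ] 𝔤)
      · rfl
      · exact add_zero (0 : vf X)
  change Y = (ofG 𝔤 X x : Toroidal 𝔤 X) +
    ((∑ i, c i • K 𝔤 X i : toroidal0 𝔤 X) : Toroidal 𝔤 X) + _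
  rw [hsum]
  refine LieAlgebra.SemiDirectSum.ext (Prod.ext ?_ ?_) ?_
  · change Y.left.1 = (1 : Poly n) ⊗ₜ[ℂ] x + 0 + 0
    rw [hx, add_zero, add_zero]
  · change Y.left.2 = (0 : Fin n → Poly n) +
      (∑ i, Pi.single i (algebraMap ℂ (Poly n) (c i)) : Fin n → Poly n) + (0 : Fin n → Poly n)
    rw [hc, Finset.univ_sum_single, zero_add, add_zero]
  · change Y.right = 0 + 0 + Y.right
    rw [zero_add, zero_add]

section Irreducible

variable (hV : LieModule.IsIrreducible ℂ (toroidal0 𝔤 X) V)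

include hV

lemma eq_bot_or_eq_top_of_stable (p : Submodule ℂ V)
    (hg : ∀ x, ∀ v ∈ p, ⁅ofG 𝔤 X x, v⁆ ∈ p) (hK : ∀ i, ∀ v ∈ p, ⁅K 𝔤 X i, v⁆ ∈ p)
    (hD : ∀ D, ∀ v ∈ p, vfRep 𝔤 X V D v ∈ p) : p = ⊥ ∨ p = ⊤ := by
  let N : LieSubmodule ℂ (toroidal0 𝔤 X) V :=
    { p with
      lie_mem := fun {Y v} hv => by
        obtain ⟨x, c, D, rfl⟩ := exists_eq_ofG_add_K_add_ofVf0 Y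
        change ⁅_, v⁆ ∈ p
        rw [add_lie, add_lie, sum_lie]
        refine p.add_mem (p.add_mem (hg x v hv) (p.sum_mem fun i _ => ?_)) (hD D v hv)
        rw [smul_lie]
        exact p.smul_mem _ (hK i v hv) }
  have hN : (N : Submodule ℂ V) = p := rfl
  rcases hV.eq_bot_or_eq_top N with h0 | h0
  · left
    rw [← hN, h0]
    rfl
  · right
    rw [← hN, h0]
    rfl

lemma stableTrivial_vfRep (hg : ∀ x (v : V), ⁅ofG 𝔤 X x, v⁆ = 0)
    (hK : ∀ i (v : V), ⁅K 𝔤 X i, v⁆ = 0) : StableTrivial (vfRep 𝔤 X V) := by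
  intro p hp
  refine eq_bot_or_eq_top_of_stable hV p (fun x v _ => ?_) (fun i v _ => ?_) hp
  · rw [hg]
    exact p.zero_mem
  · rw [hK]
    exact p.zero_mem

variable {p : Submodule ℂ (Poly n ⊗[ℂ] V)} (hp : IsStable 𝔤 X p)

include hp

/-- A nonzero submodule of the Shen–Larsson module contains all constants. -/
lemma IsStable.one_tmul_mem (hbot : p ≠ ⊥) (v : V) : (1 : Poly n) ⊗ₜ[ℂ] v ∈ p := by
  let q : Submodule ℂ V := p.comap (TensorProduct.mk ℂ (Poly n) V 1)
  have hq : q = ⊤ := by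
    refine (eq_bot_or_eq_top_of_stable hV q (fun x v hv => ?_) (fun i v hv => ?_)
      fun D v hv => ?_).resolve_left fun hb => ?_
    · have := hp.tmul_ofG_mem 1 1 x hv
      rwa [mul_one] at this
    · have := hp.tmul_K_mem 1 1 i hv
      rwa [mul_one] at this
    · have := hp.vfAct_mem (vf0Incl D) hv
      rw [TensorProduct.mk_apply, vfAct_vf0Incl, Derivation.map_one_eq_zero,
        TensorProduct.zero_tmul, zero_add] at this
      exact this
    · obtain ⟨v, hv0, hv⟩ := exists_one_tmul_mem (p := p) (fun i w hw => by
        rw [← vfAct_ddX (𝔤 := 𝔤) (X := X)]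
        exact hp.vfAct_mem _ hw) hbot
      have : v ∈ q := hv
      rw [hb, Submodule.mem_bot] at this
      exact hv0 this
  have : v ∈ q := by rw [hq]; trivial
  exact this

/-- The vectors `v` with `A_n ⊗ v` inside a proper submodule form a proper submodule of `V`. -/
lemma IsStable.eq_zero_of_forall_tmul_mem (htop : p ≠ ⊤) {v : V}
    (hv : ∀ f : Poly n, f ⊗ₜ[ℂ] v ∈ p) : v = 0 := by
  let q : Submodule ℂ V := ⨅ f : Poly n, p.comap (TensorProduct.mk ℂ (Poly n) V f)
  have hmem : ∀ v, v ∈ q ↔ ∀ f : Poly n, f ⊗ₜ[ℂ] v ∈ p := by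
    intro v
    simp [q]
  have hq : q = ⊥ := by
    refine (eq_bot_or_eq_top_of_stable hV q (fun x v hv => ?_) (fun i v hv => ?_)
      fun D v hv => ?_).resolve_right fun ht => htop ?_
    · rw [hmem] at hv ⊢
      intro f
      have := hp.tmul_ofG_mem 1 f x (hv f)
      rwa [one_mul] at this
    · rw [hmem] at hv ⊢
      intro f
      have := hp.tmul_K_mem 1 f i (hv f)
      rwa [one_mul] at this
    · rw [hmem] at hv ⊢
      intro f
      have := hp.vfAct_mem (vf0Incl D) (hv f)
      rw [vfAct_vf0Incl] at this
      exact (Submodule.add_mem_iff_right p (hv _)).1 this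
    · rw [eq_top_iff]
      intro w _
      induction w using TensorProduct.induction_on with
      | zero => exact p.zero_mem
      | tmul f v =>
        have : v ∈ q := by rw [ht]; trivial
        exact (hmem v).1 this f
      | add x y hx hy => exact p.add_mem (hx trivial) (hy trivial)
  have : v ∈ q := (hmem v).2 hv
  rwa [hq, Submodule.mem_bot] at this

end Irreducible

end Action

/-! ### Quadratic relations forced by a proper submodule -/

/-- The element `t_i d_j` of `(X_n)_0`. -/
def tdX {n : ℕ} (X : Series n) (i j : Fin n) (h : td i j ∈ vf X) : vf0 X :=
  ⟨td i j, h, td_mem_witt0 i j⟩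

lemma entry_tdX {n : ℕ} {X : Series n} {i j : Fin n} (h : td i j ∈ vf X) (k l : Fin n) :
    entry k l (tdX X i j h : Witt n) = if k = i ∧ l = j then 1 else 0 := entry_td k l i j

/-- The map `f ↦ ∑ Λ b c (∂_c f) d_b`. For suitable skew-symmetric `Λ` its values lie in `S_n` or
in `H_n`. -/
def skewGrad {n : ℕ} (Λ : Fin n → Fin n → ℂ) (f : Poly n) : Witt n :=
  ∑ b, (∑ c, Λ b c • dd c f) • dd b

lemma skewGrad_t {n : ℕ} (Λ : Fin n → Fin n → ℂ) (f : Poly n) (b : Fin n) :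
    skewGrad Λ f (t b) = ∑ c, Λ b c • dd c f := by
  simp [skewGrad, sum_witt_apply, dd_t]

lemma skewGrad_mul_mem_witt0 {n : ℕ} (Λ : Fin n → Fin n → ℂ) (k l : Fin n) :
    skewGrad Λ (t k * t l) ∈ witt0 n := by
  intro b
  rw [skewGrad_t]
  refine Submodule.sum_mem _ fun c _ => Submodule.smul_mem _ _ ?_
  rw [Derivation.leibniz, dd_t, dd_t]
  have h : ∀ i, t i ∈ homogeneous n 1 := fun i => MvPolynomial.isHomogeneous_X ℂ i
  refine Submodule.add_mem _ ?_ ?_ <;> split_ifs <;> simp [h]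

lemma entry_skewGrad {n : ℕ} (Λ : Fin n → Fin n → ℂ) (k l i b : Fin n) :
    entry i b (skewGrad Λ (t k * t l)) =
      (if i = l then Λ b k else 0) + if i = k then Λ b l else 0 := by
  apply algebraMap_injective n
  rw [← dd_eq_entry (skewGrad_mul_mem_witt0 Λ k l), skewGrad_t]
  have h : ∀ c, Λ b c • dd c (t k * t l) =
      (if c = l then Λ b l • t k else 0) + if c = k then Λ b k • t l else 0 := by
    intro c
    rw [Derivation.leibniz, dd_t, dd_t, smul_add]
    by_cases h1 : c = l <;> by_cases h2 : c = k <;> simp [h1, h2]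
    all_goals simp_all
  rw [Finset.sum_congr rfl fun c _ => h c, Finset.sum_add_distrib]
  simp only [Finset.sum_ite_eq', Finset.mem_univ, if_true, map_add, Derivation.map_smul, dd_t]
  rw [add_comm]
  congr 1 <;> split_ifs <;> simp [Algebra.smul_def]

lemma dd_skewGrad {n : ℕ} (Λ : Fin n → Fin n → ℂ) (f : Poly n) (i b : Fin n) :
    dd i (skewGrad Λ f (t b)) = ∑ p : Fin n × Fin n,
      ((1 / 2 : ℂ) * entry i b (skewGrad Λ (t p.1 * t p.2))) • dd p.1 (dd p.2 f) := by
  rw [Fintype.sum_prod_type, skewGrad_t]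
  simp only [entry_skewGrad, mul_smul, add_smul, Finset.sum_add_distrib, ite_smul, zero_smul,
    smul_add, Finset.sum_ite_eq, Finset.mem_univ, if_true, map_sum, Derivation.map_smul, smul_ite,
    smul_zero]
  rw [Finset.sum_comm (f := fun x y => if i = x then
    (1 / 2 : ℂ) • Λ b y • dd x (dd y f) else 0)]
  simp only [Finset.sum_ite_eq, Finset.mem_univ, if_true]
  rw [← Finset.sum_add_distrib]
  refine Finset.sum_congr rfl fun c _ => ?_
  rw [dd_comm c i, ← add_smul, add_halves, one_smul]

lemma dd_mul {n : ℕ} (i : Fin n) (f g : Poly n) : dd i (f * g) = f * dd i g + g * dd i f := by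
  rw [Derivation.leibniz, smul_eq_mul, smul_eq_mul]

section Taylor

variable {n : ℕ} (i k l : Fin n) (h : Poly n)

lemma dd_dd_t : dd k (dd l (t i)) = 0 := by
  rw [dd_t]
  split_ifs <;> simp

lemma dd_dd_mul : dd k (dd l (t i * h)) =
    t i * dd k (dd l h) + dd k (t i) * dd l h + dd l (t i) * dd k h := by
  simp only [dd_mul, map_add, dd_dd_t]
  ring

lemma dd_dd_mul_sq : dd k (dd l (t i ^ 2 * h)) =
    t i ^ 2 * dd k (dd l h) + 2 * t i * (dd k (t i) * dd l h + dd l (t i) * dd k h) +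
      2 * dd k (t i) * dd l (t i) * h := by
  rw [pow_two, mul_assoc, dd_dd_mul, dd_dd_mul, dd_mul, dd_mul]
  ring

lemma dd_dd_mul_cube : dd k (dd l (t i ^ 3 * h)) =
    t i ^ 3 * dd k (dd l h) + 3 * t i ^ 2 * (dd k (t i) * dd l h + dd l (t i) * dd k h) +
      6 * t i * dd k (t i) * dd l (t i) * h := by
  rw [pow_succ', mul_assoc, dd_dd_mul, dd_dd_mul_sq, pow_two, mul_assoc]
  simp only [dd_mul]
  ring

lemma dd_pow_mul {j : Fin n} (hij : i ≠ j) (m : ℕ) : dd j (t i ^ m * h) = t i ^ m * dd j h := by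
  rw [dd_mul, Derivation.leibniz_pow, dd_t, if_neg hij.symm]
  simp

end Taylor

section Relations

variable {𝔤 : Type*} [LieRing 𝔤] [LieAlgebra ℂ 𝔤] {n : ℕ} {X : Series n} {V : Type*}
  [AddCommGroup V] [Module ℂ V] [LieRingModule (toroidal0 𝔤 X) V]
  [LieModule ℂ (toroidal0 𝔤 X) V]

lemma vfAct_smul_dd {i j : Fin n} {f f' : Poly n} (hD : f • dd j ∈ vf X) (h : td i j ∈ vf X)
    (hf : ∀ k, dd k f = if k = i then f' else 0) (g : Poly n) (v : V) :
    vfAct 𝔤 V (⟨f • dd j, hD⟩ : vf X) (g ⊗ₜ[ℂ] v) =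
      (f * dd j g) ⊗ₜ[ℂ] v + (f' * g) ⊗ₜ[ℂ] vfRep 𝔤 X V (tdX X i j h) v := by
  rw [vfAct_tmul _ ({()} : Finset Unit) (fun _ => f') (fun _ => tdX X i j h),
    Finset.sum_singleton]
  · rfl
  · intro k l
    rw [Finset.sum_singleton, entry_tdX]
    change dd k ((f • dd j) (t l)) = _
    rw [Derivation.smul_apply, dd_t]
    by_cases h1 : j = l <;> by_cases h2 : k = i <;> simp [h1, h2, hf, eq_comm]

/-- The third-order Taylor combination that isolates `E_ij²`: formally it is the coefficient of `s³`
in `(e^{s t_i} d_j) P(e^{-s t_i} h)`, where `P` is `skewGrad Λ`. -/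
lemma IsStable.tmul_sq_mem {p : Submodule ℂ (Poly n ⊗[ℂ] V)} (hp : IsStable 𝔤 X p)
    (h1 : ∀ v, (1 : Poly n) ⊗ₜ[ℂ] v ∈ p) {i j : Fin n} (hij : i ≠ j)
    (hpow : ∀ k : ℕ, t i ^ k • dd j ∈ vf X) (htd : td i j ∈ vf X)
    {Λ : Fin n → Fin n → ℂ} (hΛ : ∀ f, skewGrad Λ f ∈ vf X) {c : ℂ} (hc : c ≠ 0)
    (hΛi : ∀ b, Λ b i = if b = j then c else 0) (h : Poly n) (v : V) :
    h ⊗ₜ[ℂ] vfRep 𝔤 X V (tdX X i j htd) (vfRep 𝔤 X V (tdX X i j htd) v) ∈ p := by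
  set e := vfRep 𝔤 X V (tdX X i j htd) with he
  let Q : Fin n × Fin n → vf0 X := fun q =>
    (1 / 2 : ℂ) • ⟨skewGrad Λ (t q.1 * t q.2), hΛ _, skewGrad_mul_mem_witt0 Λ q.1 q.2⟩
  let R : Fin n × Fin n → V := fun q => vfRep 𝔤 X V (Q q) v
  -- the action of `P f` on `1 ⊗ v`
  have hP : ∀ f, vfAct 𝔤 V (⟨skewGrad Λ f, hΛ f⟩ : vf X) ((1 : Poly n) ⊗ₜ[ℂ] v) =
      ∑ q : Fin n × Fin n, dd q.1 (dd q.2 f) ⊗ₜ[ℂ] R q := by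
    intro f
    rw [vfAct_tmul _ Finset.univ (fun q => dd q.1 (dd q.2 f)) Q]
    · rw [show (skewGrad Λ f) 1 = 0 from Derivation.map_one_eq_zero _, TensorProduct.zero_tmul,
        zero_add]
      simp only [mul_one]
      rfl
    · intro a b
      refine (dd_skewGrad Λ f a b).trans (Finset.sum_congr rfl fun q _ => ?_)
      rw [show entry a b (Q q : Witt n) = (1 / 2 : ℂ) * entry a b (skewGrad Λ (t q.1 * t q.2)) from
        map_smul (entry a b) (1 / 2 : ℂ) _]
  have hk : ∀ (k : ℕ) (g : Poly n) (w : V),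
      vfAct 𝔤 V (⟨t i ^ k • dd j, hpow k⟩ : vf X) (g ⊗ₜ[ℂ] w) =
        (t i ^ k * dd j g) ⊗ₜ[ℂ] w + ((k : Poly n) * t i ^ (k - 1) * g) ⊗ₜ[ℂ] e w := by
    intro k g w
    refine vfAct_smul_dd (hpow k) htd (fun l => ?_) g w
    rw [Derivation.leibniz_pow, dd_t]
    by_cases hl : l = i <;> simp [hl]
  have hm : ∀ (k : ℕ) f, ∑ q : Fin n × Fin n,
      ((t i ^ k * dd j (dd q.1 (dd q.2 f))) ⊗ₜ[ℂ] R q +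
        ((k : Poly n) * t i ^ (k - 1) * dd q.1 (dd q.2 f)) ⊗ₜ[ℂ] e (R q)) ∈ p := by
    intro k f
    have := hp.vfAct_mem ⟨t i ^ k • dd j, hpow k⟩ (hp.vfAct_mem ⟨skewGrad Λ f, hΛ f⟩ (h1 v))
    rw [hP, map_sum] at this
    simpa only [hk] using this
  have hT := p.sub_mem (p.add_mem (p.sub_mem (hm 3 h)
    (p.smul_mem (3 : ℂ) (hm 2 (t i * h)))) (p.smul_mem (3 : ℂ) (hm 1 (t i ^ 2 * h))))
    (hm 0 (t i ^ 3 * h))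
  have key : ∀ q : Fin n × Fin n,
      ((t i ^ 3 * dd j (dd q.1 (dd q.2 h))) ⊗ₜ[ℂ] R q +
        (((3 : ℕ) : Poly n) * t i ^ (3 - 1) * dd q.1 (dd q.2 h)) ⊗ₜ[ℂ] e (R q)) -
      (3 : ℂ) • ((t i ^ 2 * dd j (dd q.1 (dd q.2 (t i * h)))) ⊗ₜ[ℂ] R q +
        (((2 : ℕ) : Poly n) * t i ^ (2 - 1) * dd q.1 (dd q.2 (t i * h))) ⊗ₜ[ℂ]
          e (R q)) +
      (3 : ℂ) • ((t i ^ 1 * dd j (dd q.1 (dd q.2 (t i ^ 2 * h)))) ⊗ₜ[ℂ] R q +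
        (((1 : ℕ) : Poly n) * t i ^ (1 - 1) * dd q.1 (dd q.2 (t i ^ 2 * h))) ⊗ₜ[ℂ]
          e (R q)) -
      ((t i ^ 0 * dd j (dd q.1 (dd q.2 (t i ^ 3 * h)))) ⊗ₜ[ℂ] R q +
        (((0 : ℕ) : Poly n) * t i ^ (0 - 1) * dd q.1 (dd q.2 (t i ^ 3 * h))) ⊗ₜ[ℂ]
          e (R q)) =
      if q = (i, i) then ((6 : ℂ) • h) ⊗ₜ[ℂ] e (R q) else 0 := by
    rintro ⟨k, l⟩
    have three : algebraMap ℂ (Poly n) 3 = 3 := map_ofNat _ _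
    have hj : ∀ f, dd j (dd k (dd l f)) = dd k (dd l (dd j f)) := fun f => by
      rw [dd_comm j k, dd_comm j l]
    -- the coefficients of `R q` and of `e (R q)`
    have c1 : t i ^ 3 * dd j (dd k (dd l h)) -
        (3 : ℂ) • (t i ^ 2 * dd j (dd k (dd l (t i * h)))) +
        (3 : ℂ) • (t i ^ 1 * dd j (dd k (dd l (t i ^ 2 * h)))) -
        t i ^ 0 * dd j (dd k (dd l (t i ^ 3 * h))) = 0 := by
      have h0 := dd_pow_mul i h hij 1
      rw [pow_one] at h0
      simp only [hj, h0, dd_pow_mul i h hij]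
      simp only [dd_dd_mul, dd_dd_mul_sq, dd_dd_mul_cube, Algebra.smul_def, three]
      ring
    have c2 : ((3 : ℕ) : Poly n) * t i ^ (3 - 1) * dd k (dd l h) -
        (3 : ℂ) • (((2 : ℕ) : Poly n) * t i ^ (2 - 1) * dd k (dd l (t i * h))) +
        (3 : ℂ) • (((1 : ℕ) : Poly n) * t i ^ (1 - 1) * dd k (dd l (t i ^ 2 * h))) -
        ((0 : ℕ) : Poly n) * t i ^ (0 - 1) * dd k (dd l (t i ^ 3 * h)) =
        dd k (t i) * dd l (t i) * (6 * h) := by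
      simp only [dd_dd_mul, dd_dd_mul_sq, Algebra.smul_def, three]
      push_cast
      ring
    have c3 : dd k (t i) * dd l (t i) * (6 * h) =
        if (k, l) = (i, i) then (6 : ℂ) • h else 0 := by
      have six : algebraMap ℂ (Poly n) 6 = 6 := map_ofNat _ _
      rw [dd_t, dd_t]
      by_cases hk' : k = i <;> by_cases hl' : l = i <;> simp [hk', hl', Algebra.smul_def, six]
    have c4 : (if (k, l) = (i, i) then ((6 : ℂ) • h) ⊗ₜ[ℂ] e (R (k, l)) else 0) =
        (0 : Poly n) ⊗ₜ[ℂ] R (k, l) + (dd k (t i) * dd l (t i) * (6 * h)) ⊗ₜ[ℂ] e (R (k, l)) := by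
      rw [c3, TensorProduct.zero_tmul, zero_add]
      split_ifs <;> simp
    rw [c4, ← c2, ← c1]
    simp only [TensorProduct.add_tmul, TensorProduct.sub_tmul, ← TensorProduct.smul_tmul']
    module
  have hR : R (i, i) = c • e v := by
    have : Q (i, i) = c • tdX X i j htd := by
      apply vf0_ext
      intro a b
      rw [show entry a b ((c • tdX X i j htd : vf0 X) : Witt n) =
        c * entry a b (tdX X i j htd : Witt n) from map_smul (entry a b) _ _, entry_tdX,
        show entry a b (Q (i, i) : Witt n) = (1 / 2 : ℂ) * entry a b (skewGrad Λ (t i * t i)) from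
          map_smul (entry a b) (1 / 2 : ℂ) _, entry_skewGrad, hΛi]
      by_cases ha : a = i <;> by_cases hb : b = j <;> simp [ha, hb]
      ring
    simp only [R]
    rw [this, map_smul, LinearMap.smul_apply]
  simp only [Finset.smul_sum, ← Finset.sum_sub_distrib, ← Finset.sum_add_distrib] at hT
  rw [Finset.sum_congr rfl fun q _ => key q, Finset.sum_ite_eq' Finset.univ, if_pos
    (Finset.mem_univ _), hR, map_smul, TensorProduct.tmul_smul, ← TensorProduct.smul_tmul',
    smul_smul] at hT
  refine (Submodule.smul_mem_iff p ?_).1 hT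
  simpa using hc

/-- For `W_n`, the second-order Taylor combination isolates `E_ij² - δ_ij E_ij`: formally it is the
coefficient of `s²` in `(e^{s t_i} d_j) (e^{-s t_i} h d_j)`. -/
lemma IsStable.tmul_sq_sub_mem [LieRingModule (toroidal0 𝔤 (.W n)) V]
    [LieModule ℂ (toroidal0 𝔤 (.W n)) V]
    {p : Submodule ℂ (Poly n ⊗[ℂ] V)} (hp : IsStable 𝔤 (.W n) p)
    (h1 : ∀ v, (1 : Poly n) ⊗ₜ[ℂ] v ∈ p) (i j : Fin n) (h : Poly n) (v : V) :
    h ⊗ₜ[ℂ] (vfRep 𝔤 (.W n) V (tdX (.W n) i j trivial)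
      (vfRep 𝔤 (.W n) V (tdX (.W n) i j trivial) v) -
      (if i = j then (1 : ℂ) else 0) • vfRep 𝔤 (.W n) V (tdX (.W n) i j trivial) v) ∈ p := by
  set E : Fin n → Module.End ℂ V := fun k => vfRep 𝔤 (.W n) V (tdX (.W n) k j trivial) with hE
  have hP : ∀ f : Poly n, vfAct 𝔤 V (⟨f • dd j, trivial⟩ : vf (.W n)) ((1 : Poly n) ⊗ₜ[ℂ] v) =
      ∑ k, dd k f ⊗ₜ[ℂ] E k v := by
    intro f
    rw [vfAct_tmul _ Finset.univ (fun k => dd k f) (fun k => tdX (.W n) k j trivial)]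
    · rw [show (f • dd j) 1 = 0 from Derivation.map_one_eq_zero _, TensorProduct.zero_tmul,
        zero_add]
      simp only [mul_one]
      rfl
    · intro a b
      change dd a ((f • dd j) (t b)) = _
      have he : ∀ k, entry a b (tdX (.W n) k j trivial : Witt n) = if a = k ∧ b = j then 1 else 0 :=
        fun k => entry_tdX _ a b
      rw [Derivation.smul_apply, dd_t, Finset.sum_congr rfl fun k _ => by rw [he k]]
      by_cases hb : j = b
      · subst hb
        simp
      · simp [hb, Ne.symm hb]
  have hk : ∀ (k : ℕ) (g : Poly n) (w : V),
      vfAct 𝔤 V (⟨t i ^ k • dd j, trivial⟩ : vf (.W n)) (g ⊗ₜ[ℂ] w) =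
        (t i ^ k * dd j g) ⊗ₜ[ℂ] w + ((k : Poly n) * t i ^ (k - 1) * g) ⊗ₜ[ℂ] E i w := by
    intro k g w
    refine vfAct_smul_dd (X := .W n) trivial trivial (fun l => ?_) g w
    rw [Derivation.leibniz_pow, dd_t]
    by_cases hl : l = i <;> simp [hl]
  have hm : ∀ (k : ℕ) f, ∑ q : Fin n, ((t i ^ k * dd j (dd q f)) ⊗ₜ[ℂ] E q v +
        ((k : Poly n) * t i ^ (k - 1) * dd q f) ⊗ₜ[ℂ] E i (E q v)) ∈ p := by
    intro k f
    have := hp.vfAct_mem ⟨t i ^ k • dd j, trivial⟩ (hp.vfAct_mem ⟨f • dd j, trivial⟩ (h1 v))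
    rw [hP, map_sum] at this
    simpa only [hk] using this
  have hT := p.add_mem (p.sub_mem (hm 2 h) (p.smul_mem (2 : ℂ) (hm 1 (t i * h))))
    (hm 0 (t i ^ 2 * h))
  have key : ∀ q : Fin n, ((t i ^ 2 * dd j (dd q h)) ⊗ₜ[ℂ] E q v +
        (((2 : ℕ) : Poly n) * t i ^ (2 - 1) * dd q h) ⊗ₜ[ℂ] E i (E q v)) -
      (2 : ℂ) • ((t i ^ 1 * dd j (dd q (t i * h))) ⊗ₜ[ℂ] E q v +
        (((1 : ℕ) : Poly n) * t i ^ (1 - 1) * dd q (t i * h)) ⊗ₜ[ℂ] E i (E q v)) +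
      ((t i ^ 0 * dd j (dd q (t i ^ 2 * h))) ⊗ₜ[ℂ] E q v +
        (((0 : ℕ) : Poly n) * t i ^ (0 - 1) * dd q (t i ^ 2 * h)) ⊗ₜ[ℂ] E i (E q v)) =
      if q = i then (-2 : ℂ) • h ⊗ₜ[ℂ] (E i (E q v) -
        (if i = j then (1 : ℂ) else 0) • E q v) else 0 := by
    intro q
    have two : algebraMap ℂ (Poly n) 2 = 2 := map_ofNat _ _
    have c1 : t i ^ 2 * dd j (dd q h) - (2 : ℂ) • (t i ^ 1 * dd j (dd q (t i * h))) +
        t i ^ 0 * dd j (dd q (t i ^ 2 * h)) = dd j (t i) * dd q (t i) * (2 * h) := by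
      simp only [dd_dd_mul, dd_dd_mul_sq, Algebra.smul_def, two]
      ring
    have c2 : ((2 : ℕ) : Poly n) * t i ^ (2 - 1) * dd q h -
        (2 : ℂ) • (((1 : ℕ) : Poly n) * t i ^ (1 - 1) * dd q (t i * h)) +
        ((0 : ℕ) : Poly n) * t i ^ (0 - 1) * dd q (t i ^ 2 * h) = - (dd q (t i) * (2 * h)) := by
      simp only [dd_mul, Algebra.smul_def, two]
      push_cast
      ring
    have c3 : (if q = i then (-2 : ℂ) • h ⊗ₜ[ℂ] (E i (E q v) -
        (if i = j then (1 : ℂ) else 0) • E q v) else 0) =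
        (dd j (t i) * dd q (t i) * (2 * h)) ⊗ₜ[ℂ] E q v +
        (-(dd q (t i) * (2 * h))) ⊗ₜ[ℂ] E i (E q v) := by
      have e2 : (2 : Poly n) * h = (2 : ℂ) • h := by rw [Algebra.smul_def, two]
      rw [dd_t, dd_t, e2]
      by_cases hq : q = i
      · by_cases hij : i = j
        · subst hij
          simp only [hq, if_true, one_smul, one_mul, TensorProduct.tmul_sub,
            TensorProduct.neg_tmul, ← TensorProduct.smul_tmul']
          module
        · simp only [hq, if_true, hij, Ne.symm hij, if_false, zero_smul, one_mul, zero_mul,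
            TensorProduct.zero_tmul, sub_zero, TensorProduct.neg_tmul,
            ← TensorProduct.smul_tmul']
          module
      · simp [hq]
    rw [c3, ← c1, ← c2]
    simp only [TensorProduct.add_tmul, TensorProduct.sub_tmul, ← TensorProduct.smul_tmul']
    module
  simp only [Finset.smul_sum, ← Finset.sum_sub_distrib, ← Finset.sum_add_distrib] at hT
  rw [Finset.sum_congr rfl fun q _ => key q, Finset.sum_ite_eq' Finset.univ, if_pos
    (Finset.mem_univ _)] at hT
  exact (Submodule.smul_mem_iff p (by norm_num)).1 hT

end Relations

/-! ### The quadratic relations determine the highest weights -/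

section MemVf

lemma pow_smul_dd_mem_special {n : ℕ} {i j : Fin n} (hij : i ≠ j) (k : ℕ) :
    t i ^ k • dd j ∈ vf (.S n) := by
  change _ ∈ special n
  rw [mem_special_iff, Finset.sum_eq_single j]
  · rw [Derivation.smul_apply, dd_t, if_pos rfl, smul_eq_mul, mul_one, Derivation.leibniz_pow, dd_t,
      if_neg hij.symm, smul_zero, smul_zero]
  · intro b _ hb
    rw [Derivation.smul_apply, dd_t, if_neg hb.symm, smul_zero, map_zero]
  · simp

lemma pow_smul_dd_mem_hamiltonian {m : ℕ} (i : Fin (2 * m)) (k : ℕ) :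
    t i ^ k • dd (partner i) ∈ vf (.H m) := by
  change _ ∈ hamiltonian m
  rw [mem_hamiltonian_iff]
  have h : ∀ a b, dd b ((t i ^ k • dd (partner i)) (t (partner a))) =
      if a = i ∧ b = i then (k : Poly (2 * m)) * t i ^ (k - 1) else 0 := by
    intro a b
    rw [Derivation.smul_apply, dd_t]
    have : partner i = partner a ↔ a = i := by
      rw [partner_eq_iff, partner_partner, eq_comm]
    simp only [this]
    by_cases ha : a = i <;> by_cases hb : b = i <;> simp [ha, hb, dd_t]
  intro a b
  rw [h, h]
  by_cases ha : a = i <;> by_cases hb : b = i <;> simp [ha, hb]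

lemma td_mem_special {n : ℕ} {i j : Fin n} (hij : i ≠ j) : td i j ∈ vf (.S n) := by
  have := pow_smul_dd_mem_special hij 1
  rwa [pow_one] at this

lemma td_mem_hamiltonian {m : ℕ} (i : Fin (2 * m)) : td i (partner i) ∈ vf (.H m) := by
  have := pow_smul_dd_mem_hamiltonian i 1
  rwa [pow_one] at this

lemma skewGrad_mem_special {n : ℕ} (i j : Fin n) (f : Poly n) :
    skewGrad (fun b c => (if b = j ∧ c = i then (1 : ℂ) else 0) - if b = i ∧ c = j then 1 else 0) f ∈
      vf (.S n) := by
  change _ ∈ special n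
  rw [mem_special_iff]
  have h : ∀ b, skewGrad (fun b c => (if b = j ∧ c = i then (1 : ℂ) else 0) -
      if b = i ∧ c = j then 1 else 0) f (t b) = (if b = j then dd i f else 0) -
      if b = i then dd j f else 0 := by
    intro b
    simp only [skewGrad_t, sub_smul, ite_smul, one_smul, zero_smul, Finset.sum_sub_distrib, ite_and]
    congr 1
    · by_cases hb : b = j <;> simp [hb]
    · by_cases hb : b = i <;> simp [hb]
  rw [Finset.sum_congr rfl fun b _ => congrArg (dd b) (h b)]
  simp only [map_sub, Finset.sum_sub_distrib]
  rw [Finset.sum_eq_single j, Finset.sum_eq_single i, if_pos rfl, if_pos rfl, dd_comm, sub_self] <;>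
    simp +contextual

lemma skewGrad_mem_hamiltonian {m : ℕ} (f : Poly (2 * m)) :
    skewGrad (fun b c => if c = partner b then sgn c else 0) f ∈ vf (.H m) := by
  change _ ∈ hamiltonian m
  rw [mem_hamiltonian_iff]
  intro a b
  simp only [skewGrad_t, ite_smul, zero_smul, Finset.sum_ite_eq', Finset.mem_univ, if_true,
    partner_partner, Derivation.map_smul, smul_smul, sgn_mul_sgn, one_smul]
  exact dd_comm b a f

end MemVf

section QuadRel

variable {M : Type*} [AddCommGroup M] [Module ℂ M]

/-- The relations `E_ij² = δ_ij E_ij` for `W`, `E_ij² = 0` for `i ≠ j` for `S`, and the vanishing of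
the squares of the long root vectors for `H`. -/
def QuadRel : {n : ℕ} → (X : Series n) → (vf0 X →ₗ⁅ℂ⁆ Module.End ℂ M) → Prop
  | _, .W n, ρ => ∀ (i j : Fin n) (v : M),
    ρ (tdX (.W n) i j trivial) (ρ (tdX (.W n) i j trivial) v) =
      (if i = j then (1 : ℂ) else 0) • ρ (tdX (.W n) i j trivial) v
  | _, .S n, ρ => ∀ (i j : Fin n) (h : i ≠ j) (v : M),
      ρ (tdX (.S n) i j (td_mem_special h)) (ρ (tdX (.S n) i j (td_mem_special h)) v) = 0
  | _, .H m, ρ => ∀ (i : Fin (2 * m)) (v : M), ρ (tdX (.H m) i (partner i) (td_mem_hamiltonian i))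
      (ρ (tdX (.H m) i (partner i) (td_mem_hamiltonian i)) v) = 0

end QuadRel

section Action

variable {𝔤 : Type*} [LieRing 𝔤] [LieAlgebra ℂ 𝔤] {n : ℕ} {X : Series n} {V : Type*}
  [AddCommGroup V] [Module ℂ V] [LieRingModule (toroidal0 𝔤 X) V]
  [LieModule ℂ (toroidal0 𝔤 X) V]

lemma IsStable.ofG_eq_zero (hV : LieModule.IsIrreducible ℂ (toroidal0 𝔤 X) V)
    {p : Submodule ℂ (Poly n ⊗[ℂ] V)} (hp : IsStable 𝔤 X p) (hbot : p ≠ ⊥) (htop : p ≠ ⊤) (x : 𝔤)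
    (v : V) : ⁅ofG 𝔤 X x, v⁆ = 0 :=
  hp.eq_zero_of_forall_tmul_mem hV htop fun f => by
    have := hp.tmul_ofG_mem f 1 x (hp.one_tmul_mem hV hbot v)
    rwa [mul_one] at this

lemma IsStable.K_eq_zero (hV : LieModule.IsIrreducible ℂ (toroidal0 𝔤 X) V)
    {p : Submodule ℂ (Poly n ⊗[ℂ] V)} (hp : IsStable 𝔤 X p) (hbot : p ≠ ⊥) (htop : p ≠ ⊤)
    (i : Fin n) (v : V) : ⁅K 𝔤 X i, v⁆ = 0 :=
  hp.eq_zero_of_forall_tmul_mem hV htop fun f => by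
    have := hp.tmul_K_mem f 1 i (hp.one_tmul_mem hV hbot v)
    rwa [mul_one] at this

lemma IsStable.quadRel (hV : LieModule.IsIrreducible ℂ (toroidal0 𝔤 X) V)
    {p : Submodule ℂ (Poly n ⊗[ℂ] V)} (hp : IsStable 𝔤 X p) (hbot : p ≠ ⊥) (htop : p ≠ ⊤) :
    QuadRel X (vfRep 𝔤 X V) := by
  have h1 := hp.one_tmul_mem hV hbot
  cases X with
  | W n =>
    intro i j v
    rw [← sub_eq_zero]
    exact hp.eq_zero_of_forall_tmul_mem hV htop fun f => hp.tmul_sq_sub_mem h1 i j f v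
  | S n =>
    intro i j hij v
    refine hp.eq_zero_of_forall_tmul_mem hV htop fun f => ?_
    refine hp.tmul_sq_mem h1 hij (pow_smul_dd_mem_special hij) (td_mem_special hij)
      (skewGrad_mem_special i j) one_ne_zero (fun b => ?_) f v
    simp [hij]
  | H m =>
    intro i v
    refine hp.eq_zero_of_forall_tmul_mem hV htop fun f => ?_
    refine hp.tmul_sq_mem h1 (partner_ne i).symm (pow_smul_dd_mem_hamiltonian i)
      (td_mem_hamiltonian i) skewGrad_mem_hamiltonian (c := sgn i)
      (left_ne_zero_of_mul_eq_one (sgn_mul_sgn i)) (fun b => ?_) f v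
    have : i = partner b ↔ b = partner i := by rw [← partner_eq_iff, eq_comm]
    simp only [this]

end Action

section Sl2

variable {M : Type*} [AddCommGroup M] [Module ℂ M] {e f h : Module.End ℂ M}

lemma mul_eq_neg_of_sq_eq_zero (hef : h = e * f - f * e) (hf : h * f - f * h = -((2 : ℂ) • f))
    (ff : f * f = 0) : h * f = -f := by
  have h1 : h * f + f * h = 0 := by
    have : h * f + f * h = e * (f * f) - f * f * e := by rw [hef]; noncomm_ring
    rw [this, ff]
    simp
  have h2 : (2 : ℂ) • (h * f) = (2 : ℂ) • (-f) := by
    have : (2 : ℂ) • (h * f) = (h * f + f * h) + (h * f - f * h) := by rw [two_smul]; abel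
    rw [this, h1, hf, zero_add, smul_neg]
  exact smul_right_injective _ two_ne_zero h2

lemma tripotent_of_sq_eq_zero (hef : h = e * f - f * e) (he : h * e - e * h = (2 : ℂ) • e)
    (hf : h * f - f * h = -((2 : ℂ) • f)) (ee : e * e = 0) (ff : f * f = 0) : h * h * h = h := by
  have h1 := mul_eq_neg_of_sq_eq_zero hef hf ff
  have h2 : h * e = e := by
    have := mul_eq_neg_of_sq_eq_zero (e := f) (f := e) (h := -h) (by rw [hef]; abel)
      (by rw [← he]; noncomm_ring) ee
    rw [neg_mul] at this
    exact neg_injective this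
  have h3 : h * h = e * f + f * e := by
    calc h * h = h * (e * f - f * e) := by rw [← hef]
      _ = h * e * f - h * f * e := by noncomm_ring
      _ = e * f + f * e := by rw [h1, h2]; noncomm_ring
  calc h * h * h = h * (h * h) := mul_assoc _ _ _
    _ = h * e * f + h * f * e := by rw [h3]; noncomm_ring
    _ = e * f - f * e := by rw [h1, h2]; noncomm_ring
    _ = h := hef.symm

lemma eigenvalue_of_sq_eq_zero (hef : h = e * f - f * e) (hf : h * f - f * h = -((2 : ℂ) • f))
    (ff : f * f = 0) {v : M} (hv : v ≠ 0) (ev : e v = 0) {c : ℂ} (hc : h v = c • v) :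
    c = 0 ∨ c = 1 := by
  have h1 := mul_eq_neg_of_sq_eq_zero hef hf ff
  have h2 : f * h = f := by
    have : f * h = h * f - (h * f - f * h) := by abel
    rw [this, hf, h1, two_smul]
    abel
  have h3 : c • f v = f v := by
    have := congrArg (fun g : Module.End ℂ M => g v) h2
    simp only [Module.End.mul_apply, hc, map_smul] at this
    exact this
  by_cases hc1 : c = 1
  · exact Or.inr hc1
  · left
    have h4 : f v = 0 := by
      have : (c - 1) • f v = 0 := by rw [sub_smul, h3, one_smul, sub_self]
      exact (smul_eq_zero.1 this).resolve_left (sub_ne_zero.2 hc1)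
    have h5 : h v = 0 := by
      rw [hef, LinearMap.sub_apply, Module.End.mul_apply, Module.End.mul_apply, h4, ev, map_zero,
        map_zero, sub_zero]
    rw [h5] at hc
    exact (smul_eq_zero.1 hc.symm).resolve_right hv

end Sl2

lemma td_t {n : ℕ} (i j c : Fin n) : td i j (t c) = if j = c then t i else 0 := by
  rw [td, Derivation.smul_apply, dd_t]
  split_ifs <;> simp

lemma lie_td {n : ℕ} (i j k l : Fin n) :
    ⁅td i j, td k l⁆ = (if j = k then td i l else 0) - if l = i then td k j else 0 := by
  apply witt_ext
  intro c
  rw [Derivation.commutator_apply, td_t, td_t, Derivation.sub_apply]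
  congr 1
  · by_cases h1 : l = c <;> by_cases h2 : j = k <;> simp [h1, h2, td_t]
  · by_cases h1 : j = c <;> by_cases h2 : l = i <;> simp [h1, h2, td_t]

section Weights

variable {n : ℕ} {X : Series n} {M : Type*} [AddCommGroup M] [Module ℂ M]
  {ρ : vf0 X →ₗ⁅ℂ⁆ Module.End ℂ M}

/-- The element `t_i d_i - t_j d_j`, as a bracket of root vectors. -/
def coroot (X : Series n) (i j : Fin n) (h1 : td i j ∈ vf X) (h2 : td j i ∈ vf X) : vf0 X :=
  ⁅tdX X i j h1, tdX X j i h2⁆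

lemma coe_coroot {i j : Fin n} (h1 : td i j ∈ vf X) (h2 : td j i ∈ vf X) :
    (coroot X i j h1 h2 : Witt n) = td i i - td j j := by
  change ⁅td i j, td j i⁆ = _
  rw [lie_td, if_pos rfl, if_pos rfl]

lemma coroot_mem_cartan {i j : Fin n} (h1 : td i j ∈ vf X) (h2 : td j i ∈ vf X) :
    coroot X i j h1 h2 ∈ cartan X := by
  change (coroot X i j h1 h2 : Witt n) ∈ Submodule.span ℂ (Set.range fun i : Fin n => td i i)
  rw [coe_coroot]
  exact Submodule.sub_mem _ (Submodule.subset_span ⟨i, rfl⟩) (Submodule.subset_span ⟨j, rfl⟩)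

section Root

variable {i j : Fin n} (hij : i ≠ j) (h1 : td i j ∈ vf X) (h2 : td j i ∈ vf X)

include hij

lemma rep_coroot_e : ρ (coroot X i j h1 h2) * ρ (tdX X i j h1) -
    ρ (tdX X i j h1) * ρ (coroot X i j h1 h2) = (2 : ℂ) • ρ (tdX X i j h1) := by
  have : ⁅coroot X i j h1 h2, tdX X i j h1⁆ = (2 : ℂ) • tdX X i j h1 := by
    apply Subtype.ext
    change ⁅(coroot X i j h1 h2 : Witt n), td i j⁆ = (2 : ℂ) • td i j
    rw [coe_coroot, sub_lie, lie_td, lie_td]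
    simp [hij.symm, two_smul]
  rw [← map_smul, ← this, LieHom.map_lie]
  rfl

lemma rep_coroot_f : ρ (coroot X i j h1 h2) * ρ (tdX X j i h2) -
    ρ (tdX X j i h2) * ρ (coroot X i j h1 h2) = -((2 : ℂ) • ρ (tdX X j i h2)) := by
  have : ⁅coroot X i j h1 h2, tdX X j i h2⁆ = -((2 : ℂ) • tdX X j i h2) := by
    apply Subtype.ext
    change ⁅(coroot X i j h1 h2 : Witt n), td j i⁆ = -((2 : ℂ) • td j i)
    rw [coe_coroot, sub_lie, lie_td, lie_td]
    simp [hij, two_smul]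
    abel
  rw [← map_smul, ← map_neg, ← this, LieHom.map_lie]
  rfl

lemma rep_coroot_tripotent (e2 : ∀ v, ρ (tdX X i j h1) (ρ (tdX X i j h1) v) = 0)
    (f2 : ∀ v, ρ (tdX X j i h2) (ρ (tdX X j i h2) v) = 0) :
    ρ (coroot X i j h1 h2) * ρ (coroot X i j h1 h2) * ρ (coroot X i j h1 h2) =
      ρ (coroot X i j h1 h2) :=
  tripotent_of_sq_eq_zero (LieHom.map_lie ρ _ _) (rep_coroot_e hij h1 h2)
    (rep_coroot_f hij h1 h2) (LinearMap.ext e2) (LinearMap.ext f2)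

lemma IsHighestWeight.coroot_eq {μ : Module.Dual ℂ (cartan X)} {v : M}
    (h : IsHighestWeight ρ μ v) (hv : v ≠ 0) (hr : rk X i < rk X j)
    (f2 : ∀ v, ρ (tdX X j i h2) (ρ (tdX X j i h2) v) = 0) :
    μ ⟨coroot X i j h1 h2, coroot_mem_cartan h1 h2⟩ = 0 ∨
      μ ⟨coroot X i j h1 h2, coroot_mem_cartan h1 h2⟩ = 1 := by
  refine eigenvalue_of_sq_eq_zero (LieHom.map_lie ρ _ _) (rep_coroot_f hij h1 h2)
    (LinearMap.ext f2) hv (h.killed _ ?_) (h.weight ⟨coroot X i j h1 h2, coroot_mem_cartan h1 h2⟩)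
  rw [mem_nPos_iff]
  intro a b hab
  rw [entry_tdX, if_neg]
  rintro ⟨rfl, rfl⟩
  exact hab hr

end Root

lemma coe_eq_sum_of_mem_cartan {D : vf0 X} (hD : D ∈ cartan X) :
    (D : Witt n) = ∑ i, entry i i (D : Witt n) • td i i := by
  rw [mem_cartan_iff] at hD
  conv_lhs => rw [eq_ofMatrix D.2.2, ofMatrix]
  refine Finset.sum_congr rfl fun i _ => ?_
  rw [Finset.sum_eq_single i]
  · intro j _ hj
    rw [hD i j hj.symm, zero_smul]
  · simp

lemma mu_apply (k : ℕ) (D : cartan X) :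
    mu X k D = ∑ i : Fin n, if i.val < k then entry i i (D : Witt n) else 0 := by
  rw [mu, LinearMap.sum_apply, Finset.sum_filter]
  rfl

lemma entry_eq_neg_of_hamiltonian {m : ℕ} (D : vf0 (.H m)) (i : Fin m) :
    entry (hi i) (hi i) (D : Witt (2 * m)) = -entry (lo i) (lo i) (D : Witt (2 * m)) := by
  have := matCond_entry D (lo i) (hi i)
  simpa using this

/-- A `{0, 1}`-valued antitone sequence is the indicator of an initial segment. -/
lemma exists_threshold {N : ℕ} (a : Fin N → ℂ) (h01 : ∀ i, a i = 0 ∨ a i = 1)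
    (hanti : ∀ i j, i < j → a j = 1 → a i = 1) :
    ∃ k ≤ N, ∀ i, a i = if i.val < k then 1 else 0 := by
  classical
  have hex : ∃ k, ∀ i : Fin N, k ≤ i.val → a i = 0 := ⟨N, fun i hi => absurd i.2 (by omega)⟩
  refine ⟨Nat.find hex, Nat.find_min' hex fun i hi => absurd i.2 (by omega), fun i => ?_⟩
  split_ifs with hi
  · have hlt := Nat.find_min hex (m := Nat.find hex - 1) (by omega)
    push Not at hlt
    obtain ⟨j, hj, hj0⟩ := hlt
    have hj1 := (h01 j).resolve_left hj0
    rcases lt_or_eq_of_le (show i.val ≤ j.val by omega) with hl | hl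
    · exact hanti i j hl hj1
    · rwa [Fin.ext hl]
  · exact Nat.find_spec hex i (by omega)

lemma eq_sum_smul {ι : Type*} [Fintype ι] {D : vf0 X} (a : ι → ℂ) (c : ι → vf0 X)
    (h : (D : Witt n) = ∑ i, a i • (c i : Witt n)) : D = ∑ i, a i • c i := by
  apply Subtype.ext
  rw [h]
  exact (map_sum (vf0 X).toSubmodule.subtype (fun i => a i • c i) Finset.univ).symm

lemma tdX_mem_cartan (i : Fin n) (h : td i i ∈ vf X) : tdX X i i h ∈ cartan X :=
  Submodule.subset_span ⟨i, rfl⟩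

lemma eq_sum_tdX {D : vf0 (.W n)} (hD : D ∈ cartan (.W n)) :
    D = ∑ i, entry i i (D : Witt n) • tdX (.W n) i i trivial :=
  eq_sum_smul _ _ (coe_eq_sum_of_mem_cartan hD)

/-- The element `t_i d_i - t_o d_o` of `𝔰𝔩_n`. -/
def specialDiag (o i : Fin n) : vf0 (.S n) :=
  if h : i = o then 0 else coroot (.S n) i o (td_mem_special h) (td_mem_special (Ne.symm h))

lemma specialDiag_self (o : Fin n) : specialDiag o o = 0 := dif_pos rfl

lemma specialDiag_of_ne {o i : Fin n} (h : i ≠ o) : specialDiag o i =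
    coroot (.S n) i o (td_mem_special h) (td_mem_special h.symm) := dif_neg h

lemma coe_specialDiag (o i : Fin n) : (specialDiag o i : Witt n) = td i i - td o o := by
  by_cases h : i = o
  · subst h
    rw [specialDiag_self, sub_self]
    rfl
  · rw [specialDiag_of_ne h, coe_coroot]

lemma specialDiag_mem_cartan (o i : Fin n) : specialDiag o i ∈ cartan (.S n) := by
  by_cases h : i = o
  · subst h
    rw [specialDiag_self]
    exact Submodule.zero_mem _
  · rw [specialDiag_of_ne h]
    exact coroot_mem_cartan _ _

lemma eq_sum_specialDiag (o : Fin n) {D : vf0 (.S n)} (hD : D ∈ cartan (.S n)) :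
    D = ∑ i, entry i i (D : Witt n) • specialDiag o i := by
  have htr : ∑ i, entry i i (D : Witt n) = 0 := matCond_entry D
  refine eq_sum_smul _ _ ?_
  simp only [coe_specialDiag, smul_sub]
  rw [Finset.sum_sub_distrib, ← Finset.sum_smul, htr, zero_smul, sub_zero]
  exact coe_eq_sum_of_mem_cartan hD

lemma td_lo_hi_mem {m : ℕ} (k : Fin m) : td (lo k) (hi k) ∈ vf (.H m) := by
  have := td_mem_hamiltonian (lo k)
  rwa [partner_lo] at this

lemma td_hi_lo_mem {m : ℕ} (k : Fin m) : td (hi k) (lo k) ∈ vf (.H m) := by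
  have := td_mem_hamiltonian (hi k)
  rwa [partner_hi] at this

/-- The element `t_k d_k - t_{k+m} d_{k+m}` of `𝔰𝔭_{2m}`. -/
def hamiltonianDiag {m : ℕ} (k : Fin m) : vf0 (.H m) :=
  coroot (.H m) (lo k) (hi k) (td_lo_hi_mem k) (td_hi_lo_mem k)

lemma coe_hamiltonianDiag {m : ℕ} (k : Fin m) :
    (hamiltonianDiag k : Witt (2 * m)) = td (lo k) (lo k) - td (hi k) (hi k) :=
  coe_coroot _ _

lemma hamiltonianDiag_mem_cartan {m : ℕ} (k : Fin m) : hamiltonianDiag k ∈ cartan (.H m) :=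
  coroot_mem_cartan _ _

lemma eq_sum_hamiltonianDiag {m : ℕ} {D : vf0 (.H m)} (hD : D ∈ cartan (.H m)) :
    D = ∑ k, entry (lo k) (lo k) (D : Witt (2 * m)) • hamiltonianDiag k := by
  refine eq_sum_smul _ _ ((coe_eq_sum_of_mem_cartan hD).trans ?_)
  rw [sum_lo_add_sum_hi, ← Finset.sum_add_distrib]
  refine Finset.sum_congr rfl fun k _ => ?_
  rw [coe_hamiltonianDiag, entry_eq_neg_of_hamiltonian, neg_smul, smul_sub, sub_eq_add_neg]

/-- The quadratic relations for `X = W`. -/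
lemma QuadRel.witt {ρ : vf0 (.W n) →ₗ⁅ℂ⁆ Module.End ℂ M} (hQ : QuadRel (.W n) ρ) (i j : Fin n)
    (v : M) : ρ (tdX (.W n) i j trivial) (ρ (tdX (.W n) i j trivial) v) =
      (if i = j then (1 : ℂ) else 0) • ρ (tdX (.W n) i j trivial) v := hQ i j v

/-- The quadratic relations for `X = S`. -/
lemma QuadRel.special {ρ : vf0 (.S n) →ₗ⁅ℂ⁆ Module.End ℂ M} (hQ : QuadRel (.S n) ρ) {i j : Fin n}
    (h : i ≠ j) (v : M) :
    ρ (tdX (.S n) i j (td_mem_special h)) (ρ (tdX (.S n) i j (td_mem_special h)) v) = 0 := hQ i j h v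

lemma QuadRel.lo_hi {m : ℕ} {ρ : vf0 (.H m) →ₗ⁅ℂ⁆ Module.End ℂ M} (hQ : QuadRel (.H m) ρ)
    (k : Fin m) (v : M) : ρ (tdX (.H m) (lo k) (hi k) (td_lo_hi_mem k))
      (ρ (tdX (.H m) (lo k) (hi k) (td_lo_hi_mem k)) v) = 0 := by
  have h : ∀ (i : Fin (2 * m)) (v : M), ρ (tdX (.H m) i (partner i) (td_mem_hamiltonian i))
      (ρ (tdX (.H m) i (partner i) (td_mem_hamiltonian i)) v) = 0 := hQ
  have := h (lo k) v
  simp only [partner_lo] at this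
  exact this

lemma QuadRel.hi_lo {m : ℕ} {ρ : vf0 (.H m) →ₗ⁅ℂ⁆ Module.End ℂ M} (hQ : QuadRel (.H m) ρ)
    (k : Fin m) (v : M) : ρ (tdX (.H m) (hi k) (lo k) (td_hi_lo_mem k))
      (ρ (tdX (.H m) (hi k) (lo k) (td_hi_lo_mem k)) v) = 0 := by
  have h : ∀ (i : Fin (2 * m)) (v : M), ρ (tdX (.H m) i (partner i) (td_mem_hamiltonian i))
      (ρ (tdX (.H m) i (partner i) (td_mem_hamiltonian i)) v) = 0 := hQ
  have := h (hi k) v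
  simp only [partner_hi] at this
  exact this

lemma QuadRel.specialDiag_tripotent {ρ : vf0 (.S n) →ₗ⁅ℂ⁆ Module.End ℂ M} (hQ : QuadRel (.S n) ρ)
    (o i : Fin n) : ρ (specialDiag o i) * ρ (specialDiag o i) * ρ (specialDiag o i) =
      ρ (specialDiag o i) := by
  by_cases h : i = o
  · subst h
    rw [specialDiag_self, map_zero, mul_zero]
  · rw [specialDiag_of_ne h]
    exact rep_coroot_tripotent h _ _ (hQ.special h) (hQ.special (Ne.symm h))

lemma QuadRel.hamiltonianDiag_tripotent {m : ℕ} {ρ : vf0 (.H m) →ₗ⁅ℂ⁆ Module.End ℂ M}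
    (hQ : QuadRel (.H m) ρ) (k : Fin m) :
    ρ (hamiltonianDiag k) * ρ (hamiltonianDiag k) * ρ (hamiltonianDiag k) =
      ρ (hamiltonianDiag k) :=
  rep_coroot_tripotent (lo_ne_hi k k) _ _ (hQ.lo_hi k) (hQ.hi_lo k)

/-- Under the quadratic relations, `𝔥_X` is spanned by elements that act by tripotents. -/
lemma QuadRel.exists_tripotent (hn : 2 ≤ n) (hQ : QuadRel X ρ) :
    ∃ (ι : Type) (_ : Fintype ι) (h : ι → vf0 X), (∀ k, h k ∈ cartan X) ∧
      cartan X ≤ Submodule.span ℂ (Set.range h) ∧ ∀ k, ρ (h k) * ρ (h k) * ρ (h k) = ρ (h k) := by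
  cases X with
  | W n =>
    refine ⟨Fin n, inferInstance, fun i => tdX (.W n) i i trivial, fun i => tdX_mem_cartan _ _,
      fun D hD => ?_, fun i => LinearMap.ext fun v => ?_⟩
    · rw [eq_sum_tdX hD]
      exact Submodule.sum_mem _ fun i _ => Submodule.smul_mem _ _ (Submodule.subset_span ⟨i, rfl⟩)
    · have h := hQ.witt i i
      simp only [if_true, one_smul] at h
      simp only [Module.End.mul_apply]
      rw [h, h]
  | S n =>
    refine ⟨Fin n, inferInstance, specialDiag ⟨0, by omega⟩, specialDiag_mem_cartan _,
      fun D hD => ?_, hQ.specialDiag_tripotent _⟩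
    rw [eq_sum_specialDiag ⟨0, by omega⟩ hD]
    exact Submodule.sum_mem _ fun i _ => Submodule.smul_mem _ _ (Submodule.subset_span ⟨i, rfl⟩)
  | H m =>
    refine ⟨Fin m, inferInstance, hamiltonianDiag, hamiltonianDiag_mem_cartan,
      fun D hD => ?_, hQ.hamiltonianDiag_tripotent⟩
    rw [eq_sum_hamiltonianDiag hD]
    exact Submodule.sum_mem _ fun i _ => Submodule.smul_mem _ _ (Submodule.subset_span ⟨i, rfl⟩)

lemma eq_mu_of_apply_eq {μ : Module.Dual ℂ (cartan X)} {k : ℕ} {a : Fin n → ℂ}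
    (ha : ∀ i, a i = if i.val < k then 1 else 0)
    (hμ : ∀ D : cartan X, μ D = ∑ i, entry i i (D : Witt n) * a i) : μ = mu X k := by
  refine LinearMap.ext fun D => ?_
  rw [hμ, mu_apply]
  refine Finset.sum_congr rfl fun i _ => ?_
  rw [ha]
  split_ifs <;> simp

end Weights

section Threshold

variable {n : ℕ} {X : Series n} {M : Type*} [AddCommGroup M] [Module ℂ M]
  {ρ : vf0 X →ₗ⁅ℂ⁆ Module.End ℂ M}

lemma dual_apply_of_eq_sum {ι : Type*} [Fintype ι] (μ : Module.Dual ℂ (cartan X)) {D : cartan X}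
    {a : ι → ℂ} {c : ι → vf0 X} (hc : ∀ i, c i ∈ cartan X) (h : (D : vf0 X) = ∑ i, a i • c i) :
    μ D = ∑ i, a i * μ ⟨c i, hc i⟩ := by
  have : D = ∑ i, a i • (⟨c i, hc i⟩ : cartan X) := by
    apply Subtype.ext
    rw [h]
    exact (map_sum (cartan X).subtype (fun i => a i • (⟨c i, hc i⟩ : cartan X)) Finset.univ).symm
  rw [this, map_sum]
  simp only [map_smul, smul_eq_mul]

lemma eq_one_of_sub {a b : ℂ} (ha : a = 0 ∨ a = 1) (hab : a - b = 0 ∨ a - b = 1) (hb : b = 1) :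
    a = 1 := by
  rcases ha with rfl | rfl
  · subst hb
    rcases hab with h | h <;> norm_num at h
  · rfl

lemma td_mem_witt (i j : Fin n) : td i j ∈ vf (.W n) := trivial

lemma QuadRel.weight_witt {ρ : vf0 (.W n) →ₗ⁅ℂ⁆ Module.End ℂ M} (hQ : QuadRel (.W n) ρ)
    {μ : Module.Dual ℂ (cartan (.W n))} {v : M} (hv : v ≠ 0) (h : IsHighestWeight ρ μ v) :
    ∃ k ≤ n, μ = mu (.W n) k := by
  let a : Fin n → ℂ := fun i => μ ⟨tdX (.W n) i i (td_mem_witt i i), tdX_mem_cartan _ _⟩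
  have h01 : ∀ i, a i = 0 ∨ a i = 1 := by
    intro i
    have h1 : ρ (tdX (.W n) i i (td_mem_witt i i)) v = a i • v := h.weight ⟨_, tdX_mem_cartan _ _⟩
    have h2 := hQ.witt i i v
    rw [if_pos rfl, one_smul, h1, map_smul, h1, smul_smul, ← sub_eq_zero, ← sub_smul] at h2
    have h3 : a i * (a i - 1) = 0 := by
      rw [mul_sub, mul_one]
      exact (smul_eq_zero.1 h2).resolve_right hv
    rcases mul_eq_zero.1 h3 with h | h
    · exact Or.inl h
    · exact Or.inr (sub_eq_zero.1 h)
  have hanti : ∀ i j, i < j → a j = 1 → a i = 1 := by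
    intro i j hij
    refine eq_one_of_sub (h01 i) ?_
    have e : coroot (.W n) i j (td_mem_witt i j) (td_mem_witt j i) =
        tdX (.W n) i i (td_mem_witt i i) - tdX (.W n) j j (td_mem_witt j j) :=
      Subtype.ext (coe_coroot _ _)
    have e : a i - a j = μ ⟨coroot (.W n) i j (td_mem_witt i j) (td_mem_witt j i),
        coroot_mem_cartan _ _⟩ := by
      rw [← map_sub]
      exact congrArg μ (Subtype.ext e.symm)
    rw [e]
    refine h.coroot_eq hij.ne _ _ hv (by simpa [rk] using hij) fun u => ?_
    rw [hQ.witt, if_neg hij.ne', zero_smul]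
  obtain ⟨k, hk, hka⟩ := exists_threshold a h01 hanti
  exact ⟨k, hk, eq_mu_of_apply_eq hka fun D => dual_apply_of_eq_sum μ _ (eq_sum_tdX D.2)⟩

lemma QuadRel.weight_special (hn : 2 ≤ n) {ρ : vf0 (.S n) →ₗ⁅ℂ⁆ Module.End ℂ M}
    (hQ : QuadRel (.S n) ρ) {μ : Module.Dual ℂ (cartan (.S n))} {v : M} (hv : v ≠ 0)
    (h : IsHighestWeight ρ μ v) : ∃ k ≤ n - 1, μ = mu (.S n) k := by
  let o : Fin n := ⟨n - 1, by omega⟩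
  let a : Fin n → ℂ := fun i => μ ⟨specialDiag o i, specialDiag_mem_cartan o i⟩
  have ho : a o = 0 := by
    have : (⟨specialDiag o o, specialDiag_mem_cartan o o⟩ : cartan (.S n)) = 0 :=
      Subtype.ext (specialDiag_self o)
    simp only [a]
    rw [this, map_zero]
  have hd : ∀ i j, i < j → a i - a j = 0 ∨ a i - a j = 1 := by
    intro i j hij
    have e : a i - a j = μ ⟨coroot (.S n) i j (td_mem_special hij.ne) (td_mem_special hij.ne'),
        coroot_mem_cartan _ _⟩ := by
      rw [← map_sub]
      congr 1
      apply Subtype.ext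
      apply Subtype.ext
      change (specialDiag o i : Witt n) - (specialDiag o j : Witt n) = (coroot (.S n) i j _ _ : Witt n)
      rw [coe_specialDiag, coe_specialDiag, coe_coroot, sub_sub_sub_cancel_right]
    rw [e]
    exact h.coroot_eq hij.ne _ _ hv (by simpa [rk] using hij) (hQ.special hij.ne')
  have h01 : ∀ i, a i = 0 ∨ a i = 1 := by
    intro i
    by_cases hi : i = o
    · rw [hi]
      exact Or.inl ho
    · have := hd i o (Fin.lt_def.2 (by
        have : i.val ≠ n - 1 := fun hh => hi (Fin.ext hh)
        change i.val < n - 1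
        omega))
      rwa [ho, sub_zero] at this
  obtain ⟨k, hk, hka⟩ := exists_threshold a h01 fun i j hij => eq_one_of_sub (h01 i) (hd i j hij)
  refine ⟨k, ?_, eq_mu_of_apply_eq hka fun D => dual_apply_of_eq_sum μ _ (eq_sum_specialDiag o D.2)⟩
  by_contra hlt
  have := hka o
  rw [ho, if_pos (by change n - 1 < k; omega)] at this
  exact zero_ne_one this

lemma shortRoot_mem {m : ℕ} (i j : Fin m) :
    td (lo i) (lo j) - td (hi j) (hi i) ∈ vf (.H m) := by
  change _ ∈ hamiltonian m
  rw [mem_hamiltonian_iff]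
  intro a b
  simp only [Derivation.sub_apply, td_t, map_sub, apply_ite (dd a), apply_ite (dd b), dd_t, map_zero]
  rcases eq_lo_or_eq_hi a with ⟨a, rfl⟩ | ⟨a, rfl⟩ <;>
    rcases eq_lo_or_eq_hi b with ⟨b, rfl⟩ | ⟨b, rfl⟩ <;>
    simp only [partner_lo, partner_hi, hi_inj, lo_inj, hi_ne_lo, lo_ne_hi, sgn_lo, sgn_hi, if_false,
      one_smul, ite_self, sub_zero, zero_sub, neg_smul, smul_zero] <;>
    by_cases h1 : i = a <;> by_cases h2 : j = b <;> by_cases h3 : i = b <;> by_cases h4 : j = a <;>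
    simp [h1, h2, h3, h4, eq_comm]

/-- The root vector `t_i d_j - t_{j+m} d_{i+m}` of `𝔰𝔭_{2m}`. -/
def shortRoot {m : ℕ} (i j : Fin m) : vf0 (.H m) :=
  ⟨td (lo i) (lo j) - td (hi j) (hi i), shortRoot_mem i j,
    (witt0 _).sub_mem (td_mem_witt0 _ _) (td_mem_witt0 _ _)⟩

lemma QuadRel.weight_hamiltonian {m : ℕ} {ρ : vf0 (.H m) →ₗ⁅ℂ⁆ Module.End ℂ M}
    (hQ : QuadRel (.H m) ρ) {μ : Module.Dual ℂ (cartan (.H m))} {v : M} (hv : v ≠ 0)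
    (h : IsHighestWeight ρ μ v) : ∃ k ≤ m, μ = mu (.H m) k := by
  let a : Fin m → ℂ := fun i => μ ⟨hamiltonianDiag i, hamiltonianDiag_mem_cartan i⟩
  have hw : ∀ i, ρ (hamiltonianDiag i) v = a i • v := fun i =>
    h.weight ⟨hamiltonianDiag i, hamiltonianDiag_mem_cartan i⟩
  have h01 : ∀ i, a i = 0 ∨ a i = 1 := by
    intro i
    refine h.coroot_eq (lo_ne_hi i i) (td_lo_hi_mem i) (td_hi_lo_mem i) hv ?_ (hQ.hi_lo i)
    have hi := i.2
    simp only [rk, lo, PolyToroidal.hi]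
    push_cast
    omega
  have hanti : ∀ i j, i < j → a j = 1 → a i = 1 := by
    intro i j hij hj
    refine (h01 i).resolve_left fun hi0 => ?_
    have hjf : ⁅hamiltonianDiag j, shortRoot j i⁆ = shortRoot j i := by
      apply Subtype.ext
      change ⁅(hamiltonianDiag j : Witt (2 * m)), td (lo j) (lo i) - td (hi i) (hi j)⁆ =
        td (lo j) (lo i) - td (hi i) (hi j)
      rw [coe_hamiltonianDiag, lie_sub, sub_lie, sub_lie, lie_td, lie_td, lie_td, lie_td]
      simp [hij.ne, hij.ne']
    have hef : ⁅shortRoot i j, shortRoot j i⁆ = hamiltonianDiag i - hamiltonianDiag j := by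
      apply Subtype.ext
      change ⁅td (lo i) (lo j) - td (hi j) (hi i), td (lo j) (lo i) - td (hi i) (hi j)⁆ =
        (hamiltonianDiag i : Witt (2 * m)) - (hamiltonianDiag j : Witt (2 * m))
      rw [coe_hamiltonianDiag, coe_hamiltonianDiag, lie_sub, sub_lie, sub_lie, lie_td, lie_td,
        lie_td, lie_td]
      simp
      abel
    have he : ρ (shortRoot i j) v = 0 := by
      refine h.killed _ (Submodule.subset_span (Or.inl ⟨i, j, hij, rfl⟩))
    -- the weight of `f v` under the `j`-th diagonal element is `2`, not an eigenvalue of a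
    -- tripotent
    have hf2 : ρ (hamiltonianDiag j) (ρ (shortRoot j i) v) = (2 : ℂ) • ρ (shortRoot j i) v := by
      have := rep_lie ρ (hamiltonianDiag j) (shortRoot j i) v
      rw [hjf, hw, hj, one_smul, eq_sub_iff_add_eq] at this
      rw [← this, two_smul]
    have hf0 : ρ (shortRoot j i) v = 0 := by
      have := congrArg (fun g : Module.End ℂ M => g (ρ (shortRoot j i) v))
        (hQ.hamiltonianDiag_tripotent j)
      simp only [Module.End.mul_apply, hf2, map_smul, smul_smul, ← sub_eq_zero (b := (2 : ℂ) • _)] at this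
      rw [← sub_smul] at this
      exact (smul_eq_zero.1 this).resolve_left (by norm_num)
    have := rep_lie ρ (shortRoot i j) (shortRoot j i) v
    rw [hef, hf0, he, map_zero, map_zero, sub_zero, map_sub, LinearMap.sub_apply, hw, hw, hi0, hj,
      zero_smul, one_smul, zero_sub, neg_eq_zero] at this
    exact hv this
  obtain ⟨k, hk, hka⟩ := exists_threshold a h01 hanti
  refine ⟨k, hk, eq_mu_of_apply_eq (a := fun i => if i.val < k then 1 else 0) (fun _ => rfl)
    fun D => ?_⟩
  rw [sum_lo_add_sum_hi, dual_apply_of_eq_sum μ hamiltonianDiag_mem_cartan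
    (eq_sum_hamiltonianDiag D.2)]
  have h0 : ∀ i : Fin m, (if (hi i).val < k then (1 : ℂ) else 0) = 0 := fun i =>
    if_neg (by change ¬ (m + i.val < k); omega)
  simp only [h0, mul_zero, Finset.sum_const_zero, add_zero]
  exact Finset.sum_congr rfl fun i _ => congrArg _ (hka i)

/-- Under the quadratic relations, a highest weight is one of the `μ_k`. -/
lemma QuadRel.weight (hn : 2 ≤ n) (hQ : QuadRel X ρ) {μ : Module.Dual ℂ (cartan X)} {v : M}
    (hv : v ≠ 0) (h : IsHighestWeight ρ μ v) : ∃ k ≤ nX X, μ = mu X k := by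
  cases X with
  | W n => exact hQ.weight_witt hv h
  | S n => exact hQ.weight_special hn hv h
  | H m => exact hQ.weight_hamiltonian hv h

end Threshold

section Existence

variable {n : ℕ} {X : Series n} {M : Type*} [AddCommGroup M] [Module ℂ M]
  {ρ : vf0 X →ₗ⁅ℂ⁆ Module.End ℂ M}

lemma lie_eq_zero_of_mem_cartan {D E : vf0 X} (hD : D ∈ cartan X) (hE : E ∈ cartan X) :
    ⁅D, E⁆ = 0 := by
  rw [mem_cartan_iff] at hD hE
  apply vf0_ext
  intro i j
  rw [LieSubalgebra.coe_bracket, entry_lie D.2.2 E.2.2]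
  have h0 : entry i j ((0 : vf0 X) : Witt n) = 0 := map_zero (entry i j)
  rw [h0]
  refine Finset.sum_eq_zero fun k _ => ?_
  by_cases h1 : i = k
  · subst h1
    by_cases h2 : i = j
    · subst h2
      ring
    · rw [hD i j h2, hE i j h2, mul_zero, mul_zero, sub_zero]
  · rw [hD i k h1, hE i k h1, zero_mul, zero_mul, sub_zero]

/-- A joint eigenvector of `𝔥_X` has a weight. -/
lemma exists_dual_of_eigenvector {v : M} (hv : v ≠ 0)
    (h : ∀ D ∈ cartan X, ∃ a : ℂ, ρ D v = a • v) :
    ∃ μ : Module.Dual ℂ (cartan X), ∀ D : cartan X, ρ D v = μ D • v := by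
  choose a ha using fun D : cartan X => h D D.2
  refine ⟨{ toFun := a, map_add' := fun D E => ?_, map_smul' := fun c D => ?_ }, ha⟩
  · refine smul_left_injective ℂ hv ?_
    simp only
    rw [← ha, add_smul, ← ha, ← ha, Submodule.coe_add, map_add, LinearMap.add_apply]
  · refine smul_left_injective ℂ hv ?_
    simp only
    rw [← ha, RingHom.id_apply, smul_assoc, ← ha, Submodule.coe_smul, map_smul,
      LinearMap.smul_apply]

/-- An irreducible module satisfying the quadratic relations is a finite-dimensional highest weight
module: `𝔥_X` acts by commuting tripotents, hence diagonalizably with integrally bounded weights. -/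
lemma QuadRel.exists_isHighestWeight [Nontrivial M] (hn : 2 ≤ n) (hQ : QuadRel X ρ)
    (hs : StableTrivial ρ) :
    FiniteDimensional ℂ M ∧ ∃ (v : M) (μ : Module.Dual ℂ (cartan X)), v ≠ 0 ∧
      IsHighestWeight ρ μ v := by
  obtain ⟨ι, _, h, hc, hspan, h3⟩ := hQ.exists_tripotent hn
  have hcomm : ∀ k l, Commute (ρ (h k)) (ρ (h l)) := by
    intro k l
    have := LieHom.map_lie ρ (h k) (h l)
    rw [lie_eq_zero_of_mem_cartan (hc k) (hc l), map_zero] at this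
    exact sub_eq_zero.1 this.symm
  have hrange : ∀ D ∈ cartan X, ρ D ∈ Submodule.span ℂ (Set.range fun k => ρ (h k)) := by
    intro D hD
    have : ρ D ∈ (Submodule.span ℂ (Set.range h)).map (ρ : vf0 X →ₗ[ℂ] Module.End ℂ M) :=
      ⟨D, hspan hD, rfl⟩
    rw [Submodule.map_span, ← Set.range_comp] at this
    exact this
  obtain ⟨v, hv, heig, z, hz, htop, B, hB⟩ :=
    exists_extremal_eigenvector _ hcomm h3 (hrange _ (gradElt_mem_cartan X))
  obtain ⟨μ, hμ⟩ := exists_dual_of_eigenvector (ρ := ρ) hv fun D hD => by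
    have hle : Submodule.span ℂ (Set.range fun k => ρ (h k)) ≤
        (Submodule.span ℂ {v}).comap (LinearMap.applyₗ v) := by
      rw [Submodule.span_le]
      rintro _ ⟨k, rfl⟩
      obtain ⟨a, ha⟩ := heig k
      exact Submodule.mem_span_singleton.2 ⟨a, ha.symm⟩
    obtain ⟨a, ha⟩ := Submodule.mem_span_singleton.1 (hle (hrange D hD))
    exact ⟨a, ha.symm⟩
  have hhw : IsHighestWeight ρ μ v := by
    refine ⟨fun D hD => ?_, hμ⟩
    have hle : (⨆ q : ℤ, ⨆ _ : 0 < q, gr X q) ≤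
        LinearMap.ker ((LinearMap.applyₗ v).comp (ρ : vf0 X →ₗ[ℂ] Module.End ℂ M)) :=
      iSup₂_le fun q hq E hE => htop q hq _ (rep_gradElt_of_mem_gr ρ hE hz)
    exact hle (nPos_le_iSup_gr X hD)
  refine ⟨hhw.finiteDimensional hv hs (B := B) ?_, v, μ, hv, hhw⟩
  have hμz : μ ⟨gradElt X, gradElt_mem_cartan X⟩ = z :=
    smul_left_injective ℂ hv ((hμ ⟨gradElt X, gradElt_mem_cartan X⟩).symm.trans hz)
  rw [hμz]
  exact hB

end Existence

/-! ### Irreducibility -/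

section Irreducible

variable {𝔤 : Type*} [LieRing 𝔤] [LieAlgebra ℂ 𝔤] {n : ℕ} {X : Series n} {V : Type*}
  [AddCommGroup V] [Module ℂ V] [LieRingModule (toroidal0 𝔤 X) V]
  [LieModule ℂ (toroidal0 𝔤 X) V]

omit [LieModule ℂ (toroidal0 𝔤 X) V] in
lemma nontrivial_of_isIrreducible (hV : LieModule.IsIrreducible ℂ (toroidal0 𝔤 X) V) :
    Nontrivial V := by
  by_contra h
  rw [not_nontrivial_iff_subsingleton] at h
  have := hV
  exact bot_ne_top (α := LieSubmodule ℂ (toroidal0 𝔤 X) V)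
    (LieSubmodule.ext _ _ fun v => by simp [Subsingleton.elim v 0])

lemma exists_stable_of_not_isIrreducible (hV : LieModule.IsIrreducible ℂ (toroidal0 𝔤 X) V)
    (h : ¬ LieModule.IsIrreducible ℂ (Toroidal 𝔤 X) (ShenLarsson X V)) :
    ∃ p : Submodule ℂ (Poly n ⊗[ℂ] V), IsStable 𝔤 X p ∧ p ≠ ⊥ ∧ p ≠ ⊤ := by
  have := nontrivial_of_isIrreducible hV
  rw [isIrreducible_shenLarsson_iff] at h
  push Not at h
  exact h

section Simple

variable [FiniteDimensional ℂ 𝔤] [LieAlgebra.IsSimple ℂ 𝔤] {𝔥 : LieSubalgebra ℂ 𝔤}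
  [𝔥.IsCartanSubalgebra] (b : (LieAlgebra.IsKilling.rootSystem 𝔥).Base)

/-- If `A_n ⊗ V` is reducible, then `V` is one of the fundamental modules. -/
lemma exists_isL0_of_not_isIrreducible (hn : 2 ≤ n)
    (hV : LieModule.IsIrreducible ℂ (toroidal0 𝔤 X) V)
    (h : ¬ LieModule.IsIrreducible ℂ (Toroidal 𝔤 X) (ShenLarsson X V)) :
    ∃ k ≤ nX X, IsL0 b X 0 (mu X k) 0 V := by
  have := nontrivial_of_isIrreducible hV
  obtain ⟨p, hp, hbot, htop⟩ := exists_stable_of_not_isIrreducible hV h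
  have hg := hp.ofG_eq_zero hV hbot htop
  have hK := hp.K_eq_zero hV hbot htop
  have hQ := hp.quadRel hV hbot htop
  obtain ⟨hfin, v, μ, hv, hw⟩ := hQ.exists_isHighestWeight hn (stableTrivial_vfRep hV hg hK)
  obtain ⟨k, hk, rfl⟩ := hQ.weight hn hv hw
  refine ⟨k, hk, hV, hfin, ⟨v, hv, fun α _ x _ => hg x v, fun x => ?_, hw.killed, hw.weight⟩,
    fun i v => ?_⟩
  · rw [hg, LinearMap.zero_apply, zero_smul]
  · rw [hK, Pi.zero_apply, zero_smul]

/-- The parameters of a highest weight module `V` with `A_n ⊗ V` reducible. -/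
lemma IsL0.parameters {b : (LieAlgebra.IsKilling.rootSystem 𝔥).Base} (hn : 2 ≤ n)
    {l : Module.Dual ℂ 𝔥} {μ : Module.Dual ℂ (cartan X)} {c : Fin n → ℂ} (hL : IsL0 b X l μ c V)
    (h : ¬ LieModule.IsIrreducible ℂ (Toroidal 𝔤 X) (ShenLarsson X V)) :
    ∃ k ≤ nX X, l = 0 ∧ μ = mu X k ∧ c = 0 := by
  have hV := hL.irreducible
  obtain ⟨p, hp, hbot, htop⟩ := exists_stable_of_not_isIrreducible hV h
  obtain ⟨v, hv, -, hh, hpos, hwt⟩ := hL.highestWeight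
  obtain ⟨k, hk, hμ⟩ := (hp.quadRel hV hbot htop).weight hn hv (μ := μ) ⟨hpos, hwt⟩
  refine ⟨k, hk, LinearMap.ext fun x => ?_, hμ, funext fun i => ?_⟩
  · have := hh x
    rw [hp.ofG_eq_zero hV hbot htop] at this
    exact (smul_eq_zero.1 this.symm).resolve_right hv
  · have := hL.central i v
    rw [hp.K_eq_zero hV hbot htop] at this
    exact (smul_eq_zero.1 this.symm).resolve_right hv

end Simple

end Irreducible

section TopWeight

lemma exists_dd_eq {n : ℕ} (i : Fin n) (f : Poly n) : ∃ g, dd i g = f := by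
  induction f using MvPolynomial.induction_on' with
  | monomial u a =>
    refine ⟨(MvPolynomial.monomial (u + Finsupp.single i 1) (a / (u i + 1)) :
      MvPolynomial (Fin n) ℂ), ?_⟩
    have h : (u i : ℂ) + 1 ≠ 0 := by exact_mod_cast Nat.succ_ne_zero (u i)
    refine (MvPolynomial.pderiv_monomial (i := i)).trans ?_
    rw [add_tsub_cancel_right, Finsupp.add_apply, Finsupp.single_eq_same, Nat.cast_add, Nat.cast_one,
      div_mul_cancel₀ _ h]
  | add p q hp hq =>
    obtain ⟨p', rfl⟩ := hp
    obtain ⟨q', rfl⟩ := hq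
    exact ⟨p' + q', map_add _ _ _⟩

variable {𝔤 : Type*} [LieRing 𝔤] [LieAlgebra ℂ 𝔤] {n : ℕ} {V : Type*}
  [AddCommGroup V] [Module ℂ V] [LieRingModule (toroidal0 𝔤 (.W n)) V]
  [LieModule ℂ (toroidal0 𝔤 (.W n)) V]

/-- On a highest weight vector of weight `μ_n`, `𝔤𝔩_n` acts through the trace: `E_ij v`, `i ≠ j`, is
an eigenvector of the idempotent `E_ii` for the eigenvalue `2`. -/
lemma QuadRel.rep_tdX_eq {M : Type*} [AddCommGroup M] [Module ℂ M]
    {ρ : vf0 (.W n) →ₗ⁅ℂ⁆ Module.End ℂ M} (hQ : QuadRel (.W n) ρ) {v : M}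
    (hv : IsHighestWeight ρ (mu (.W n) n) v) (i j : Fin n) :
    ρ (tdX (.W n) i j (td_mem_witt i j)) v = (if i = j then (1 : ℂ) else 0) • v := by
  have hdiag : ∀ i, ρ (tdX (.W n) i i (td_mem_witt i i)) v = v := by
    intro i
    have := hv.weight ⟨tdX (.W n) i i (td_mem_witt i i), tdX_mem_cartan _ _⟩
    rw [mu_apply, Finset.sum_eq_single i] at this
    · simp only [entry_tdX, i.2, if_true, and_self, one_smul] at this
      exact this
    · intro k _ hk
      simp only [entry_tdX, hk, false_and, if_false, ite_self]
    · simp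
  split_ifs with hij
  · subst hij
    rw [hdiag, one_smul]
  rw [zero_smul]
  have hl : ⁅tdX (.W n) i i (td_mem_witt i i), tdX (.W n) i j (td_mem_witt i j)⁆ =
      tdX (.W n) i j (td_mem_witt i j) := by
    apply Subtype.ext
    change ⁅td i i, td i j⁆ = td i j
    rw [lie_td, if_pos rfl, if_neg (Ne.symm hij), sub_zero]
  set w := ρ (tdX (.W n) i j (td_mem_witt i j)) v with hw
  have h2 : ρ (tdX (.W n) i i (td_mem_witt i i)) w = (2 : ℂ) • w := by
    have := rep_lie ρ (tdX (.W n) i i (td_mem_witt i i)) (tdX (.W n) i j (td_mem_witt i j)) v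
    rw [hl, hdiag, ← hw, eq_sub_iff_add_eq] at this
    rw [← this, two_smul]
  have h4 := hQ.witt i i w
  rw [if_pos rfl, one_smul] at h4
  have h5 : ρ (tdX (.W n) i i (td_mem_witt i i)) (ρ (tdX (.W n) i i (td_mem_witt i i)) w) =
    ρ (tdX (.W n) i i (td_mem_witt i i)) w := h4
  rw [h2, map_smul, h2, ← sub_eq_zero, smul_smul, ← sub_smul] at h5
  exact (smul_eq_zero.1 h5).resolve_left (by norm_num)

/-- For the weight `μ_n` of `W_n`, `A_n ⊗ V` is the module of `n`-forms. It has no proper submodule: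
`g d_i` sends `1 ⊗ v` to `∂_i g ⊗ v`, and `∂_i` is surjective. -/
lemma isIrreducible_of_weight_top (hn : 2 ≤ n)
    (hV : LieModule.IsIrreducible ℂ (toroidal0 𝔤 (.W n)) V)
    {v : V} (hv0 : v ≠ 0) (hv : IsHighestWeight (vfRep 𝔤 (.W n) V) (mu (.W n) n) v) :
    LieModule.IsIrreducible ℂ (Toroidal 𝔤 (.W n)) (ShenLarsson (.W n) V) := by
  by_contra hirr
  obtain ⟨p, hp, hbot, htop⟩ := exists_stable_of_not_isIrreducible hV hirr
  have hQ := hp.quadRel hV hbot htop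
  refine hv0 (hp.eq_zero_of_forall_tmul_mem hV htop fun f => ?_)
  let o : Fin n := ⟨0, by omega⟩
  obtain ⟨g, rfl⟩ := exists_dd_eq o f
  have hmem := hp.vfAct_mem (⟨g • dd o, trivial⟩ : vf (.W n)) (hp.one_tmul_mem hV hbot v)
  rw [vfAct_tmul _ Finset.univ (fun k => dd k g) (fun k => tdX (.W n) k o (td_mem_witt k o)),
    Derivation.map_one_eq_zero, TensorProduct.zero_tmul, zero_add, Finset.sum_eq_single o] at hmem
  · rw [hQ.rep_tdX_eq hv, if_pos rfl, one_smul, mul_one] at hmem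
    exact hmem
  · intro k _ hk
    rw [hQ.rep_tdX_eq hv, if_neg hk, zero_smul, TensorProduct.tmul_zero]
  · simp
  · intro i j
    change dd i ((g • dd o) (t j)) = _
    rw [Derivation.smul_apply, dd_t]
    by_cases h : o = j
    · simp [h, entry_tdX]
    · simp [h, entry_tdX, Ne.symm h]

end TopWeight

/-! ### Reducibility: the current algebra acts by zero -/

section TrivialG

variable {𝔤 : Type*} [LieRing 𝔤] [LieAlgebra ℂ 𝔤] [FiniteDimensional ℂ 𝔤] [LieAlgebra.IsSimple ℂ 𝔤]
  {𝔥 : LieSubalgebra ℂ 𝔤} [𝔥.IsCartanSubalgebra]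
  {b : (LieAlgebra.IsKilling.rootSystem 𝔥).Base}

open LieAlgebra LieAlgebra.IsKilling

/-- A highest weight vector of weight `0` in a finite-dimensional module is invariant: by
`𝔰𝔩₂`-theory the negative root vectors kill it too. -/
lemma lie_eq_zero_of_highestWeight_zero {M : Type*} [AddCommGroup M] [Module ℂ M]
    [LieRingModule 𝔤 M] [LieModule ℂ 𝔤 M] [FiniteDimensional ℂ M] {v : M}
    (hpos : ∀ α, b.IsPos α → ∀ x ∈ rootSpace 𝔥 α.1, ⁅x, v⁆ = 0)
    (hh : ∀ h : 𝔥, ⁅(h : 𝔤), v⁆ = 0) (x : 𝔤) : ⁅x, v⁆ = 0 := by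
  by_cases hv : v = 0
  · rw [hv, lie_zero]
  have hneg : ∀ α, b.IsPos α → ∀ x ∈ rootSpace 𝔥 (-(α.1 : LieModule.Weight ℂ 𝔥 𝔤)), ⁅x, v⁆ = 0 := by
    intro α hα x hx
    have hα0 : α.1.IsNonZero := 𝔥.isNonZero_coe_root α
    obtain ⟨h, e, f, ht, he, hf⟩ := exists_isSl2Triple_of_weight_isNonZero hα0
    have hprim : ht.HasPrimitiveVectorWith v (0 : ℂ) :=
      { ne_zero := hv
        lie_h := by rw [ht.h_eq_coroot hα0 he hf, hh, zero_smul]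
        lie_e := hpos α hα e he }
    have hfv : ⁅f, v⁆ = 0 := by
      have := hprim.pow_toEnd_f_eq_zero_of_eq_nat (n := 0) Nat.cast_zero.symm
      rwa [zero_add, pow_one, LieModule.toEnd_apply_apply] at this
    have hα0' : (-α.1).IsNonZero := by simpa using hα0
    have hf0 : (⟨f, hf⟩ : rootSpace 𝔥 (-⇑α.1)) ≠ 0 := fun h0 => ht.f_ne_zero (congrArg Subtype.val h0)
    obtain ⟨c, hc⟩ := exists_smul_eq_of_finrank_eq_one (finrank_rootSpace_eq_one _ hα0') hf0 ⟨x, hx⟩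
    have : x = c • f := (congrArg Subtype.val hc).symm
    rw [this, smul_lie, hfv, smul_zero]
  let p : Submodule ℂ 𝔤 := LinearMap.ker ((LinearMap.applyₗ v).comp
    (LieModule.toEnd ℂ 𝔤 M : 𝔤 →ₗ[ℂ] Module.End ℂ M))
  have hp : ∀ y, y ∈ p ↔ ⁅y, v⁆ = 0 := fun y => Iff.rfl
  suffices p = ⊤ from (hp x).1 (this ▸ Submodule.mem_top)
  rw [eq_top_iff, ← LieSubmodule.top_toSubmodule (R := ℂ) (L := 𝔥),
    ← LieModule.iSup_genWeightSpace_eq_top' ℂ 𝔥 𝔤, LieSubmodule.iSup_toSubmodule]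
  refine iSup_le fun α y hy => ?_
  rw [hp]
  by_cases hα : α.IsZero
  · have hy0 : y ∈ rootSpace 𝔥 (0 : 𝔥 → ℂ) := by
      rw [← hα.eq]
      exact hy
    rw [rootSpace_zero_eq] at hy0
    exact hh ⟨y, hy0⟩
  · have hmem : α ∈ 𝔥.root := by simpa using hα
    let _ := (rootSystem 𝔥).indexNeg
    rcases RootPairing.Base.IsPos.or_neg b ⟨α, hmem⟩ with h | h
    · exact hpos _ h y hy
    · refine hneg _ h y ?_
      have hroot : (rootSystem 𝔥).root (-⟨α, hmem⟩) = -(rootSystem 𝔥).root ⟨α, hmem⟩ :=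
        ((rootSystem 𝔥).root_reflectionPerm _ _).trans ((rootSystem 𝔥).reflection_apply_self _)
      have hfun : (-⇑(-(⟨α, hmem⟩ : 𝔥.root)).1 : 𝔥 → ℂ) = ⇑α := by
        funext x
        have := congrArg (fun g : Module.Dual ℂ 𝔥 => -g x) hroot
        exact this.trans (neg_neg _)
      rw [hfun]
      exact hy

variable {n : ℕ} {X : Series n} {V : Type*}
  [AddCommGroup V] [Module ℂ V] [LieRingModule (toroidal0 𝔤 X) V]
  [LieModule ℂ (toroidal0 𝔤 X) V]

lemma IsL0.ofG_eq_zero {μ : Module.Dual ℂ (cartan X)} {c : Fin n → ℂ} (hL : IsL0 b X 0 μ c V)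
    (x : 𝔤) (v : V) : ⁅ofG 𝔤 X x, v⁆ = 0 := by
  have := hL.finiteDimensional
  let p : Submodule ℂ V := ⨅ x : 𝔤, LinearMap.ker (LieModule.toEnd ℂ (toroidal0 𝔤 X) V (ofG 𝔤 X x))
  have hp : ∀ u, u ∈ p ↔ ∀ x, ⁅ofG 𝔤 X x, u⁆ = 0 := by
    intro u
    simp [p]
  have hcomm : ∀ (Y : toroidal0 𝔤 X), (∀ x, ⁅Y, ofG 𝔤 X x⁆ = 0) → ∀ u ∈ p, ⁅Y, u⁆ ∈ p := by
    intro Y hY u hu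
    rw [hp] at hu ⊢
    intro x
    have := leibniz_lie Y (ofG 𝔤 X x) u
    rw [hY, hu, lie_zero, zero_lie, zero_add] at this
    exact this.symm
  have htop : p = ⊤ := by
    refine (eq_bot_or_eq_top_of_stable hL.irreducible p (fun x u hu => ?_)
      (fun i => hcomm _ fun x => K_lie 𝔤 X i _)
      (fun D => hcomm _ fun x => ofVf0_lie_ofG 𝔤 X D x)).resolve_left fun hbot => ?_
    · rw [(hp u).1 hu]
      exact p.zero_mem
    · obtain ⟨v, hv, hpos, hh, -⟩ := hL.highestWeight
      refine hv ?_
      rw [← Submodule.mem_bot ℂ, ← hbot, hp]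
      let _ : LieRingModule 𝔤 V := LieRingModule.compLieHom V (ofG 𝔤 X)
      have : LieModule ℂ 𝔤 V := LieModule.compLieHom V (ofG 𝔤 X)
      refine lie_eq_zero_of_highestWeight_zero (b := b) (M := V) hpos fun h => ?_
      exact (hh h).trans (zero_smul ℂ v)
  exact (hp v).1 (htop ▸ Submodule.mem_top) x

end TrivialG

/-! ### The fundamental modules inside the exterior algebra -/

section Fock

/-- The exterior algebra of `ℂⁿ`, with its creation and annihilation operators. -/
abbrev Fock (n : ℕ) : Type := ExteriorAlgebra ℂ (Fin n → ℂ)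

variable {n : ℕ}

/-- Left multiplication by the `a`-th standard basis vector. -/
def create (a : Fin n) : Module.End ℂ (Fock n) :=
  LinearMap.mulLeft ℂ (ExteriorAlgebra.ι ℂ (Pi.single a (1 : ℂ)))

/-- Contraction with the `b`-th coordinate form. -/
def annihilate (b : Fin n) : Module.End ℂ (Fock n) :=
  CliffordAlgebra.contractLeft (Q := (0 : QuadraticForm ℂ (Fin n → ℂ))) (LinearMap.proj b)

lemma annihilate_create (a b : Fin n) : annihilate b * create a =
    (if a = b then (1 : ℂ) else 0) • (1 : Module.End ℂ (Fock n)) - create a * annihilate b := by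
  refine LinearMap.ext fun x => ?_
  have h := CliffordAlgebra.contractLeft_ι_mul (Q := (0 : QuadraticForm ℂ (Fin n → ℂ)))
    (LinearMap.proj b) (Pi.single a (1 : ℂ)) x
  rw [LinearMap.proj_apply, Pi.single_apply] at h
  simp only [eq_comm (a := a)]
  exact h

lemma create_create (a b : Fin n) : create a * create b = -(create b * create a) := by
  refine LinearMap.ext fun x => ?_
  have h := ExteriorAlgebra.ι_add_mul_swap (R := ℂ) (Pi.single a (1 : ℂ)) (Pi.single b (1 : ℂ) : Fin n → ℂ)
  change ExteriorAlgebra.ι ℂ _ * (ExteriorAlgebra.ι ℂ _ * x) =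
    -(ExteriorAlgebra.ι ℂ _ * (ExteriorAlgebra.ι ℂ _ * x))
  rw [← mul_assoc, ← mul_assoc, eq_neg_iff_add_eq_zero, ← add_mul, h, zero_mul]

lemma annihilate_annihilate (a b : Fin n) :
    annihilate a * annihilate b = -(annihilate b * annihilate a) :=
  LinearMap.ext fun x => CliffordAlgebra.contractLeft_comm
    (Q := (0 : QuadraticForm ℂ (Fin n → ℂ))) (LinearMap.proj a) (LinearMap.proj b) x

lemma create_create_self (a : Fin n) (x : Fock n) : create a (create a x) = 0 := by
  have h := congrArg (fun g : Module.End ℂ (Fock n) => g x) (create_create a a)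
  have h2 : (2 : ℂ) • create a (create a x) = 0 := by
    rw [two_smul]
    exact eq_neg_iff_add_eq_zero.1 h
  exact (smul_eq_zero.1 h2).resolve_left two_ne_zero

/-- The image of a matrix under the action of `𝔤𝔩_n` on the exterior algebra. -/
def fockMatrix : (Fin n → Fin n → ℂ) →ₗ[ℂ] Module.End ℂ (Fock n) where
  toFun M := ∑ a, ∑ b, M a b • (create a * annihilate b)
  map_add' M N := by simp only [Pi.add_apply, add_smul, Finset.sum_add_distrib]
  map_smul' c M := by simp only [Pi.smul_apply, smul_eq_mul, mul_smul, Finset.smul_sum, RingHom.id_apply]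

lemma fockMatrix_apply (M : Fin n → Fin n → ℂ) :
    fockMatrix M = ∑ a, ∑ b, M a b • (create a * annihilate b) := rfl

lemma fockMatrix_mul_create (M : Fin n → Fin n → ℂ) (c : Fin n) :
    fockMatrix M * create c = create c * fockMatrix M + ∑ a, M a c • create a := by
  have h : ∀ a b, create a * annihilate b * create c =
      create c * (create a * annihilate b) + (if c = b then (1 : ℂ) else 0) • create a := by
    intro a b
    rw [mul_assoc, annihilate_create, mul_sub, ← mul_assoc, create_create a c, mul_smul_comm, mul_one,
      neg_mul, sub_neg_eq_add, mul_assoc, add_comm]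
  simp only [fockMatrix_apply, Finset.sum_mul, Finset.mul_sum, smul_mul_assoc, mul_smul_comm, h,
    smul_add, Finset.sum_add_distrib, ite_smul, smul_ite, one_smul, zero_smul, smul_zero,
    Finset.sum_ite_eq, Finset.mem_univ, if_true]

lemma fockMatrix_mul_annihilate (M : Fin n → Fin n → ℂ) (d : Fin n) :
    fockMatrix M * annihilate d = annihilate d * fockMatrix M - ∑ b, M d b • annihilate b := by
  have h : ∀ a b, create a * annihilate b * annihilate d =
      annihilate d * (create a * annihilate b) - (if a = d then (1 : ℂ) else 0) • annihilate b := by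
    intro a b
    rw [← mul_assoc (annihilate d), annihilate_create, sub_mul, smul_mul_assoc, one_mul, mul_assoc,
      mul_assoc, annihilate_annihilate b d, mul_neg]
    abel
  simp only [fockMatrix_apply, Finset.sum_mul, Finset.mul_sum, smul_mul_assoc, mul_smul_comm, h,
    smul_sub, Finset.sum_sub_distrib, ite_smul, smul_ite, one_smul, zero_smul, smul_zero]
  congr 1
  rw [Finset.sum_comm]
  simp

lemma fockMatrix_commutator (M N : Fin n → Fin n → ℂ) :
    fockMatrix (fun i j => ∑ k, (M i k * N k j - N i k * M k j)) =
      fockMatrix M * fockMatrix N - fockMatrix N * fockMatrix M := by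
  have h : ∀ c d, fockMatrix M * (create c * annihilate d) - create c * annihilate d * fockMatrix M =
      ∑ a, M a c • (create a * annihilate d) - ∑ b, M d b • (create c * annihilate b) := by
    intro c d
    rw [← mul_assoc, fockMatrix_mul_create, add_mul, mul_assoc, fockMatrix_mul_annihilate, mul_sub,
      Finset.mul_sum, Finset.sum_mul]
    simp only [smul_mul_assoc, mul_smul_comm, mul_assoc]
    abel
  have h2 : fockMatrix M * fockMatrix N - fockMatrix N * fockMatrix M =
      ∑ c, ∑ d, N c d • (∑ a, M a c • (create a * annihilate d) -
        ∑ b, M d b • (create c * annihilate b)) := by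
    rw [fockMatrix_apply N, Finset.mul_sum, Finset.sum_mul, ← Finset.sum_sub_distrib]
    refine Finset.sum_congr rfl fun c _ => ?_
    rw [Finset.mul_sum, Finset.sum_mul, ← Finset.sum_sub_distrib]
    refine Finset.sum_congr rfl fun d _ => ?_
    rw [← h, mul_smul_comm, smul_mul_assoc, smul_sub]
  rw [h2, fockMatrix_apply]
  simp only [Finset.sum_sub_distrib, sub_smul, Finset.sum_smul, smul_sub, Finset.smul_sum, smul_smul]
  congr 1
  · rw [Finset.sum_comm' (t' := Finset.univ) (s' := fun _ => Finset.univ) (by simp)]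
    conv_lhs => enter [2, j]; rw [Finset.sum_comm]
    rw [Finset.sum_comm]
    refine Finset.sum_congr rfl fun k _ => Finset.sum_congr rfl fun j _ =>
      Finset.sum_congr rfl fun i _ => by rw [mul_comm]
  · refine Finset.sum_congr rfl fun i _ => ?_
    rw [Finset.sum_comm]

/-- The action of `(X_n)_0` on the exterior algebra. -/
def fockRep (X : Series n) : vf0 X →ₗ⁅ℂ⁆ Module.End ℂ (Fock n) where
  toFun D := fockMatrix fun i j => entry i j (D : Witt n)
  map_add' D E := by
    rw [← map_add]
    congr 1
    funext i j
    exact map_add (entry i j) (D : Witt n) E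
  map_smul' c D := by
    rw [RingHom.id_apply, ← map_smul]
    congr 1
    funext i j
    exact map_smul (entry i j) c (D : Witt n)
  map_lie' {D E} := by
    refine Eq.trans (congrArg fockMatrix ?_) (fockMatrix_commutator _ _)
    funext i j
    exact entry_lie D.2.2 E.2.2 i j

lemma fockRep_apply (X : Series n) (D : vf0 X) :
    fockRep X D = ∑ a, ∑ b, entry a b (D : Witt n) • (create a * annihilate b) := rfl

/-- The wedge product of the first `k` basis vectors. -/
lemma exists_fock_vector {k : ℕ} (hk : k ≤ n) : ∃ e : Fock n, e ≠ 0 ∧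
    (∀ i : Fin n, i.val < k → create i e = 0) ∧ ∀ i : Fin n, k ≤ i.val → annihilate i e = 0 := by
  induction k with
  | zero =>
    exact ⟨1, one_ne_zero, fun i hi => absurd hi (Nat.not_lt_zero _), fun i _ =>
      CliffordAlgebra.contractLeft_one (Q := (0 : QuadraticForm ℂ (Fin n → ℂ))) (LinearMap.proj i)⟩
  | succ k ih =>
    obtain ⟨e, he, h1, h2⟩ := ih (by omega)
    let o : Fin n := ⟨k, hk⟩
    have hac : ∀ i, annihilate i (create o e) = (if o = i then (1 : ℂ) else 0) • e -
        create o (annihilate i e) := fun i =>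
      congrArg (fun g : Module.End ℂ (Fock n) => g e) (annihilate_create o i)
    refine ⟨create o e, fun h0 => he ?_, fun i hi => ?_, fun i hi => ?_⟩
    · have := hac o
      rw [h0, h2 o le_rfl, if_pos rfl, one_smul, map_zero, map_zero, sub_zero] at this
      exact this.symm
    · have hcc := congrArg (fun g : Module.End ℂ (Fock n) => g e) (create_create i o)
      simp only [Module.End.mul_apply, LinearMap.neg_apply] at hcc
      rcases Nat.lt_succ_iff_lt_or_eq.1 hi with hlt | heq
      · rw [hcc, h1 i hlt, map_zero, neg_zero]
      · have : i = o := Fin.ext heq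
        subst this
        exact create_create_self _ e
    · rw [hac, h2 i (by omega), if_neg, zero_smul, map_zero, sub_zero]
      intro h
      rw [← h] at hi
      exact absurd hi (by change ¬ (k + 1 ≤ k); omega)

lemma create_annihilate_eq {k : ℕ} {e : Fock n} (h1 : ∀ i : Fin n, i.val < k → create i e = 0)
    (h2 : ∀ i : Fin n, k ≤ i.val → annihilate i e = 0) (a b : Fin n)
    (hab : a = b ∨ a.val < k ∨ k ≤ b.val) :
    create a (annihilate b e) = (if a = b ∧ a.val < k then (1 : ℂ) else 0) • e := by
  have h := congrArg (fun g : Module.End ℂ (Fock n) => g e) (annihilate_create a b)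
  simp only [Module.End.mul_apply, LinearMap.sub_apply, LinearMap.smul_apply, Module.End.one_apply] at h
  by_cases hb : k ≤ b.val
  · rw [h2 b hb, map_zero, if_neg, zero_smul]
    rintro ⟨rfl, h⟩
    omega
  · have ha : a.val < k := by
      rcases hab with rfl | h | h <;> omega
    rw [h1 a ha, map_zero, eq_comm, sub_eq_zero] at h
    simp only [ha, and_true]
    exact h.symm

/-- `e_1 ∧ ⋯ ∧ e_k` is a highest weight vector for `k ≤ n_X`: every term `t_a d_b` of a positive root
vector has `a` among the first `k` indices or `b` not among them, so that it creates a factor that is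
already present or contracts with one that is absent. -/
lemma isHighestWeight_fock (X : Series n) {k : ℕ} (hk : k ≤ nX X) {e : Fock n}
    (h1 : ∀ i : Fin n, i.val < k → create i e = 0)
    (h2 : ∀ i : Fin n, k ≤ i.val → annihilate i e = 0) :
    IsHighestWeight (fockRep X) (mu X k) e := by
  have hrk : ∀ a b : Fin n, rk X a < rk X b → a.val < k ∨ k ≤ b.val := by
    intro a b hab
    by_contra hcon
    push Not at hcon
    cases X with
    | W n => simp only [rk] at hab; omega
    | S n => simp only [rk] at hab; omega
    | H m =>
      have := a.2
      simp only [rk, nX] at hab hk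
      split_ifs at hab <;> omega
  refine ⟨fun D hD => ?_, fun D => ?_⟩
  · rw [mem_nPos_iff] at hD
    rw [fockRep_apply, LinearMap.sum_apply]
    refine Finset.sum_eq_zero fun a _ => ?_
    rw [LinearMap.sum_apply]
    refine Finset.sum_eq_zero fun b _ => ?_
    by_cases hab : rk X a < rk X b
    · have hne : a ≠ b := by
        rintro rfl
        exact lt_irrefl _ hab
      rw [LinearMap.smul_apply, Module.End.mul_apply,
        create_annihilate_eq h1 h2 a b (Or.inr (hrk a b hab)), if_neg (fun h => hne h.1), zero_smul,
        smul_zero]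
    · rw [hD a b hab, zero_smul, LinearMap.zero_apply]
  · have hD := mem_cartan_iff.1 D.2
    rw [fockRep_apply, LinearMap.sum_apply, mu_apply, Finset.sum_smul]
    refine Finset.sum_congr rfl fun a _ => ?_
    rw [LinearMap.sum_apply, Finset.sum_eq_single a]
    · rw [LinearMap.smul_apply, Module.End.mul_apply, create_annihilate_eq h1 h2 a a (Or.inl rfl)]
      by_cases ha : a.val < k <;> simp [ha]
    · intro b _ hb
      rw [hD a b hb.symm, zero_smul, LinearMap.zero_apply]
    · simp

/-- The number operator is the scalar `k` on the submodule generated by `e_1 ∧ ⋯ ∧ e_k`. -/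
lemma sum_create_annihilate_of_mem_cyclic (X : Series n) {k : ℕ} (hk : k ≤ n) {e : Fock n}
    (h1 : ∀ i : Fin n, i.val < k → create i e = 0)
    (h2 : ∀ i : Fin n, k ≤ i.val → annihilate i e = 0) {f : Fock n}
    (hf : f ∈ cyclic (fockRep X) e) : ∑ a, create a (annihilate a f) = (k : ℂ) • f := by
  let N : Module.End ℂ (Fock n) := fockMatrix fun i j => if i = j then 1 else 0
  have hN : ∀ g, N g = ∑ a, create a (annihilate a g) := by
    intro g
    simp [N, fockMatrix_apply]
  have hcomm : ∀ D, N * fockRep X D = fockRep X D * N := by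
    intro D
    have := fockMatrix_commutator (fun i j => if i = j then (1 : ℂ) else 0)
      (fun i j => entry i j (D : Witt n))
    rw [eq_comm, ← sub_eq_zero]
    rw [← neg_sub, neg_eq_zero]
    refine this.symm.trans ?_
    rw [← map_zero (fockMatrix (n := n))]
    congr 1
    funext i j
    simp
  let p : Submodule ℂ (Fock n) := LinearMap.ker (N - (k : ℂ) • 1)
  have hp : ∀ g, g ∈ p ↔ N g = (k : ℂ) • g := by
    intro g
    simp [p, sub_eq_zero]
  rw [← hN, ← hp]
  refine cyclic_le (p := p) (fun D u hu => ?_) ?_ hf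
  · rw [hp] at hu ⊢
    have := congrArg (fun g : Module.End ℂ (Fock n) => g u) (hcomm D)
    simp only [Module.End.mul_apply, hu, map_smul] at this
    exact this
  · rw [hp, hN]
    simp only [create_annihilate_eq h1 h2 _ _ (Or.inl rfl), true_and]
    rw [← Finset.sum_smul]
    congr 1
    rw [Finset.sum_boole, Fin.card_filter_val_lt, min_eq_right hk]

end Fock

/-! ### The symbol of the exterior derivative -/

section Projection

/-- The matrix unit `E_ab`. -/
def unitMat {n : ℕ} (a b : Fin n) : Fin n → Fin n → ℂ := fun i j => if i = a ∧ j = b then 1 else 0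

/-- The identity matrix. -/
def idMat {n : ℕ} : Fin n → Fin n → ℂ := fun i j => if i = j then 1 else 0

/-- The image of `E_ab` under the equivariant projection of `𝔤𝔩_n` onto `(X_n)_0`, as a matrix. -/
def projMat : {n : ℕ} → Series n → Fin n → Fin n → Fin n → Fin n → ℂ
  | _, .W _, a, b => unitMat a b
  | _, .S n, a, b => unitMat a b - (if a = b then (n : ℂ)⁻¹ else 0) • idMat
  | _, .H _, a, b => (1 / 2 : ℂ) • (unitMat a b - (sgn a * sgn b) • unitMat (partner b) (partner a))

lemma matCond_projMat {n : ℕ} (X : Series n) (a b : Fin n) : MatCond X (projMat X a b) := by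
  cases X with
  | W n => trivial
  | S n =>
    have hn : (n : ℂ) ≠ 0 := Nat.cast_ne_zero.2 (by have := a.2; omega)
    change ∑ i, projMat (.S n) a b i i = 0
    simp only [projMat, unitMat, idMat, Pi.sub_apply, Pi.smul_apply, smul_eq_mul, if_true,
      Finset.sum_sub_distrib, mul_one, Finset.sum_const, Finset.card_univ, Fintype.card_fin,
      nsmul_eq_mul, ite_and, Finset.sum_ite_eq', Finset.mem_univ]
    split_ifs with h
    · rw [mul_inv_cancel₀ hn, sub_self]
    · rw [mul_zero, sub_zero]
  | H m =>
    intro p q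
    have e : ∀ x y : Fin (2 * m), partner x = y ↔ x = partner y := fun x y => partner_eq_iff
    simp only [projMat, unitMat, Pi.sub_apply, Pi.smul_apply, smul_eq_mul, e, partner_partner]
    by_cases h1 : q = a ∧ p = partner b
    · by_cases h2 : q = partner b ∧ p = a
      · rw [if_pos h1, if_pos h2, if_pos h2.symm, if_pos h1.symm, h1.1, h2.2]
      · rw [if_pos h1, if_neg h2, if_neg (fun h => h2 h.symm), if_pos h1.symm, h1.1, h1.2,
          sgn_partner]
        linear_combination (1 / 2 * sgn b) * sgn_mul_sgn a
    · by_cases h2 : q = partner b ∧ p = a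
      · rw [if_neg h1, if_pos h2, if_pos h2.symm, if_neg (fun h => h1 h.symm), h2.1, h2.2,
          sgn_partner]
        linear_combination (-(1 / 2) * sgn b) * sgn_mul_sgn a
      · rw [if_neg h1, if_neg h2, if_neg (fun h => h2 h.symm), if_neg (fun h => h1 h.symm)]
        ring

/-- The image of `E_ab` under the equivariant projection of `𝔤𝔩_n` onto `(X_n)_0`. -/
def proj0 {n : ℕ} (X : Series n) (a b : Fin n) : vf0 X :=
  mk0 X (projMat X a b) (matCond_projMat X a b)

lemma entry_proj0 {n : ℕ} (X : Series n) (a b i j : Fin n) :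
    entry i j (proj0 X a b : Witt n) = projMat X a b i j := entry_mk0 _ _ _ _ _

lemma entry_partner {m : ℕ} (D : vf0 (.H m)) (i j : Fin (2 * m)) :
    entry (partner i) j (D : Witt (2 * m)) =
      sgn i * sgn j * entry (partner j) i (D : Witt (2 * m)) := by
  have h := matCond_entry D (partner j) (partner i)
  rw [partner_partner, partner_partner, sgn_partner, sgn_partner] at h
  linear_combination (-sgn j) * h - entry (partner i) j (D : Witt (2 * m)) * sgn_mul_sgn j

lemma entry_partner_right {m : ℕ} (D : vf0 (.H m)) (i j : Fin (2 * m)) :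
    entry i (partner j) (D : Witt (2 * m)) =
      sgn i * sgn j * entry j (partner i) (D : Witt (2 * m)) := by
  have h := matCond_entry D j i
  linear_combination (sgn j) * h - entry i (partner j) (D : Witt (2 * m)) * sgn_mul_sgn j

lemma coe_lie_sum {n : ℕ} {X : Series n} (D : vf0 X) (a b i j : Fin n) :
    entry i j (((∑ k, entry k a (D : Witt n) • proj0 X k b -
      ∑ k, entry b k (D : Witt n) • proj0 X a k : vf0 X)) : Witt n) =
    ∑ k, entry k a (D : Witt n) * projMat X k b i j - ∑ k, entry b k (D : Witt n) * projMat X a k i j := by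
  have h : ∀ (c : Fin n → ℂ) (E : Fin n → vf0 X), entry i j ((∑ k, c k • E k : vf0 X) : Witt n) =
      ∑ k, c k * entry i j (E k : Witt n) := by
    intro c E
    rw [entry_coe_sum]
    exact Finset.sum_congr rfl fun k _ => map_smul (entry i j) (c k) (E k : Witt n)
  have h2 : ∀ E F : vf0 X, entry i j ((E - F : vf0 X) : Witt n) =
      entry i j (E : Witt n) - entry i j (F : Witt n) := fun E F => map_sub (entry i j) _ _
  rw [h2, h, h]
  simp only [entry_proj0]

/-- The projection of `𝔤𝔩_n` onto `(X_n)_0` is equivariant. -/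
lemma lie_proj0 {n : ℕ} (X : Series n) (D : vf0 X) (a b : Fin n) :
    ⁅D, proj0 X a b⁆ = ∑ k, entry k a (D : Witt n) • proj0 X k b -
      ∑ k, entry b k (D : Witt n) • proj0 X a k := by
  apply vf0_ext
  intro i j
  rw [coe_lie_sum, LieSubalgebra.coe_bracket, entry_lie D.2.2 (proj0 X a b).2.2]
  simp only [entry_proj0]
  have hu : ∀ x y : Fin n, ∑ k, (entry i k (D : Witt n) * unitMat x y k j -
      unitMat x y i k * entry k j (D : Witt n)) =
      (if j = y then entry i x (D : Witt n) else 0) - if i = x then entry y j (D : Witt n) else 0 := by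
    intro x y
    simp only [unitMat, ite_and, Finset.sum_sub_distrib, mul_ite, ite_mul, mul_one, one_mul, mul_zero,
      zero_mul, Finset.sum_ite_eq', Finset.mem_univ, if_true]
    congr 1
    by_cases h : i = x <;> simp [h]
  have hw : ∑ k, (entry i k (D : Witt n) * unitMat a b k j -
      unitMat a b i k * entry k j (D : Witt n)) = ∑ k, entry k a (D : Witt n) * unitMat k b i j -
      ∑ k, entry b k (D : Witt n) * unitMat a k i j := by
    rw [hu]
    simp only [unitMat, ite_and, mul_ite, mul_one, mul_zero, Finset.sum_ite_eq, Finset.mem_univ, if_true]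
    congr 1
    by_cases h : j = b <;> simp [h]
  cases X with
  | W n => exact hw
  | S n =>
    simp only [projMat, Pi.sub_apply, Pi.smul_apply, smul_eq_mul]
    have h1 : ∑ k, (entry i k (D : Witt n) * ((if a = b then (n : ℂ)⁻¹ else 0) * idMat k j) -
        (if a = b then (n : ℂ)⁻¹ else 0) * idMat i k * entry k j (D : Witt n)) = 0 := by
      simp [idMat, Finset.sum_sub_distrib, mul_comm]
    have h2 : ∑ k, entry k a (D : Witt n) * ((if k = b then (n : ℂ)⁻¹ else 0) * idMat i j) -
        ∑ k, entry b k (D : Witt n) * ((if a = k then (n : ℂ)⁻¹ else 0) * idMat i j) = 0 := by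
      simp
    simp only [Finset.sum_sub_distrib, mul_sub, sub_mul] at hw h1 h2 ⊢
    linear_combination hw - h1 + h2
  | H m =>
    simp only [projMat, Pi.sub_apply, Pi.smul_apply, smul_eq_mul]
    have h1 := hu (partner b) (partner a)
    have h2 : ∑ k, entry k a (D : Witt (2 * m)) *
        (sgn k * sgn b * unitMat (partner b) (partner k) i j) =
        if i = partner b then entry (partner j) a (D : Witt (2 * m)) * (sgn (partner j) * sgn b)
        else 0 := by
      rw [Finset.sum_eq_single (partner j)]
      · simp [unitMat]
      · intro k _ hk
        rw [unitMat, if_neg, mul_zero, mul_zero]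
        rintro ⟨-, rfl⟩
        exact hk (partner_partner k).symm
      · simp
    have h3 : ∑ k, entry b k (D : Witt (2 * m)) *
        (sgn a * sgn k * unitMat (partner k) (partner a) i j) =
        if j = partner a then entry b (partner i) (D : Witt (2 * m)) * (sgn a * sgn (partner i))
        else 0 := by
      rw [Finset.sum_eq_single (partner i)]
      · simp [unitMat]
      · intro k _ hk
        rw [unitMat, if_neg, mul_zero, mul_zero]
        rintro ⟨rfl, -⟩
        exact hk (partner_partner k).symm
      · simp
    have h4 : sgn a * sgn b * ((if j = partner a then entry i (partner b) (D : Witt (2 * m)) else 0) -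
        if i = partner b then entry (partner a) j (D : Witt (2 * m)) else 0) =
        (if i = partner b then entry (partner j) a (D : Witt (2 * m)) * (sgn (partner j) * sgn b)
        else 0) - if j = partner a then
          entry b (partner i) (D : Witt (2 * m)) * (sgn a * sgn (partner i)) else 0 := by
      rw [entry_partner_right D i b, entry_partner D a j, sgn_partner, sgn_partner]
      have hb := sgn_mul_sgn b
      have ha := sgn_mul_sgn a
      split_ifs
      · linear_combination sgn a * sgn i * entry b (partner i) (D : Witt (2 * m)) * hb -
          sgn b * sgn j * entry (partner j) a (D : Witt (2 * m)) * ha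
      · linear_combination sgn a * sgn i * entry b (partner i) (D : Witt (2 * m)) * hb
      · linear_combination - sgn b * sgn j * entry (partner j) a (D : Witt (2 * m)) * ha
      · ring
    have e1 : ∑ k, (entry i k (D : Witt (2 * m)) * (1 / 2 * (unitMat a b k j -
        sgn a * sgn b * unitMat (partner b) (partner a) k j)) -
        1 / 2 * (unitMat a b i k - sgn a * sgn b * unitMat (partner b) (partner a) i k) *
        entry k j (D : Witt (2 * m))) = 1 / 2 * ∑ k, (entry i k (D : Witt (2 * m)) * unitMat a b k j -
      unitMat a b i k * entry k j (D : Witt (2 * m))) - 1 / 2 * (sgn a * sgn b *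
      ∑ k, (entry i k (D : Witt (2 * m)) * unitMat (partner b) (partner a) k j -
      unitMat (partner b) (partner a) i k * entry k j (D : Witt (2 * m)))) := by
      simp only [Finset.mul_sum]
      rw [← Finset.sum_sub_distrib]
      exact Finset.sum_congr rfl fun k _ => by ring
    have e2 : ∀ c u v : Fin (2 * m) → ℂ, ∑ k, c k * (1 / 2 * (u k - v k)) =
        1 / 2 * ∑ k, c k * u k - 1 / 2 * ∑ k, c k * v k := by
      intro c u v
      simp only [Finset.mul_sum]
      rw [← Finset.sum_sub_distrib]
      exact Finset.sum_congr rfl fun k _ => by ring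
    rw [e1, e2, e2, h2, h3, hw, h1, h4]
    ring

end Projection

section Theta

variable {n : ℕ} {X : Series n} {M : Type*} [AddCommGroup M] [Module ℂ M]

/-- The matrix of endomorphisms `κ δ_ab - E_ab`, with `E_ab` projected to `(X_n)_0`: the operators
`∑_a θ_ab ∂_a` are the components of the exterior derivative. -/
def theta (κ : ℂ) (ρ : vf0 X →ₗ⁅ℂ⁆ Module.End ℂ M) (a b : Fin n) : Module.End ℂ M :=
  (if a = b then κ else 0) • 1 - ρ (proj0 X a b)

lemma theta_apply (κ : ℂ) (ρ : vf0 X →ₗ⁅ℂ⁆ Module.End ℂ M) (a b : Fin n) (v : M) :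
    theta κ ρ a b v = (if a = b then κ • v else 0) - ρ (proj0 X a b) v := by
  rw [theta, LinearMap.sub_apply, LinearMap.smul_apply, Module.End.one_apply, ite_smul, zero_smul]

lemma theta_rep (κ : ℂ) (ρ : vf0 X →ₗ⁅ℂ⁆ Module.End ℂ M) (a b : Fin n) (D : vf0 X) (v : M) :
    theta κ ρ a b (ρ D v) = ρ D (theta κ ρ a b v) -
      ∑ i, entry i a (D : Witt n) • theta κ ρ i b v +
      ∑ j, entry b j (D : Witt n) • theta κ ρ a j v := by
  have h := rep_lie ρ D (proj0 X a b) v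
  rw [lie_proj0, map_sub, map_sum, map_sum, LinearMap.sub_apply, LinearMap.sum_apply,
    LinearMap.sum_apply] at h
  have hsm : ∀ (c : ℂ) (E : vf0 X), ρ (c • E) v = c • ρ E v := fun c E => by
    rw [map_smul, LinearMap.smul_apply]
  simp only [hsm] at h
  simp only [theta_apply, map_sub, smul_sub, Finset.sum_sub_distrib, smul_ite, smul_zero,
    Finset.sum_ite_eq, Finset.sum_ite_eq', Finset.mem_univ, if_true, apply_ite (ρ D), map_smul, map_zero]
  rw [eq_sub_iff_add_eq] at h
  rw [← h]
  abel

lemma sum_sum_eq_zero {M : Type*} [AddCommGroup M] [Module ℂ M] (F : Fin n → Fin n → M)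
    (h : ∀ a b, F a b = -F b a) : ∑ a, ∑ b, F a b = 0 := by
  have h1 : ∑ a, ∑ b, F a b = -∑ a, ∑ b, F a b := by
    conv_lhs => rw [Finset.sum_comm]
    simp only [← Finset.sum_neg_distrib]
    exact Finset.sum_congr rfl fun a _ => Finset.sum_congr rfl fun b _ => h b a
  have h2 : (2 : ℂ) • ∑ a, ∑ b, F a b = 0 := by
    rw [two_smul]
    exact eq_neg_iff_add_eq_zero.1 h1
  exact (smul_eq_zero.1 h2).resolve_left two_ne_zero

lemma fockMatrix_apply_apply (M : Fin n → Fin n → ℂ) (f : Fock n) :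
    fockMatrix M f = ∑ a, ∑ b, M a b • create a (annihilate b f) := by
  simp only [fockMatrix_apply, LinearMap.sum_apply, LinearMap.smul_apply, Module.End.mul_apply]

lemma fockMatrix_unitMat (a b : Fin n) : fockMatrix (unitMat a b) = create a * annihilate b := by
  simp [fockMatrix_apply, unitMat, ite_and]

lemma annihilate_create_apply (a b : Fin n) (f : Fock n) : annihilate b (create a f) =
    (if a = b then (1 : ℂ) else 0) • f - create a (annihilate b f) :=
  congrArg (fun g : Module.End ℂ (Fock n) => g f) (annihilate_create a b)

/-- Second derivatives are symmetric, and `d² = 0`. -/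
lemma sum_create_fockMatrix (y : Fin n → Fin n → Fin n → ℂ) (hy : ∀ a i j, y a i j = y i a j)
    (f : Fock n) : ∑ a, create a (fockMatrix (y a) f) = 0 := by
  simp only [fockMatrix_apply_apply, map_sum, map_smul]
  refine sum_sum_eq_zero _ fun a i => ?_
  rw [← Finset.sum_neg_distrib]
  refine Finset.sum_congr rfl fun j _ => ?_
  have h := congrArg (fun g : Module.End ℂ (Fock n) => g (annihilate j f)) (create_create a i)
  simp only [Module.End.mul_apply, LinearMap.neg_apply] at h
  rw [h, hy, smul_neg]

lemma sum_partner {m : ℕ} {M : Type*} [AddCommMonoid M] (F : Fin (2 * m) → M) :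
    ∑ a, F (partner a) = ∑ a, F a :=
  Equiv.sum_comp (Function.Involutive.toPerm partner partner_partner) F

/-- The dual of the relation `d² = 0` under the symplectic form. -/
lemma sum_annihilate_fockMatrix {m : ℕ} (y : Fin (2 * m) → Fin (2 * m) → Fin (2 * m) → ℂ)
    (hy : ∀ a i j, y a i j = y i a j) (hH : ∀ a, MatCond (.H m) (y a)) (f : Fock (2 * m)) :
    ∑ a, sgn a • annihilate (partner a) (fockMatrix (y a) f) = 0 := by
  simp only [fockMatrix_apply_apply, map_sum, map_smul, annihilate_create_apply, smul_sub,
    Finset.smul_sum, Finset.sum_sub_distrib, smul_smul]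
  have h1 : ∑ a, ∑ i, ∑ j, (sgn a * (y a i j * if i = partner a then (1 : ℂ) else 0)) •
      annihilate j f = 0 := by
    have e : ∀ a, ∑ i, ∑ j, (sgn a * (y a i j * if i = partner a then (1 : ℂ) else 0)) •
        annihilate j f = ∑ j, (sgn a * y a (partner a) j) • annihilate j f := by
      intro a
      rw [Finset.sum_eq_single (partner a)]
      · simp
      · intro i _ hi
        simp [hi]
      · simp
    simp only [e]
    rw [Finset.sum_comm]
    refine Finset.sum_eq_zero fun j _ => ?_
    rw [← Finset.sum_smul]
    have h3 : ∑ a, sgn a * y a (partner a) j = -∑ a, sgn a * y a (partner a) j := by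
      conv_lhs => rw [← sum_partner]
      rw [← Finset.sum_neg_distrib]
      refine Finset.sum_congr rfl fun a _ => ?_
      rw [partner_partner, sgn_partner, hy, neg_mul]
    have h4 : ∑ a, sgn a * y a (partner a) j = 0 := by linear_combination h3 / 2
    rw [h4, zero_smul]
  have h2 : ∑ a, ∑ i, ∑ j, (sgn a * y a i j) • create i (annihilate (partner a) (annihilate j f)) = 0 := by
    rw [Finset.sum_comm]
    refine Finset.sum_eq_zero fun i _ => ?_
    have e : ∀ a, ∑ j, (sgn a * y a i j) • create i (annihilate (partner a) (annihilate j f)) =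
        ∑ p, (sgn a * y a i (partner p)) •
          create i (annihilate (partner a) (annihilate (partner p) f)) := fun a =>
      (sum_partner fun j => (sgn a * y a i j) • create i (annihilate (partner a) (annihilate j f))).symm
    simp only [e]
    refine sum_sum_eq_zero _ fun a p => ?_
    have hc := congrArg (fun g : Module.End ℂ (Fock (2 * m)) => g f)
      (annihilate_annihilate (partner a) (partner p))
    simp only [Module.End.mul_apply, LinearMap.neg_apply] at hc
    have hs : sgn a * y a i (partner p) = sgn p * y p i (partner a) := by
      have h : sgn p * y i a (partner p) = sgn a * y i p (partner a) := hH i p a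
      rw [hy a, hy p]
      linear_combination (sgn a * sgn p) * h - sgn a * y i a (partner p) * sgn_mul_sgn p +
        sgn p * y i p (partner a) * sgn_mul_sgn a
    rw [hc, map_neg, smul_neg, hs]
  rw [h1, h2, sub_zero]

/-- The scalar `κ` for which `θ` is the symbol of the exterior derivative on `k`-forms. -/
def kappa : {n : ℕ} → Series n → ℕ → ℂ
  | _, .W _, _ => 1
  | _, .S n, k => 1 - k * (n : ℂ)⁻¹
  | _, .H _, _ => 1 / 2

lemma kappa_sub_ne_zero (X : Series n) {k : ℕ} (hk : k ≤ nX X) (hkn : k < n) :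
    kappa X k - ∑ i : Fin n, (if i.val < k then projMat X ⟨k, hkn⟩ ⟨k, hkn⟩ i i else 0) ≠ 0 := by
  have hu : ∀ x : Fin n, (∑ i : Fin n, if i.val < k then unitMat x x i i else 0) =
      if x.val < k then 1 else 0 := by
    intro x
    rw [Finset.sum_eq_single x]
    · simp [unitMat]
    · intro i _ hi
      simp [unitMat, hi]
    · simp
  have hko : (∑ i : Fin n, if i.val < k then unitMat (⟨k, hkn⟩ : Fin n) ⟨k, hkn⟩ i i else 0) = 0 := by
    rw [hu, if_neg (lt_irrefl k)]
  cases X with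
  | W n =>
    simp only [kappa, projMat]
    rw [hko]
    norm_num
  | S n =>
    have h : ∀ i : Fin n, (if i.val < k then projMat (.S n) ⟨k, hkn⟩ ⟨k, hkn⟩ i i else 0) =
        (if i.val < k then unitMat (⟨k, hkn⟩ : Fin n) ⟨k, hkn⟩ i i else 0) -
        if i.val < k then (n : ℂ)⁻¹ else 0 := by
      intro i
      split_ifs <;> simp [projMat, idMat]
    simp only [h]
    rw [Finset.sum_sub_distrib, hko, ← Finset.sum_filter, Finset.sum_const, Fin.card_filter_val_lt,
      min_eq_right hkn.le, nsmul_eq_mul, kappa]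
    norm_num
  | H m =>
    have h : ∀ i : Fin (2 * m), (if i.val < k then projMat (.H m) ⟨k, hkn⟩ ⟨k, hkn⟩ i i else 0) =
        1 / 2 * (if i.val < k then unitMat (⟨k, hkn⟩ : Fin (2 * m)) ⟨k, hkn⟩ i i else 0) -
        1 / 2 * (if i.val < k then
          unitMat (partner (⟨k, hkn⟩ : Fin (2 * m))) (partner ⟨k, hkn⟩) i i else 0) := by
      intro i
      split_ifs
      · simp [projMat, mul_sub]
      · simp
    simp only [h]
    rw [Finset.sum_sub_distrib, ← Finset.mul_sum, ← Finset.mul_sum, hko, hu, kappa]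
    split_ifs <;> norm_num

lemma fockRep_proj0 (X : Series n) (a b : Fin n) :
    fockRep X (proj0 X a b) = fockMatrix (projMat X a b) := by
  refine congrArg fockMatrix ?_
  funext i j
  exact entry_proj0 X a b i j

/-- On the exterior algebra, `∑_a θ_ab ∂_a` is a part of `ι_b d` (and, for `H`, of the conjugate of
`d` under the symplectic star), so that it kills second derivatives. -/
lemma sum_theta_fockRep (X : Series n) {k : ℕ} (hk : k ≤ nX X) (hkn : k ≤ n) {e f : Fock n}
    (h1 : ∀ i : Fin n, i.val < k → create i e = 0)
    (h2 : ∀ i : Fin n, k ≤ i.val → annihilate i e = 0) (hf : f ∈ cyclic (fockRep X) e)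
    (y : Fin n → vf0 X) (hy : ∀ a i j, entry i j (y a : Witt n) = entry a j (y i : Witt n))
    (b : Fin n) : ∑ a, theta (kappa X k) (fockRep X) a b (fockRep X (y a) f) = 0 := by
  have hcr : ∑ a, annihilate b (create a (fockRep X (y a) f)) = 0 := by
    rw [← map_sum]
    have := sum_create_fockMatrix (fun a i j => entry i j (y a : Witt n)) hy f
    exact (congrArg (annihilate b) this).trans (map_zero _)
  cases X with
  | W n =>
    refine Eq.trans (Finset.sum_congr rfl fun a _ => ?_) hcr
    rw [theta, fockRep_proj0, LinearMap.sub_apply, annihilate_create_apply]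
    simp only [projMat, fockMatrix_unitMat]
    rfl
  | S n =>
    refine Eq.trans (Finset.sum_congr rfl fun a _ => ?_) hcr
    have hg := (isHighestWeight_fock (.S n) hk h1 h2).cyclic_stable (y a) hf
    have hid : fockMatrix idMat (fockRep (.S n) (y a) f) = (k : ℂ) • fockRep (.S n) (y a) f := by
      rw [← sum_create_annihilate_of_mem_cyclic (.S n) hkn h1 h2 hg, fockMatrix_apply_apply]
      simp [idMat]
    rw [theta, fockRep_proj0, LinearMap.sub_apply, annihilate_create_apply]
    simp only [projMat, map_sub, map_smul, fockMatrix_unitMat, LinearMap.sub_apply,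
      LinearMap.smul_apply, hid, Module.End.one_apply, Module.End.mul_apply, kappa]
    by_cases hab : a = b
    · simp only [hab, if_true, sub_smul, smul_smul, mul_comm]
      abel
    · simp [hab]
  | H m =>
    have han := sum_annihilate_fockMatrix (fun a i j => entry i j (y a : Witt (2 * m))) hy
      (fun a => matCond_entry (y a)) f
    have hth : ∀ a g, theta (kappa (.H m) k) (fockRep (.H m)) a b g =
        (1 / 2 : ℂ) • annihilate b (create a g) +
        (1 / 2 * sgn b : ℂ) • create (partner b) (sgn a • annihilate (partner a) g) := by
      intro a g
      rw [theta, fockRep_proj0, LinearMap.sub_apply, annihilate_create_apply]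
      simp only [projMat, map_sub, map_smul, fockMatrix_unitMat, LinearMap.sub_apply,
        LinearMap.smul_apply, Module.End.one_apply, Module.End.mul_apply, kappa, smul_sub, smul_smul]
      by_cases hab : a = b
      · simp only [hab, if_true]
        module
      · simp only [hab, if_false]
        module
    simp only [hth]
    rw [Finset.sum_add_distrib, ← Finset.smul_sum, ← Finset.smul_sum, hcr, ← map_sum]
    have : ∑ a, sgn a • annihilate (partner a) (fockRep (.H m) (y a) f) = 0 := han
    rw [this, map_zero, smul_zero, smul_zero, add_zero]

/-- The relation `d² = 0` for every irreducible representation of highest weight `μ_k`. -/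
lemma sum_theta_rep {ρ : vf0 X →ₗ⁅ℂ⁆ Module.End ℂ M} (hs : StableTrivial ρ) {k : ℕ}
    (hk : k ≤ nX X) (hkn : k ≤ n) {v : M} (hv : IsHighestWeight ρ (mu X k) v) (hv0 : v ≠ 0)
    (y : Fin n → vf0 X) (hy : ∀ a i j, entry i j (y a : Witt n) = entry a j (y i : Witt n))
    (b : Fin n) (w : M) : ∑ a, theta (kappa X k) ρ a b (ρ (y a) w) = 0 := by
  obtain ⟨e, he, h1, h2⟩ := exists_fock_vector hkn
  obtain ⟨U, hU, hsurj, hinj⟩ :=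
    exists_correspondence hs hv (isHighestWeight_fock X hk h1 h2) hv0 he
  obtain ⟨f, hf, hwf⟩ := hsurj w
  have hth : ∀ a, ∀ u ∈ U,
      (theta (kappa X k) ρ a b u.1, theta (kappa X k) (fockRep X) a b u.2) ∈ U := fun a u hu =>
    U.sub_mem (U.smul_mem _ hu) (hU (proj0 X a b) u hu)
  refine hinj _ ?_
  rw [← sum_theta_fockRep X hk hkn h1 h2 hf y hy b]
  have := U.sum_mem (t := Finset.univ) fun a _ => hth a _ (hU (y a) _ hwf)
  refine (congrArg (· ∈ U) (Prod.ext ?_ ?_)).mp this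
  · rw [Prod.fst_sum]
  · rw [Prod.snd_sum]

lemma theta_highestWeight {ρ : vf0 X →ₗ⁅ℂ⁆ Module.End ℂ M} {k : ℕ} (hk : k ≤ nX X) (hkn : k < n)
    {v : M} (hv : IsHighestWeight ρ (mu X k) v) (hv0 : v ≠ 0) :
    theta (kappa X k) ρ ⟨k, hkn⟩ ⟨k, hkn⟩ v ≠ 0 := by
  have hmem : proj0 X ⟨k, hkn⟩ ⟨k, hkn⟩ ∈ cartan X := by
    rw [mem_cartan_iff]
    intro i j hij
    rw [entry_proj0]
    have hu : ∀ x : Fin n, unitMat x x i j = 0 := fun x => if_neg fun h => hij (h.1.trans h.2.symm)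
    cases X with
    | W n => exact hu _
    | S n => simp [projMat, idMat, hij, hu]
    | H m => simp [projMat, hu]
  have h := hv.weight ⟨_, hmem⟩
  rw [mu_apply] at h
  simp only [entry_proj0] at h
  rw [theta, LinearMap.sub_apply, h, LinearMap.smul_apply, Module.End.one_apply, if_pos rfl, ← sub_smul]
  exact smul_ne_zero (kappa_sub_ne_zero X hk hkn) hv0

end Theta

/-! ### Reducibility: the closed forms -/

section Closed

variable {𝔤 : Type*} [LieRing 𝔤] [LieAlgebra ℂ 𝔤] {n : ℕ} {X : Series n} {V : Type*}
  [AddCommGroup V] [Module ℂ V] [LieRingModule (toroidal0 𝔤 X) V]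
  [LieModule ℂ (toroidal0 𝔤 X) V]

lemma dd_rTensor (D : Witt n) (a : Fin n) (w : Poly n ⊗[ℂ] V) :
    (dd a).toLinearMap.rTensor V (D.toLinearMap.rTensor V w) =
      D.toLinearMap.rTensor V ((dd a).toLinearMap.rTensor V w) +
        ∑ j, dd a (D (t j)) • (dd j).toLinearMap.rTensor V w := by
  induction w using TensorProduct.induction_on with
  | zero => simp
  | add w w' hw hw' =>
    simp only [map_add, hw, hw', smul_add, Finset.sum_add_distrib]
    abel
  | tmul f v =>
    simp only [LinearMap.rTensor_tmul, TensorProduct.smul_tmul', smul_eq_mul,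
      ← TensorProduct.sum_tmul, ← TensorProduct.add_tmul]
    exact congrArg (· ⊗ₜ[ℂ] v) (dd_apply_apply D a f)

lemma baseChange_rTensor (D : Witt n) (T : Module.End ℂ V) (w : Poly n ⊗[ℂ] V) :
    T.baseChange (Poly n) (D.toLinearMap.rTensor V w) =
      D.toLinearMap.rTensor V (T.baseChange (Poly n) w) := by
  induction w using TensorProduct.induction_on with
  | zero => simp
  | add w w' hw hw' => simp only [map_add, hw, hw']
  | tmul f v => rfl

variable (𝔤 X V) in
/-- The component at `b` of the exterior derivative, `∑_a θ_ab ∂_a`. -/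
def extDeriv (κ : ℂ) (b : Fin n) : Poly n ⊗[ℂ] V →ₗ[ℂ] Poly n ⊗[ℂ] V :=
  ∑ a, ((theta κ (vfRep 𝔤 X V) a b).baseChange (Poly n)).restrictScalars ℂ ∘ₗ
    (dd a).toLinearMap.rTensor V

lemma extDeriv_apply (κ : ℂ) (b : Fin n) (w : Poly n ⊗[ℂ] V) :
    extDeriv 𝔤 X V κ b w = ∑ a, (theta κ (vfRep 𝔤 X V) a b).baseChange (Poly n)
      ((dd a).toLinearMap.rTensor V w) := by
  simp [extDeriv]

lemma theta_tact (κ : ℂ) (a b : Fin n) (x : Poly n ⊗[ℂ] vf0 X) (w : Poly n ⊗[ℂ] V) :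
    (theta κ (vfRep 𝔤 X V) a b).baseChange (Poly n) (tact (vfSymbol 𝔤 X x) w) =
      tact (vfSymbol 𝔤 X x) ((theta κ (vfRep 𝔤 X V) a b).baseChange (Poly n) w) -
        ∑ i, entryA X i a x • (theta κ (vfRep 𝔤 X V) i b).baseChange (Poly n) w +
        ∑ j, entryA X b j x • (theta κ (vfRep 𝔤 X V) a j).baseChange (Poly n) w := by
  induction x using TensorProduct.induction_on with
  | zero => simp
  | add x y hx hy =>
    simp only [map_add, LinearMap.add_apply, hx, hy, add_smul, Finset.sum_add_distrib]
    abel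
  | tmul f D =>
    induction w using TensorProduct.induction_on with
    | zero => simp
    | add w w' hw hw' =>
      simp only [map_add, hw, hw', smul_add, Finset.sum_add_distrib]
      abel
    | tmul g v =>
      have h := congrArg (fun u => (f * g) ⊗ₜ[ℂ] u) (theta_rep κ (vfRep 𝔤 X V) a b D v)
      simp only [TensorProduct.tmul_add, TensorProduct.tmul_sub, TensorProduct.tmul_sum,
        TensorProduct.tmul_smul, TensorProduct.smul_tmul'] at h
      simp only [vfSymbol_tmul, tact_tmul, LinearMap.baseChange_tmul, entryA_tmul,
        TensorProduct.smul_tmul', smul_eq_mul, smul_mul_assoc]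
      exact h

lemma exists_coefficients {ι : Type*} [Fintype ι] (x : ι → Poly n ⊗[ℂ] vf0 X) :
    ∃ (s : Finset (Fin n →₀ ℕ)) (y : ι → (Fin n →₀ ℕ) → vf0 X),
      (∀ a, x a = ∑ r ∈ s, monomials n r ⊗ₜ y a r) ∧
      ∀ a r i j, entry i j (y a r : Witt n) = (monomials n).repr (entryA X i j (x a)) r := by
  classical
  let e := TensorProduct.equivFinsuppOfBasisLeft (N := vf0 X) (monomials n)
  refine ⟨Finset.univ.biUnion fun a => (e (x a)).support, fun a r => e (x a) r, fun a => ?_,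
    fun a r i j => ?_⟩
  · conv_lhs => rw [← e.symm_apply_apply (x a)]
    rw [TensorProduct.equivFinsuppOfBasisLeft_symm_apply, Finsupp.sum]
    refine Finset.sum_subset (fun r hr => Finset.mem_biUnion.2 ⟨a, Finset.mem_univ _, hr⟩)
      fun r _ hr => ?_
    rw [Finsupp.notMem_support_iff.1 hr, TensorProduct.tmul_zero]
  · have key : ∀ z, entry i j (e z r : Witt n) = (monomials n).repr (entryA X i j z) r := by
      intro z
      induction z using TensorProduct.induction_on with
      | zero => simp
      | tmul f D =>
        rw [entryA_tmul, TensorProduct.equivFinsuppOfBasisLeft_apply_tmul_apply]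
        simp [mul_comm]
      | add y z hy hz =>
        simp only [map_add, Finsupp.add_apply, ← hy, ← hz]
        exact map_add (entry i j) (e y r : Witt n) (e z r : Witt n)
    exact key _

lemma sum_theta_tact {κ : ℂ}
    (h : ∀ y : Fin n → vf0 X, (∀ a i j, entry i j (y a : Witt n) = entry a j (y i : Witt n)) →
      ∀ b v, ∑ a, theta κ (vfRep 𝔤 X V) a b (vfRep 𝔤 X V (y a) v) = 0)
    (x : Fin n → Poly n ⊗[ℂ] vf0 X) (hx : ∀ a i j, entryA X i j (x a) = entryA X a j (x i))
    (b : Fin n) (w : Poly n ⊗[ℂ] V) :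
    ∑ a, (theta κ (vfRep 𝔤 X V) a b).baseChange (Poly n) (tact (vfSymbol 𝔤 X (x a)) w) = 0 := by
  obtain ⟨s, y, hxy, hy⟩ := exists_coefficients x
  induction w using TensorProduct.induction_on with
  | zero => simp
  | add w w' hw hw' => simp only [map_add, Finset.sum_add_distrib, hw, hw', add_zero]
  | tmul g v =>
    have e : ∀ a, (theta κ (vfRep 𝔤 X V) a b).baseChange (Poly n)
        (tact (vfSymbol 𝔤 X (x a)) (g ⊗ₜ v)) = ∑ r ∈ s, (monomials n r * g) ⊗ₜ[ℂ]
          theta κ (vfRep 𝔤 X V) a b (vfRep 𝔤 X V (y a r) v) := by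
      intro a
      rw [hxy a, map_sum, map_sum, LinearMap.sum_apply, map_sum]
      rfl
    simp only [e]
    rw [Finset.sum_comm]
    refine Finset.sum_eq_zero fun r _ => ?_
    rw [← TensorProduct.tmul_sum, h (fun a => y a r), TensorProduct.tmul_zero]
    intro a i j
    rw [hy, hy, hx]

/-- The closed forms are a submodule, because vector fields act by Lie derivatives. -/
lemma extDeriv_vfAct {κ : ℂ}
    (h : ∀ y : Fin n → vf0 X, (∀ a i j, entry i j (y a : Witt n) = entry a j (y i : Witt n)) →
      ∀ b v, ∑ a, theta κ (vfRep 𝔤 X V) a b (vfRep 𝔤 X V (y a) v) = 0)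
    (D : vf X) {w : Poly n ⊗[ℂ] V} (hw : ∀ b, extDeriv 𝔤 X V κ b w = 0) (b : Fin n) :
    extDeriv 𝔤 X V κ b (vfAct 𝔤 V D w) = 0 := by
  simp only [extDeriv_apply] at hw ⊢
  have h1 : ∑ a, (theta κ (vfRep 𝔤 X V) a b).baseChange (Poly n) (tact (vfSymbol 𝔤 X
      ((dd a).toLinearMap.rTensor (vf0 X) (jacobian X D))) w) = 0 := by
    refine sum_theta_tact h _ (fun a i j => ?_) b w
    rw [entryA_act, entryA_act, entryA_jacobian, entryA_jacobian, dd_comm]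
  have h2 : ∀ a, (theta κ (vfRep 𝔤 X V) a b).baseChange (Poly n)
      ((dd a).toLinearMap.rTensor V (vfAct 𝔤 V D w)) =
      (D : Witt n).toLinearMap.rTensor V ((theta κ (vfRep 𝔤 X V) a b).baseChange (Poly n)
        ((dd a).toLinearMap.rTensor V w)) +
      ∑ j, dd a ((D : Witt n) (t j)) • (theta κ (vfRep 𝔤 X V) a b).baseChange (Poly n)
        ((dd j).toLinearMap.rTensor V w) +
      (theta κ (vfRep 𝔤 X V) a b).baseChange (Poly n) (tact (vfSymbol 𝔤 X
        ((dd a).toLinearMap.rTensor (vf0 X) (jacobian X D))) w) +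
      (tact (vfSymbol 𝔤 X (jacobian X D)) ((theta κ (vfRep 𝔤 X V) a b).baseChange (Poly n)
        ((dd a).toLinearMap.rTensor V w)) -
      ∑ i, dd i ((D : Witt n) (t a)) • (theta κ (vfRep 𝔤 X V) i b).baseChange (Poly n)
        ((dd a).toLinearMap.rTensor V w) +
      ∑ j, dd b ((D : Witt n) (t j)) • (theta κ (vfRep 𝔤 X V) a j).baseChange (Poly n)
        ((dd a).toLinearMap.rTensor V w)) := by
    intro a
    rw [vfAct, LinearMap.add_apply, map_add, dd_rTensor, rTensor_tact, vfSymbol_act, map_add, map_add,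
      map_add, map_sum, baseChange_rTensor,
      theta_tact κ a b (jacobian X D)]
    simp only [map_smul, entryA_jacobian]
    abel
  rw [Finset.sum_congr rfl fun a _ => h2 a]
  simp only [Finset.sum_add_distrib, Finset.sum_sub_distrib]
  rw [h1, ← map_sum, ← map_sum, hw, map_zero, map_zero]
  have h3 : ∑ a, ∑ j, dd b ((D : Witt n) (t j)) • (theta κ (vfRep 𝔤 X V) a j).baseChange (Poly n)
        ((dd a).toLinearMap.rTensor V w) = 0 := by
    rw [Finset.sum_comm]
    refine Finset.sum_eq_zero fun j _ => ?_
    rw [← Finset.smul_sum, hw, smul_zero]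
  rw [h3, Finset.sum_comm]
  abel

/-- The closed forms are a proper nonzero submodule. -/
lemma not_isIrreducible_of_theta [Nontrivial V] {κ : ℂ}
    (hg : ∀ x (v : V), ⁅ofG 𝔤 X x, v⁆ = 0) (hK : ∀ i (v : V), ⁅K 𝔤 X i, v⁆ = 0)
    (h : ∀ y : Fin n → vf0 X, (∀ a i j, entry i j (y a : Witt n) = entry a j (y i : Witt n)) →
      ∀ b v, ∑ a, theta κ (vfRep 𝔤 X V) a b (vfRep 𝔤 X V (y a) v) = 0)
    {o : Fin n} {v : V} (ho : theta κ (vfRep 𝔤 X V) o o v ≠ 0) :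
    ¬ LieModule.IsIrreducible ℂ (Toroidal 𝔤 X) (ShenLarsson X V) := by
  rw [isIrreducible_shenLarsson_iff]
  intro hirr
  let p : Submodule ℂ (Poly n ⊗[ℂ] V) := ⨅ b, LinearMap.ker (extDeriv 𝔤 X V κ b)
  have hp : ∀ w, w ∈ p ↔ ∀ b, extDeriv 𝔤 X V κ b w = 0 := by
    intro w
    simp [p]
  have hone : ∀ u : V, u ≠ 0 → (1 : Poly n) ⊗ₜ[ℂ] u ≠ 0 := by
    intro u hu h0
    refine hu ?_
    have := congrArg (coef (V := V) 0) h0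
    rwa [coef_tmul, repr_one, if_pos rfl, one_smul, map_zero] at this
  have hstab : IsStable 𝔤 X p := by
    intro Y w hw
    have h1 : ∀ x, tact (gSymbol 𝔤 X x) w = 0 := by
      intro x
      induction x using TensorProduct.induction_on with
      | zero => simp
      | add x y hx hy => rw [map_add, map_add, LinearMap.add_apply, hx, hy, add_zero]
      | tmul f x =>
        rw [gSymbol_tmul]
        clear hw
        induction w using TensorProduct.induction_on with
        | zero => simp
        | add w w' hw hw' => rw [map_add, hw, hw', add_zero]
        | tmul g v => rw [tact_tmul, hg, TensorProduct.tmul_zero]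
    have h2 : ∀ z, tact (centerSymbol 𝔤 X z) w = 0 := by
      intro z
      rw [centerSymbol_apply, map_sum, LinearMap.sum_apply]
      refine Finset.sum_eq_zero fun i _ => ?_
      clear hw h1
      induction w using TensorProduct.induction_on with
      | zero => simp
      | add w w' hw hw' => rw [map_add, hw, hw', add_zero]
      | tmul g v => rw [tact_tmul, hK, TensorProduct.tmul_zero]
    rw [act_eq, h1, h2, zero_add, zero_add, hp]
    exact extDeriv_vfAct h _ ((hp w).1 hw)
  rcases hirr p hstab with h0 | h0
  · obtain ⟨u, hu⟩ := exists_ne (0 : V)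
    refine hone u hu ?_
    rw [← Submodule.mem_bot ℂ, ← h0, hp]
    intro b
    rw [extDeriv_apply]
    refine Finset.sum_eq_zero fun a _ => ?_
    rw [LinearMap.rTensor_tmul]
    change LinearMap.baseChange _ _ (dd a 1 ⊗ₜ u) = 0
    rw [Derivation.map_one_eq_zero, TensorProduct.zero_tmul, map_zero]
  · have hmem : t o ⊗ₜ[ℂ] v ∈ p := by rw [h0]; trivial
    have := (hp _).1 hmem o
    rw [extDeriv_apply, Finset.sum_eq_single o] at this
    · refine hone _ ho ?_
      rw [LinearMap.rTensor_tmul] at this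
      change LinearMap.baseChange _ _ (dd o (t o) ⊗ₜ v) = 0 at this
      rwa [dd_t, if_pos rfl, LinearMap.baseChange_tmul] at this
    · intro a _ ha
      rw [LinearMap.rTensor_tmul]
      change LinearMap.baseChange _ _ (dd a (t o) ⊗ₜ v) = 0
      rw [dd_t, if_neg ha, TensorProduct.zero_tmul, map_zero]
    · simp

end Closed

section Reducible

lemma nX_le {n : ℕ} (X : Series n) : nX X ≤ n := by
  cases X <;> simp only [nX] <;> omega

lemma IsL0.not_isIrreducible {𝔤 : Type*} [LieRing 𝔤] [LieAlgebra ℂ 𝔤] {n : ℕ} {X : Series n}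
    {V : Type*} [AddCommGroup V] [Module ℂ V] [LieRingModule (toroidal0 𝔤 X) V]
    [LieModule ℂ (toroidal0 𝔤 X) V] [FiniteDimensional ℂ 𝔤] [LieAlgebra.IsSimple ℂ 𝔤]
    {𝔥 : LieSubalgebra ℂ 𝔤} [𝔥.IsCartanSubalgebra]
    {b : (LieAlgebra.IsKilling.rootSystem 𝔥).Base} {k : ℕ} (hk : k ≤ nX X) (hkn : k ≠ n)
    (hL : IsL0 b X 0 (mu X k) 0 V) :
    ¬ LieModule.IsIrreducible ℂ (Toroidal 𝔤 X) (ShenLarsson X V) := by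
  have := nontrivial_of_isIrreducible hL.irreducible
  have hg := hL.ofG_eq_zero
  have hK : ∀ i (v : V), ⁅K 𝔤 X i, v⁆ = 0 := fun i v => (hL.central i v).trans (zero_smul ℂ v)
  have hkn : k < n := lt_of_le_of_ne (hk.trans (nX_le X)) hkn
  obtain ⟨v, hv0, -, -, hpos, hwt⟩ := hL.highestWeight
  have hv : IsHighestWeight (vfRep 𝔤 X V) (mu X k) v := ⟨hpos, hwt⟩
  exact not_isIrreducible_of_theta hg hK
    (sum_theta_rep (stableTrivial_vfRep hL.irreducible hg hK) hk hkn.le hv hv0)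
    (theta_highestWeight hk hkn hv hv0)

end Reducible

/-! ### The weight `μ_n` -/

section Final

variable {𝔤 : Type*} [LieRing 𝔤] [LieAlgebra ℂ 𝔤] {n : ℕ} {X : Series n} {V : Type*}
  [AddCommGroup V] [Module ℂ V] [LieRingModule (toroidal0 𝔤 X) V]
  [LieModule ℂ (toroidal0 𝔤 X) V] [FiniteDimensional ℂ 𝔤] [LieAlgebra.IsSimple ℂ 𝔤]
  {𝔥 : LieSubalgebra ℂ 𝔤} [𝔥.IsCartanSubalgebra]
  {b : (LieAlgebra.IsKilling.rootSystem 𝔥).Base}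

lemma IsL0.isIrreducible_of_top {n : ℕ} {X : Series n} (hn : 2 ≤ n) (hX : X = .W n) {V : Type*}
    [AddCommGroup V] [Module ℂ V] [LieRingModule (toroidal0 𝔤 X) V]
    [LieModule ℂ (toroidal0 𝔤 X) V] {l : Module.Dual ℂ 𝔥} {c : Fin n → ℂ}
    (hL : IsL0 b X l (mu X n) c V) :
    LieModule.IsIrreducible ℂ (Toroidal 𝔤 X) (ShenLarsson X V) := by
  subst hX
  obtain ⟨v, hv, -, -, hpos, hwt⟩ := hL.highestWeight
  exact isIrreducible_of_weight_top hn hL.irreducible hv ⟨hpos, hwt⟩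

lemma eq_witt_of_le_nX {n : ℕ} (hn : 2 ≤ n) (X : Series n) (h : n ≤ nX X) : X = .W n := by
  cases X with
  | W n => rfl
  | S n => simp only [nX] at h; omega
  | H m => simp only [nX] at h; omega

end Final

end

end PolyToroidal

open PolyToroidal
theorem theorem4p8 {n : ℕ} (hn : 2 ≤ n) (X : Series n)
    (𝔤 : Type*) [LieRing 𝔤] [LieAlgebra ℂ 𝔤] [FiniteDimensional ℂ 𝔤] [LieAlgebra.IsSimple ℂ 𝔤]
    (𝔥 : LieSubalgebra ℂ 𝔤) [𝔥.IsCartanSubalgebra] (b : (LieAlgebra.IsKilling.rootSystem 𝔥).Base)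
    (V : Type*) [AddCommGroup V] [Module ℂ V] [LieRingModule (toroidal0 𝔤 X) V]
    [LieModule ℂ (toroidal0 𝔤 X) V] (hV : LieModule.IsIrreducible ℂ (toroidal0 𝔤 X) V) :
    ((¬ ∃ k ≤ nX X, IsL0 b X 0 (mu X k) 0 V) →
      LieModule.IsIrreducible ℂ (Toroidal 𝔤 X) (ShenLarsson X V)) ∧
    (X = Series.W n → IsL0 b X 0 (mu X n) 0 V →
      LieModule.IsIrreducible ℂ (Toroidal 𝔤 X) (ShenLarsson X V)) ∧
    (∀ k ≤ nX X, k ≠ n → IsL0 b X 0 (mu X k) 0 V →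
      ¬ LieModule.IsIrreducible ℂ (Toroidal 𝔤 X) (ShenLarsson X V)) ∧
    (¬ FiniteDimensional ℂ V →
      LieModule.IsIrreducible ℂ (Toroidal 𝔤 X) (ShenLarsson X V)) ∧
    (∀ (l : Module.Dual ℂ 𝔥) (μ : Module.Dual ℂ (cartan X)) (c : Fin n → ℂ), IsL0 b X l μ c V →
      (¬ LieModule.IsIrreducible ℂ (Toroidal 𝔤 X) (ShenLarsson X V) ↔
        (∃ k ≤ nX X, l = 0 ∧ μ = mu X k ∧ c = 0) ∧ (X = Series.W n → μ ≠ mu X n))) := by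
  have hred : ∀ k ≤ nX X, k ≠ n → IsL0 b X 0 (mu X k) 0 V →
      ¬ LieModule.IsIrreducible ℂ (Toroidal 𝔤 X) (ShenLarsson X V) :=
    fun k hk hkn hL => hL.not_isIrreducible hk hkn
  have htop : X = Series.W n → ∀ {l : Module.Dual ℂ 𝔥} {c : Fin n → ℂ}, IsL0 b X l (mu X n) c V →
      LieModule.IsIrreducible ℂ (Toroidal 𝔤 X) (ShenLarsson X V) :=
    fun hX _ _ hL => hL.isIrreducible_of_top hn hX
  refine ⟨fun h => ?_, fun hX hL => htop hX hL, hred, fun h => ?_, fun l μ c hL => ⟨fun h => ?_, ?_⟩⟩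
  · by_contra hirr
    exact h (exists_isL0_of_not_isIrreducible b hn hV hirr)
  · by_contra hirr
    obtain ⟨k, -, hL⟩ := exists_isL0_of_not_isIrreducible b hn hV hirr
    exact h hL.finiteDimensional
  · refine ⟨hL.parameters hn h, fun hX hμ => h ?_⟩
    rw [hμ] at hL
    exact htop hX hL
  · rintro ⟨⟨k, hk, rfl, rfl, rfl⟩, hX⟩
    refine hred k hk (fun hkn => ?_) hL
    subst hkn
    exact hX (eq_witt_of_le_nX hn X hk) rfl
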